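/- Let $s\in(0,1)$, $N>2s$, let $\Omega\subset\mathbb R^N$ be a smooth bounded domain, put $\Omega^c=\mathbb R^N\setminus\Omega$ and let $C_{N,s}=\frac{4^s\Gamma(N/2+s)}{\pi^{N/2}|\Gamma(-s)|}$ be the normalization constant of the fractional Laplacian. Let $f:\mathbb R\to\mathbb R$ be continuous, $F(t)=\int_0^t f(\tau)\,d\tau$, and assume - $(f_1)$ $f(t)=0$ for $t<0$ and $f(t)>0$ for $t>0$; - $(f_2)$ $\lim_{t\to0^+}f(t)/t=0$, and $\lim_{t\to\infty}f(t)/t^{p-1}=0$ for some $2<p<\frac{2N}{N-2s}$; - $(f_3)$ $\lim_{t\to\infty}f(t)/t=+\infty$; - $(f_4)$ (with $a_3=0$) there is $\theta>2$ such that $0<\theta F(t)\le t f(t)$ for all $t>0$; - $(f_5)$ $\inf\{\,t^2/2-F(t): t>0,\ f(t)=t\,\}>0$. For $\varepsilon>0$ and measurable $u,v:\mathbb R^N\to\mathbb R$ put $$\langle u,v\rangle_{\varepsilon,s}=\frac{C_{N,s}\varepsilon^{2s}}2\iint_{\mathbb R^{2N}\setminus(\Omega^c)^2}\frac{(u(x)-u(y))(v(x)-v(y))}{|x-y|^{N+2s}}\,dx\,dy+\int_\Omega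 uv\,dx ,$$ let $H^s_\varepsilon(\Omega)$ be the space of measurable $u$ with $\|u\|_{H^s_\varepsilon}^2=\langle u,u\rangle_{\varepsilon,s}<\infty$, and let $I_\varepsilon(u)=\frac12\|u\|_{H^s_\varepsilon}^2-\int_\Omega F(u)\,dx$. A weak solution of $$(P_\varepsilon)\qquad \varepsilon^{2s}(-\Delta)^su+u=f(u)\ \text{in }\Omega,\qquad \mathcal N_su=0\ \text{in }\mathbb R^N\setminus\Omega$$ ($\mathcal N_s$ being the nonlocal normal derivative $\mathcal N_su(x)=C_{N,s}\int_\Omega\frac{u(x)-u(y)}{|x-y|^{N+2s}}\,dy$) is a function $u\in H^s_\varepsilon(\Omega)$ with $\langle u,v\rangle_{\varepsilon,s}=\int_\Omega f(u)v\,dx$ for all $v\in H^s_\varepsilon(\Omega)$. Then: 1. There are $C>0$ and $\varepsilon_0>0$, independent of $\varepsilon$, such that for every $0<\varepsilon<\varepsilon_0$ the problem $(P_\varepsilon)$ has a weak solution $u_\varepsilon$ that is nonnegative a.e. in $\mathbb R^N$, is not a.e. equal to a constant on $\Omega$, and satisfies $I_\varepsilon(u_\varepsilon)\le C\varepsilon^N$.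 2. For every $\varepsilon>0$ and every weak solution $u$ of $(P_\varepsilon)$, the functions $F(u)$ and $f(u)u$ are integrable on $\Omega$ and $\|u\|_{H^s_\varepsilon}^2=\int_\Omega f(u)u\,dx$. 3. For every $C>0$ there is $K_0>0$, independent of $\varepsilon$ and $u$, such that for every $\varepsilon>0$ every weak solution $u$ of $(P_\varepsilon)$ with $I_\varepsilon(u)\le C\varepsilon^N$ satisfies $\int_\Omega f(u)u\,dx\le K_0\varepsilon^N$. In particular the solutions $u_\varepsilon$ in 1 satisfy $\|u_\varepsilon\|_{H^s_\varepsilon}^2=\int_\Omega f(u_\varepsilon)u_\varepsilon\,dx\le K_0\varepsilon^N$ with $K_0$ independent of $\varepsilon$. -/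

import Mathlib

open MeasureTheory Filter Topology Set
open scoped ContDiff

noncomputable section

namespace FracNeumann

/-- A smooth bounded domain of `ℝ^N`: bounded, open, connected (hence nonempty), and near each
boundary point equal to the sublevel set `{φ < 0}` of a smooth function `φ` with nonvanishing
differential there. -/
structure IsSmoothBoundedDomain {N : ℕ} (Ω : Set (EuclideanSpace ℝ (Fin N))) : Prop where
  isOpen : IsOpen Ω
  isConnected : IsConnected Ω
  isBounded : Bornology.IsBounded Ω
  smooth_boundary : ∀ x₀ ∈ frontier Ω, ∃ (U : Set (EuclideanSpace ℝ (Fin N)))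
    (φ : EuclideanSpace ℝ (Fin N) → ℝ), IsOpen U ∧ x₀ ∈ U ∧ ContDiffOn ℝ ∞ φ U ∧
      φ x₀ = 0 ∧ fderiv ℝ φ x₀ ≠ 0 ∧ Ω ∩ U = {x | φ x < 0} ∩ U

/-- The normalization constant `C_{N,s}` of the fractional Laplacian on `ℝ^N`,
`4^s Γ(N/2 + s) / (π^{N/2} |Γ(-s)|)`. -/
def fracConst (N : ℕ) (s : ℝ) : ℝ :=
  4 ^ s * Real.Gamma ((N : ℝ) / 2 + s) / (Real.pi ^ ((N : ℝ) / 2) * |Real.Gamma (-s)|)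

/-- `(u(x) - u(y)) (v(x) - v(y)) / |x - y|^{N+2s}`. -/
def gagliardoIntegrand {N : ℕ} (s : ℝ) (u v : EuclideanSpace ℝ (Fin N) → ℝ)
    (z : EuclideanSpace ℝ (Fin N) × EuclideanSpace ℝ (Fin N)) : ℝ :=
  (u z.1 - u z.2) * (v z.1 - v z.2) / ‖z.1 - z.2‖ ^ ((N : ℝ) + 2 * s)

/-- The region `ℝ^{2N} ∖ (Ωᶜ)²`. -/
def crossRegion {N : ℕ} (Ω : Set (EuclideanSpace ℝ (Fin N))) :
    Set (EuclideanSpace ℝ (Fin N) × EuclideanSpace ℝ (Fin N)) :=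
  (Ωᶜ ×ˢ Ωᶜ)ᶜ

/-- The inner product `⟨u, v⟩_{ε,s}`. -/
def innerHs {N : ℕ} (Ω : Set (EuclideanSpace ℝ (Fin N))) (s ε : ℝ)
    (u v : EuclideanSpace ℝ (Fin N) → ℝ) : ℝ :=
  fracConst N s * ε ^ (2 * s) / 2 * (∫ z in crossRegion Ω, gagliardoIntegrand s u v z)
    + ∫ x in Ω, u x * v x

/-- Membership in `H^s_ε(Ω)`: `u : ℝ^N → ℝ` is (Lebesgue) measurable and `⟨u, u⟩_{ε,s} < ∞`, i.e.
the two integrals of nonnegative functions in `⟨u, u⟩_{ε,s}` are finite. As a set of functions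
the space is the same for all `ε > 0`. -/
def MemHs {N : ℕ} (Ω : Set (EuclideanSpace ℝ (Fin N))) (s : ℝ)
    (u : EuclideanSpace ℝ (Fin N) → ℝ) : Prop :=
  AEMeasurable u volume ∧ IntegrableOn (gagliardoIntegrand s u u) (crossRegion Ω) volume ∧
    IntegrableOn (fun x => u x * u x) Ω volume

/-- The norm of `H^s_ε(Ω)`. -/
def normHs {N : ℕ} (Ω : Set (EuclideanSpace ℝ (Fin N))) (s ε : ℝ)
    (u : EuclideanSpace ℝ (Fin N) → ℝ) : ℝ :=
  Real.sqrt (innerHs Ω s ε u u)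

/-- Weak solutions of `ε^{2s} (-Δ)^s u + u = f(u)` in `Ω`, `𝓝_s u = 0` in `ℝ^N ∖ Ω`. -/
def IsWeakSolution {N : ℕ} (Ω : Set (EuclideanSpace ℝ (Fin N))) (s ε : ℝ) (f : ℝ → ℝ)
    (u : EuclideanSpace ℝ (Fin N) → ℝ) : Prop :=
  MemHs Ω s u ∧ ∀ v : EuclideanSpace ℝ (Fin N) → ℝ, MemHs Ω s v →
    innerHs Ω s ε u v - ∫ x in Ω, f (u x) * v x = 0

/-- `F(t) = ∫₀ᵗ f`. -/
def primitive (f : ℝ → ℝ) (t : ℝ) : ℝ := ∫ τ in (0 : ℝ)..t, f τ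

/-- The energy functional `I_ε`. -/
def energy {N : ℕ} (Ω : Set (EuclideanSpace ℝ (Fin N))) (s ε : ℝ) (f : ℝ → ℝ)
    (u : EuclideanSpace ℝ (Fin N) → ℝ) : ℝ :=
  fracConst N s * ε ^ (2 * s) / 4 *
      (∫ z in crossRegion Ω, |u z.1 - u z.2| ^ 2 / ‖z.1 - z.2‖ ^ ((N : ℝ) + 2 * s))
    + 1 / 2 * (∫ x in Ω, |u x| ^ 2) - ∫ x in Ω, primitive f (u x)

/-- The structural assumptions on the nonlinearity `f`, with parameter `a₃ ≥ 0` in the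
Ambrosetti–Rabinowitz condition `f4`. Since `F(0) = 0`, for `a₃ = 0` that condition is meant for
all `t > 0`; for `a₃ > 0` the clause `0 < t` is redundant. -/
structure Nonlinearity (N : ℕ) (s : ℝ) (a₃ : ℝ) (f : ℝ → ℝ) : Prop where
  continuous : Continuous f
  f1 : (∀ t, t < 0 → f t = 0) ∧ ∀ t, 0 < t → 0 < f t
  f2 : Tendsto (fun t => f t / t) (𝓝[>] 0) (𝓝 0) ∧
    ∃ p : ℝ, 2 < p ∧ p < 2 * (N : ℝ) / ((N : ℝ) - 2 * s) ∧
      Tendsto (fun t => f t / t ^ (p - 1)) atTop (𝓝 0)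
  f3 : Tendsto (fun t => f t / t) atTop atTop
  f4 : ∃ θ : ℝ, 2 < θ ∧ ∀ t, 0 < t → a₃ ≤ t →
    0 < θ * primitive f t ∧ θ * primitive f t ≤ t * f t
  f5 : 0 < sInf ((fun t => t ^ 2 / 2 - primitive f t) '' {t : ℝ | 0 < t ∧ f t = t})

end FracNeumann

end

/-! Weak solutions are critical points of `‖x‖² / 2 - ∫ F (T x)` on a Hilbert space that realizes
`H^s_ε(Ω)`, where `T` restricts a function to `Ω`. The Ambrosetti–Rabinowitz condition makes `F`
superhomogeneous of degree `θ > 2`, the behaviour of `f` at 0 makes the origin a strict local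
minimum, and subcritical growth together with compactness of `T` makes the gradient `K` of the
nonlinear part compact. A mountain pass argument (`exists_mountainPass`, `exists_criticalPoint`,
`exists_weakSolution`) then gives a solution whose energy is positive and at most the maximum of the
energy along a segment from 0 to a point of negative energy.

The analytic input rests on the measure density `|B(x, r) ∩ Ω| ≥ c r^N`, which follows from
smoothness of the boundary. Comparing `u(x)` with nearby values of `u` yields the subcritical
Sobolev embedding (`sobolevEmbedding_of_lt`), and comparing it with local averages yields
compactness in `L²(Ω)` (`isCompactOperator_of_localEnergy_le`). The space is complete because values
outside `Ω` can be recovered from the difference quotients and the values inside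
(`isClosed_hsSubmodule`).

A tent function of width `ε` gives a mountain pass level of order `ε^N` (`exists_energy_tent_le`). A
solution constant on `Ω` has energy 0 or at least `|Ω| m`, where `m > 0` comes from `f5`
(`IsWeakSolution.energy_of_ae_const`), so for small `ε` the solution is not constant. Testing with
the negative part shows that it is nonnegative. The remaining claims come from testing with `u`
itself: `‖u‖² = ∫ f(u) u`, and Ambrosetti–Rabinowitz then bounds this integral by a multiple of the
energy. -/

noncomputable section

namespace FracNeumann

/-! ### Mountain pass theorem in an abstract Hilbert space. -/

section MountainPass

open scoped RealInnerProductSpace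

variable {H : Type*} [NormedAddCommGroup H] [InnerProductSpace ℝ H]

/-- The functional `x ↦ ‖x‖² / 2 - Φ x`. -/
def semilinearEnergy (Φ : H → ℝ) (x : H) : ℝ := ‖x‖ ^ 2 / 2 - Φ x

/-- Weighted AM–GM for `τ^θ` and `1` with weights `2/θ` and `1 - 2/θ`. It allows the quadratic and
the superhomogeneous part of the energy to be compared through the single factor `τ^θ - 1`. -/
lemma sq_le_weighted_rpow {τ θ : ℝ} (hτ : 1 ≤ τ) (hθ : 2 < θ) :
    τ ^ 2 ≤ 2 / θ * τ ^ θ + (1 - 2 / θ) := by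
  have h0 : 0 ≤ τ := by linarith
  have hle : 2 / θ ≤ 1 := by rw [div_le_one (by linarith)]; linarith
  have h := Real.geom_mean_le_arith_mean2_weighted (w₁ := 2 / θ) (w₂ := 1 - 2 / θ)
    (p₁ := τ ^ θ) (p₂ := 1) (by positivity) (by linarith) (by positivity) zero_le_one (by ring)
  rw [Real.one_rpow, mul_one, ← Real.rpow_mul h0, mul_div_cancel₀ _ (by linarith : θ ≠ 0)] at h
  rw [mul_one] at h
  exact_mod_cast h

/-- Superhomogeneity of `Φ` makes the functional decrease along rays where `x` is large. -/
lemma semilinearEnergy_smul_le {Φ : H → ℝ} {θ : ℝ} (hθ : 2 < θ)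
    (hΦ : ∀ (x : H) (τ : ℝ), 1 ≤ τ → τ ^ θ * Φ x ≤ Φ (τ • x)) (x : H) {τ : ℝ} (hτ : 1 ≤ τ) :
    semilinearEnergy Φ (τ • x) ≤ semilinearEnergy Φ x +
      (τ ^ θ - 1) * (semilinearEnergy Φ x - (1 / 2 - 1 / θ) * ‖x‖ ^ 2) := by
  have h1 := hΦ x τ hτ
  have h2 := mul_le_mul_of_nonneg_right (sq_le_weighted_rpow hτ hθ) (sq_nonneg ‖x‖)
  have h3 : ‖τ • x‖ ^ 2 = τ ^ 2 * ‖x‖ ^ 2 := by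
    rw [norm_smul, mul_pow, Real.norm_eq_abs, sq_abs]
  have h4 : (1 : ℝ) / θ = 2 / θ / 2 := by ring
  simp only [semilinearEnergy, h3, h4]
  nlinarith

/-- Palais–Smale on bounded sets: if `x n - K (x n) → 0`, compactness makes a subsequence of `K (x
n)` converge, hence also of `x n`, and the limit is a fixed point at level `c`. -/
lemma exists_norm_sub_ge_of_no_fixedPoint {Φ : H → ℝ} {K : H → H} (hΦ : Continuous Φ)
    (hK : Continuous K) {S : Set H} (hS : IsCompact S) {R c : ℝ}
    (hKS : ∀ x, ‖x‖ ≤ R → K x ∈ S) (hc : ∀ x, K x = x → semilinearEnergy Φ x ≠ c) :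
    ∃ δ : ℝ, 0 < δ ∧ ∀ x, ‖x‖ ≤ R → |semilinearEnergy Φ x - c| ≤ δ → δ ≤ ‖x - K x‖ := by
  by_contra! hcon
  have hpos : ∀ n : ℕ, (0 : ℝ) < 1 / ((n : ℝ) + 1) := fun n => by positivity
  choose x hxR hxc hxK using fun n : ℕ => hcon (1 / ((n : ℝ) + 1)) (hpos n)
  obtain ⟨z, -, φ, hφ, hz⟩ := hS.tendsto_subseq (fun n => hKS _ (hxR n))
  have hlim := tendsto_one_div_add_atTop_nhds_zero_nat (𝕜 := ℝ)
  have h1 : Tendsto (fun n => x n - K (x n)) atTop (𝓝 0) :=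
    squeeze_zero_norm (fun n => (hxK n).le) hlim
  have h2 : Tendsto (fun n => semilinearEnergy Φ (x n) - c) atTop (𝓝 0) :=
    squeeze_zero_norm (fun n => hxc n) hlim
  have h3 : Tendsto (fun n => x (φ n)) atTop (𝓝 z) := by
    have := (h1.comp hφ.tendsto_atTop).add hz
    simpa [Function.comp_def] using this
  have hI : Continuous (semilinearEnergy Φ) := by unfold semilinearEnergy; fun_prop
  have h4 : K z = z := by
    have := tendsto_nhds_unique ((hK.tendsto z).comp h3) hz
    exact this
  refine hc z h4 ?_
  have h5 : Tendsto (fun n => semilinearEnergy Φ (x (φ n)) - c) atTop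
      (𝓝 (semilinearEnergy Φ z - c)) := ((hI.tendsto z).comp h3).sub_const c
  have := tendsto_nhds_unique h5 (h2.comp hφ.tendsto_atTop)
  linarith

/-- Here `k` plays the gradient of `Φ` at `x`, so `x - k` is the gradient of the energy; the extra
`‖h‖ / 2` is the exact second order term of `‖·‖² / 2`. -/
lemma semilinearEnergy_add_le {Φ : H → ℝ} {x h k : H} {A : ℝ}
    (hΦ : Φ x + ⟪k, h⟫ - A * ‖h‖ ≤ Φ (x + h)) :
    semilinearEnergy Φ (x + h) ≤
      semilinearEnergy Φ x + ⟪x - k, h⟫ + (A + ‖h‖ / 2) * ‖h‖ := by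
  have h1 := norm_add_sq_real x h
  simp only [semilinearEnergy, inner_sub_left, h1]
  nlinarith

/-- One explicit gradient step lowers the functional uniformly on bounded sets. -/
lemma exists_gradient_step {Φ : H → ℝ} {K : H → H} {S : Set H} (hS : IsCompact S) {R : ℝ}
    (hKS : ∀ x, ‖x‖ ≤ R → K x ∈ S)
    (hΦd : ∀ η : ℝ, 0 < η → ∃ L : ℝ, 0 ≤ L ∧ ∀ x h : H, ‖x‖ ≤ R → ‖h‖ ≤ 1 →
      Φ x + ⟪K x, h⟫ - (η + L * ‖h‖) * ‖h‖ ≤ Φ (x + h)) {δ : ℝ} (hδ : 0 < δ) :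
    ∃ t : ℝ, 0 < t ∧ ∀ x, ‖x‖ ≤ R → δ ≤ ‖x - K x‖ → ∀ σ : ℝ, 0 ≤ σ → σ ≤ 1 →
      semilinearEnergy Φ (x - (t * σ) • (x - K x)) ≤
        semilinearEnergy Φ x - t * σ * (δ ^ 2 / 2) := by
  obtain ⟨M, hM⟩ := hS.isBounded.exists_norm_le
  obtain ⟨L, hL0, hL⟩ := hΦd (δ / 4) (by positivity)
  set M' := |R| + |M| + 1 with hM'
  have hM'0 : 0 < M' := by positivity
  -- The first bound keeps the step of norm at most 1, where the expansion is available. The second,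
  -- with `η = δ / 4`, lets half of the first order gain absorb the error.
  set t := min (1 / M') (1 / (4 * (L + 1))) with ht
  have ht0 : 0 < t := by positivity
  refine ⟨t, ht0, fun x hx hδx σ hσ0 hσ1 => ?_⟩
  set g := x - K x with hg
  have hgM : ‖g‖ ≤ M' := by
    have h1 := norm_sub_le x (K x)
    have h2 := hM _ (hKS x hx)
    have := le_abs_self R; have := le_abs_self M
    linarith
  have htM : t * M' ≤ 1 := by
    have := min_le_left (1 / M') (1 / (4 * (L + 1)))
    calc t * M' ≤ 1 / M' * M' := by gcongr
      _ = 1 := by field_simp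
  have htL : t * (4 * (L + 1)) ≤ 1 := by
    have := min_le_right (1 / M') (1 / (4 * (L + 1)))
    calc t * (4 * (L + 1)) ≤ 1 / (4 * (L + 1)) * (4 * (L + 1)) := by gcongr
      _ = 1 := by field_simp
  have hτ0 : 0 ≤ t * σ := by positivity
  have hτt : t * σ ≤ t := by nlinarith
  set τ := t * σ with hτ
  have hnorm : ‖-(τ • g)‖ = τ * ‖g‖ := by
    rw [norm_neg, norm_smul, Real.norm_eq_abs, abs_of_nonneg hτ0]
  have hn1 : ‖-(τ • g)‖ ≤ 1 := by
    rw [hnorm]; nlinarith [norm_nonneg g]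
  have h1 := semilinearEnergy_add_le (hL x (-(τ • g)) hx hn1)
  rw [← hg, hnorm, inner_neg_right, inner_smul_right, real_inner_self_eq_norm_sq,
    ← sub_eq_add_neg] at h1
  refine h1.trans ?_
  have hgg : 0 < ‖g‖ := hδ.trans_le hδx
  have h2 : δ / 4 + L * (τ * ‖g‖) + τ * ‖g‖ / 2 ≤ ‖g‖ / 2 := by
    have : (L + 1 / 2) * τ ≤ 1 / 4 := by nlinarith
    nlinarith
  have h3 : (δ / 4 + L * (τ * ‖g‖) + τ * ‖g‖ / 2) * (τ * ‖g‖) ≤ ‖g‖ / 2 * (τ * ‖g‖) := by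
    gcongr
  have h4 : δ ^ 2 ≤ ‖g‖ ^ 2 := by gcongr
  nlinarith

/-- The mountain pass theorem for `‖x‖² / 2 - Φ x` with superhomogeneous `Φ` and completely
continuous gradient `K` of `Φ`. -/
theorem exists_mountainPass {Φ : H → ℝ} {K : H → H} (hΦc : Continuous Φ) (hKc : Continuous K)
    (hΦ0 : Φ 0 = 0)
    (hKS : ∀ R : ℝ, ∃ S : Set H, IsCompact S ∧ ∀ x, ‖x‖ ≤ R → K x ∈ S)
    (hΦd : ∀ R η : ℝ, 0 < η → ∃ L : ℝ, 0 ≤ L ∧ ∀ x h : H, ‖x‖ ≤ R → ‖h‖ ≤ 1 →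
      Φ x + ⟪K x, h⟫ - (η + L * ‖h‖) * ‖h‖ ≤ Φ (x + h))
    {θ : ℝ} (hθ : 2 < θ) (hΦθ : ∀ (x : H) (τ : ℝ), 1 ≤ τ → τ ^ θ * Φ x ≤ Φ (τ • x))
    {r α : ℝ} (hr : 0 < r) (hα : 0 < α) (hIr : ∀ x, ‖x‖ = r → α ≤ semilinearEnergy Φ x)
    (hI0 : ∀ x, ‖x‖ ≤ r → 0 ≤ semilinearEnergy Φ x)
    {e : H} {B : ℝ} (he : semilinearEnergy Φ e < 0)
    (hB : ∀ τ ∈ Icc (0 : ℝ) 1, semilinearEnergy Φ (τ • e) ≤ B) :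
    ∃ x, K x = x ∧ 0 < semilinearEnergy Φ x ∧ semilinearEnergy Φ x ≤ B := by
  set I := semilinearEnergy Φ with hI
  have hIc : Continuous I := by rw [hI]; unfold semilinearEnergy; fun_prop
  have hIzero : I 0 = 0 := by simp [hI, semilinearEnergy, hΦ0]
  -- The endpoint is free in `{I < 0}` and is not pinned at `e`, so the radial push below may move
  -- it.
  set P : Set ℝ := {m | ∃ γ : ℝ → H, Continuous γ ∧ γ 0 = 0 ∧ I (γ 1) < 0 ∧
    ∀ t ∈ Icc (0 : ℝ) 1, I (γ t) ≤ m} with hP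
  have hPα : ∀ m ∈ P, α ≤ m := by
    rintro m ⟨γ, hγ, hγ0, hγ1, hm⟩
    have h1 : r ≤ ‖γ 1‖ := by
      by_contra! h
      exact absurd (hI0 _ h.le) (not_le.2 hγ1)
    obtain ⟨t, ht, hrt⟩ := intermediate_value_Icc (zero_le_one' ℝ)
      (f := fun t => ‖γ t‖) (by fun_prop) (show r ∈ Icc ‖γ 0‖ ‖γ 1‖ by simp [hγ0, hr.le, h1])
    exact (hIr _ hrt).trans (hm t ht)
  have hPB : B ∈ P := ⟨fun t => t • e, by fun_prop, by simp, by simpa using he, hB⟩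
  have hPbdd : BddBelow P := ⟨α, hPα⟩
  set c := sInf P with hc
  have hcα : α ≤ c := le_csInf ⟨B, hPB⟩ hPα
  have hcB : c ≤ B := csInf_le hPbdd hPB
  by_contra! hcon
  have hno : ∀ x, K x = x → I x ≠ c := by
    intro x hx h
    have := hcon x hx (by linarith)
    linarith
  have hθ' : 0 < 1 / 2 - 1 / θ := by
    have : 1 / θ < 1 / 2 := one_div_lt_one_div_of_lt (by norm_num) hθ
    linarith
  -- Beyond radius `R`, a point of energy at most `c + 1` loses energy when scaled up. This replaces
  -- the boundedness of Palais–Smale sequences.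
  set R := max 1 ((c + 2) / (1 / 2 - 1 / θ)) with hR
  have hR1 : 1 ≤ R := le_max_left _ _
  have hRc : c + 2 ≤ (1 / 2 - 1 / θ) * R ^ 2 := by
    have h1 : c + 2 ≤ R * (1 / 2 - 1 / θ) := by
      rw [← div_le_iff₀ hθ']; exact le_max_right _ _
    nlinarith
  -- Points that matter after the push have norm at most `2 * (R + 1)`: they come from norm at most
  -- `R + 1`, scaled by a factor at most 2.
  obtain ⟨S, hS, hKS'⟩ := hKS (2 * (R + 1))
  obtain ⟨δ, hδ, hδI⟩ := exists_norm_sub_ge_of_no_fixedPoint hΦc hKc hS hKS' hno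
  obtain ⟨t, ht, hstep⟩ := exists_gradient_step hS hKS' (hΦd _) hδ
  -- The bound `ρ ≤ c / 2` keeps `c - ρ` positive, so the deformation fixes the origin and every
  -- point of negative energy.
  set ρ := min δ (min (c / 2) 1) with hρ
  have hρ0 : 0 < ρ := by have : 0 < c := by linarith
                         positivity
  have hρδ : ρ ≤ δ := min_le_left _ _
  have hρc : ρ ≤ c / 2 := (min_le_right _ _).trans (min_le_left _ _)
  have hρ1 : ρ ≤ 1 := (min_le_right _ _).trans (min_le_right _ _)
  -- A full gradient step gains at least `2 * ρ'`, enough to pass from level `c + ρ'` to `c - ρ'`.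
  set ρ' := min ρ (t * (δ ^ 2 / 2) / 2) with hρ'
  have hρ'0 : 0 < ρ' := by positivity
  have hρ'ρ : ρ' ≤ ρ := min_le_left _ _
  have hρ't : 2 * ρ' ≤ t * (δ ^ 2 / 2) := by
    have := min_le_right ρ (t * (δ ^ 2 / 2) / 2)
    linarith
  obtain ⟨m, ⟨γ, hγ, hγ0, hγ1, hm⟩, hmc⟩ := exists_lt_of_csInf_lt ⟨B, hPB⟩
    (show sInf P < c + ρ' by rw [← hc]; linarith)
  -- radial push of the far part of the path
  set χ : H → ℝ := fun x => 1 + max 0 (min 1 (‖x‖ - R)) with hχ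
  have hχ1 : ∀ x, 1 ≤ χ x := fun x => by simp [hχ]
  have hχ2 : ∀ x, χ x ≤ 2 := fun x => by
    have : max 0 (min 1 (‖x‖ - R)) ≤ 1 := max_le zero_le_one (min_le_left _ _)
    simp only [hχ]; linarith
  have hpush : ∀ x, I x ≤ c + 1 → I (χ x • x) ≤ I x ∧ (R + 1 ≤ ‖x‖ → I (χ x • x) ≤ I x - 3) := by
    intro x hx
    rcases le_total ‖x‖ R with h | h
    · have : χ x = 1 := by
        have : min 1 (‖x‖ - R) ≤ 0 := (min_le_right _ _).trans (by linarith)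
        simp [hχ, this]
      exact ⟨by simp [this], fun h' => by linarith⟩
    · have h1 := semilinearEnergy_smul_le hθ hΦθ x (hχ1 x)
      have h2 : I x - (1 / 2 - 1 / θ) * ‖x‖ ^ 2 ≤ -1 := by
        have : R ^ 2 ≤ ‖x‖ ^ 2 := by gcongr
        nlinarith
      have h3 : 1 ≤ χ x ^ θ := Real.one_le_rpow (hχ1 x) (by linarith)
      refine ⟨by nlinarith, fun h' => ?_⟩
      have h4 : χ x = 2 := by
        have : min 1 (‖x‖ - R) = 1 := min_eq_left (by linarith)
        simp [hχ, this]; norm_num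
      have h5 : (2 : ℝ) ^ (2 : ℝ) ≤ χ x ^ θ := by
        rw [h4]; exact Real.rpow_le_rpow_of_exponent_le (by norm_num) hθ.le
      have h6 : (2 : ℝ) ^ (2 : ℝ) = 4 := by norm_num
      nlinarith
  -- truncated gradient step
  set η : H → ℝ := fun x => max 0 (min 1 ((I x - (c - ρ)) / (ρ / 2))) with hη
  have hη0 : ∀ x, 0 ≤ η x := fun x => le_max_left _ _
  have hη1 : ∀ x, η x ≤ 1 := fun x => max_le zero_le_one (min_le_left _ _)
  set D : H → H := fun x => x - (t * η x) • (x - K x) with hD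
  have hDfix : ∀ x, I x ≤ c - ρ → D x = x := by
    intro x hx
    have h1 : (I x - (c - ρ)) / (ρ / 2) ≤ 0 :=
      div_nonpos_of_nonpos_of_nonneg (by linarith) (by linarith)
    have : η x = 0 := by simp only [hη]; exact max_eq_left ((min_le_right _ _).trans h1)
    simp [hD, this]
  have hχc : Continuous χ := by fun_prop
  have hηc : Continuous η := by fun_prop
  have hDc : Continuous D := by fun_prop
  have key : ∀ x, I x ≤ c + ρ' → I (D (χ x • x)) ≤ c - ρ / 2 ∨ I (D (χ x • x)) ≤ c - ρ' := by
    intro x hx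
    obtain ⟨hp1, hp2⟩ := hpush x (by linarith)
    set y := χ x • x with hy
    rcases le_or_gt (I y) (c - ρ) with h | h
    · left; rw [hDfix y h]; linarith
    · have hxR : ‖x‖ ≤ R + 1 := by
        by_contra! h'
        have := hp2 h'.le
        linarith
      have hyR : ‖y‖ ≤ 2 * (R + 1) := by
        rw [hy, norm_smul, Real.norm_eq_abs, abs_of_nonneg (by linarith [hχ1 x])]
        have := hχ2 x
        gcongr
      have h1 : δ ≤ ‖y - K y‖ := hδI y hyR (by rw [← hI, abs_le]; constructor <;> linarith)
      have h2 := hstep y hyR h1 (η y) (hη0 y) (hη1 y)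
      rcases le_or_gt (I y) (c - ρ / 2) with h' | h'
      · left
        refine h2.trans ?_
        have : 0 ≤ t * η y * (δ ^ 2 / 2) := by have := hη0 y; positivity
        linarith
      · right
        have h3 : η y = 1 := by
          have : 1 ≤ (I y - (c - ρ)) / (ρ / 2) := by
            rw [le_div_iff₀ (by positivity)]; linarith
          simp [hη, min_eq_left this]
        refine h2.trans ?_
        rw [h3]; linarith
  -- The pushed and deformed path stays strictly below level `c`, contradicting the choice of `c` as
  -- infimum.
  have hmem : max (c - ρ / 2) (c - ρ') ∈ P := by
    refine ⟨fun t => D (χ (γ t) • γ t), by fun_prop, ?_, ?_, fun t ht => ?_⟩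
    · simp only [hγ0, smul_zero]
      exact hDfix 0 (by rw [hIzero]; linarith)
    · have h1 := (hpush (γ 1) (by linarith)).1
      simp only
      rw [hDfix _ (by linarith)]
      linarith
    · rcases key (γ t) ((hm t ht).trans hmc.le) with h | h
      · exact h.trans (le_max_left _ _)
      · exact h.trans (le_max_right _ _)
  have := csInf_le hPbdd hmem
  rw [← hc] at this
  rcases le_max_iff.1 this with h | h <;> linarith

end MountainPass

/-! ### Growth, continuity and superhomogeneity of `f` and its primitive. -/

section NonlinearTerm

/-- Replacing the smaller of `a`, `b` by the larger bounds the product by a pure `p`-th power. -/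
lemma rpow_sub_one_mul_le {a b p : ℝ} (ha : 0 ≤ a) (hb : 0 ≤ b) (hp : 1 < p) :
    a ^ (p - 1) * b ≤ a ^ p + b ^ p := by
  rcases le_total a b with h | h
  · calc a ^ (p - 1) * b ≤ b ^ (p - 1) * b := by
          gcongr
      _ = b ^ p := by
          rcases hb.eq_or_lt with rfl | hb
          · rw [mul_zero, Real.zero_rpow (by linarith)]
          · rw [← Real.rpow_add_one hb.ne']; ring_nf
      _ ≤ a ^ p + b ^ p := by have := Real.rpow_nonneg ha p; linarith
  · calc a ^ (p - 1) * b ≤ a ^ (p - 1) * a := by gcongr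
      _ = a ^ p := by
          rcases ha.eq_or_lt with rfl | ha
          · rw [mul_zero, Real.zero_rpow (by linarith)]
          · rw [← Real.rpow_add_one ha.ne']; ring_nf
      _ ≤ a ^ p + b ^ p := by have := Real.rpow_nonneg hb p; linarith

variable {f : ℝ → ℝ}

lemma eq_zero_of_nonpos (hfc : Continuous f) (hneg : ∀ t, t < 0 → f t = 0) {t : ℝ} (ht : t ≤ 0) :
    f t = 0 := by
  have h1 : IsClosed {t | f t = 0} := isClosed_eq hfc continuous_const
  have h2 : closure (Iio (0 : ℝ)) ⊆ {t | f t = 0} := h1.closure_subset_iff.2 hneg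
  rw [closure_Iio] at h2
  exact h2 ht

lemma hasDerivAt_primitive (hfc : Continuous f) (t : ℝ) : HasDerivAt (primitive f) (f t) t :=
  intervalIntegral.integral_hasDerivAt_right (hfc.intervalIntegrable _ _)
    (hfc.stronglyMeasurableAtFilter _ _) hfc.continuousAt

lemma continuous_primitive (hfc : Continuous f) : Continuous (primitive f) :=
  continuous_iff_continuousAt.2 fun t => (hasDerivAt_primitive hfc t).continuousAt

@[simp] lemma primitive_zero : primitive f 0 = 0 := by simp [primitive]

lemma primitive_of_nonpos (hf0 : ∀ t, t ≤ 0 → f t = 0) {t : ℝ} (ht : t ≤ 0) :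
    primitive f t = 0 := by
  have : primitive f t = ∫ τ in (0 : ℝ)..t, (0 : ℝ) := by
    refine intervalIntegral.integral_congr fun x hx => ?_
    rw [uIcc_of_ge ht] at hx
    exact hf0 x hx.2
  simpa using this

lemma monotone_primitive (hfc : Continuous f) (hf : ∀ t, 0 ≤ f t) : Monotone (primitive f) :=
  monotone_of_deriv_nonneg (fun t => (hasDerivAt_primitive hfc t).differentiableAt)
    fun t => by rw [(hasDerivAt_primitive hfc t).deriv]; exact hf t

lemma primitive_nonneg (hfc : Continuous f) (hf0 : ∀ t, t ≤ 0 → f t = 0) (hf : ∀ t, 0 ≤ f t)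
    (t : ℝ) : 0 ≤ primitive f t := by
  rcases le_total t 0 with h | h
  · rw [primitive_of_nonpos hf0 h]
  · simpa using monotone_primitive hfc hf h

lemma primitive_add_sub (hfc : Continuous f) (a b : ℝ) :
    primitive f (a + b) - primitive f a - f a * b = ∫ ξ in a..(a + b), (f ξ - f a) := by
  rw [intervalIntegral.integral_sub (hfc.intervalIntegrable _ _)
    (continuous_const.intervalIntegrable _ _), intervalIntegral.integral_const, primitive,
    primitive, intervalIntegral.integral_interval_sub_left (hfc.intervalIntegrable _ _)
    (hfc.intervalIntegrable _ _)]
  simp [mul_comm]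

/-- The growth of `f` from its behaviour at `0` and at `∞`. -/
lemma exists_growth (hfc : Continuous f) (hf0 : ∀ t, t ≤ 0 → f t = 0)
    (h0 : Tendsto (fun t => f t / t) (𝓝[>] 0) (𝓝 0)) {p : ℝ}
    (hinf : Tendsto (fun t => f t / t ^ (p - 1)) atTop (𝓝 0)) {η : ℝ} (hη : 0 < η) :
    ∃ C : ℝ, 0 ≤ C ∧ ∀ t, |f t| ≤ η * |t| + C * |t| ^ (p - 1) := by
  obtain ⟨δ, hδ, hδf⟩ : ∃ δ : ℝ, 0 < δ ∧ ∀ t, 0 < t → t < δ → |f t| ≤ η * t := by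
    have h1 := (Metric.tendsto_nhdsWithin_nhds.1 h0) η hη
    obtain ⟨δ, hδ, h⟩ := h1
    refine ⟨δ, hδ, fun t ht htδ => ?_⟩
    have h2 := h (x := t) ht (by rw [dist_zero_right, Real.norm_eq_abs, abs_of_pos ht]; exact htδ)
    rw [dist_zero_right, Real.norm_eq_abs, abs_div, abs_of_pos ht, div_lt_iff₀ ht] at h2
    exact h2.le
  obtain ⟨M, hM0, hM⟩ : ∃ M : ℝ, 0 < M ∧ ∀ t, M ≤ t → |f t| ≤ t ^ (p - 1) := by
    have h1 := (Metric.tendsto_atTop.1 hinf) 1 one_pos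
    obtain ⟨M, h⟩ := h1
    refine ⟨max M 1, by positivity, fun t ht => ?_⟩
    have ht0 : 0 < t := lt_of_lt_of_le one_pos ((le_max_right _ _).trans ht)
    have h2 := h t ((le_max_left _ _).trans ht)
    have h3 : 0 < t ^ (p - 1) := by positivity
    rw [dist_zero_right, Real.norm_eq_abs, abs_div, abs_of_pos h3, div_lt_iff₀ h3] at h2
    linarith
  have hcont : ContinuousOn (fun t => |f t| / t ^ (p - 1)) (Icc δ M) := by
    refine ContinuousOn.div (by fun_prop) ?_ ?_
    · exact fun t ht => (Real.continuousAt_rpow_const _ _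
        (Or.inl (hδ.trans_le ht.1).ne')).continuousWithinAt
    · exact fun t ht => (Real.rpow_pos_of_pos (hδ.trans_le ht.1) _).ne'
  obtain ⟨B, hB⟩ := isCompact_Icc.exists_bound_of_continuousOn hcont
  refine ⟨max B 1, by positivity, fun t => ?_⟩
  rcases le_or_gt t 0 with h | h
  · rw [hf0 t h, abs_zero]; positivity
  rw [abs_of_pos h]
  have htp : 0 < t ^ (p - 1) := by positivity
  rcases lt_or_ge t δ with h1 | h1
  · have := hδf t h h1
    have : 0 ≤ max B 1 * t ^ (p - 1) := by positivity
    linarith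
  have hηt : 0 ≤ η * t := by positivity
  rcases le_total M t with h2 | h2
  · have h3 := hM t h2
    have : 1 * t ^ (p - 1) ≤ max B 1 * t ^ (p - 1) := by gcongr; exact le_max_right _ _
    linarith
  · have h3 := hB t ⟨h1, h2⟩
    rw [Real.norm_eq_abs, abs_of_nonneg (by positivity), div_le_iff₀ htp] at h3
    have : B * t ^ (p - 1) ≤ max B 1 * t ^ (p - 1) := by gcongr; exact le_max_left _ _
    linarith

/-- Up to a small multiple of the critical growth, `f` is Lipschitz. -/
lemma exists_modulus (hfc : Continuous f) (hf0 : ∀ t, t ≤ 0 → f t = 0) {p : ℝ}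
    (hinf : Tendsto (fun t => f t / t ^ (p - 1)) atTop (𝓝 0)) {η : ℝ} (hη : 0 < η) :
    ∃ L : ℝ, 0 ≤ L ∧ ∀ t t', |f t - f t'| ≤
      η * (1 + |t| ^ (p - 1) + |t'| ^ (p - 1)) + L * |t - t'| := by
  obtain ⟨M, hM0, hM⟩ : ∃ M : ℝ, 0 < M ∧ ∀ t, M ≤ |t| → |f t| ≤ η * |t| ^ (p - 1) := by
    have h1 := (Metric.tendsto_atTop.1 hinf) η hη
    obtain ⟨M, h⟩ := h1
    refine ⟨max M 1, by positivity, fun t ht => ?_⟩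
    rcases le_or_gt t 0 with h0 | ht0
    · rw [hf0 t h0, abs_zero]; positivity
    rw [abs_of_pos ht0] at ht ⊢
    have h2 := h t ((le_max_left _ _).trans ht)
    have h3 : 0 < t ^ (p - 1) := by positivity
    rw [dist_zero_right, Real.norm_eq_abs, abs_div, abs_of_pos h3, div_lt_iff₀ h3] at h2
    linarith
  -- The margin 1 ensures that, for `|t - t'| < 1`, either both points lie in this interval or both
  -- exceed `M` in absolute value.
  have hK : IsCompact (Icc (-(M + 1)) (M + 1)) := isCompact_Icc
  obtain ⟨B, hB⟩ := hK.exists_bound_of_continuousOn hfc.continuousOn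
  have hfB : ∀ t, |f t| ≤ |B| + η * |t| ^ (p - 1) := by
    intro t
    have h0 : 0 ≤ η * |t| ^ (p - 1) := by positivity
    rcases le_total M |t| with h | h
    · have := hM t h; have := abs_nonneg B; linarith
    · have := hB t (abs_le.1 (h.trans (by linarith)))
      rw [Real.norm_eq_abs] at this
      have := le_abs_self B; linarith
  obtain ⟨δ, hδ, hδf⟩ := Metric.uniformContinuousOn_iff.1
    (hK.uniformContinuousOn_of_continuous hfc.continuousOn) η hη
  -- For `|t - t'|` at least `min δ 1` the Lipschitz term alone dominates `2 * |B|`.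
  refine ⟨2 * |B| / min δ 1, by positivity, fun t t' => ?_⟩
  have hm : 0 < min δ 1 := by positivity
  have h1 : 0 ≤ η * |t| ^ (p - 1) := by positivity
  have h2 : 0 ≤ η * |t'| ^ (p - 1) := by positivity
  rcases lt_or_ge |t - t'| (min δ 1) with h | h
  · have hd : |t - t'| < δ := h.trans_le (min_le_left _ _)
    have hd1 : |t - t'| < 1 := h.trans_le (min_le_right _ _)
    have h3 : 0 ≤ 2 * |B| / min δ 1 * |t - t'| := by positivity
    by_cases hb : |t| ≤ M + 1 ∧ |t'| ≤ M + 1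
    · have := hδf t (abs_le.1 hb.1) t' (abs_le.1 hb.2) hd
      rw [Real.dist_eq] at this
      linarith
    · have h4 := abs_sub_abs_le_abs_sub t t'
      have h5 := abs_sub_abs_le_abs_sub t' t
      rw [abs_sub_comm t' t] at h5
      have h6 : M ≤ |t| ∧ M ≤ |t'| := by
        rw [not_and_or, not_le, not_le] at hb
        rcases hb with hb | hb <;> constructor <;> linarith
      have := hM t h6.1; have := hM t' h6.2
      have := abs_sub (f t) (f t')
      linarith
  · have h3 : 2 * |B| ≤ 2 * |B| / min δ 1 * |t - t'| := by
      rw [div_mul_eq_mul_div, le_div_iff₀ hm]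
      gcongr
    have := hfB t; have := hfB t'
    have := abs_sub (f t) (f t')
    linarith

lemma abs_primitive_le {p η C : ℝ} (hp : 2 < p) (hη : 0 ≤ η) (hC : 0 ≤ C)
    (hf : ∀ t, |f t| ≤ η * |t| + C * |t| ^ (p - 1)) (t : ℝ) :
    |primitive f t| ≤ η * |t| ^ 2 + C * |t| ^ p := by
  have h := intervalIntegral.norm_integral_le_of_norm_le_const (f := f) (a := 0) (b := t)
    (C := η * |t| + C * |t| ^ (p - 1)) (fun x hx => by
      have hx' : |x| ≤ |t| := by
        rcases le_total 0 t with h0 | h0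
        · rw [uIoc_of_le h0] at hx
          rw [abs_of_pos hx.1, abs_of_nonneg h0]; exact hx.2
        · rw [uIoc_of_ge h0] at hx
          rw [abs_of_nonpos hx.2, abs_of_nonpos h0]; linarith [hx.1]
      have : 0 ≤ p - 1 := by linarith
      exact (hf x).trans (by gcongr))
  rw [Real.norm_eq_abs, sub_zero] at h
  refine h.trans (le_of_eq ?_)
  have : |t| ^ p = |t| ^ (p - 1) * |t| := by
    rcases (abs_nonneg t).eq_or_lt with h0 | h0
    · rw [← h0, mul_zero, Real.zero_rpow (by linarith)]
    · rw [← Real.rpow_add_one h0.ne']; ring_nf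
  rw [this]; ring

lemma abs_primitive_add_sub_le (hfc : Continuous f) {p η L : ℝ} (hp : 2 < p) (hη : 0 ≤ η)
    (hL : 0 ≤ L)
    (hf : ∀ t t', |f t - f t'| ≤ η * (1 + |t| ^ (p - 1) + |t'| ^ (p - 1)) + L * |t - t'|)
    (a b : ℝ) :
    |primitive f (a + b) - primitive f a - f a * b| ≤
      (η * (1 + 2 * (|a| + |b|) ^ (p - 1)) + L * |b|) * |b| := by
  rw [primitive_add_sub hfc]
  have h := intervalIntegral.norm_integral_le_of_norm_le_const (f := fun ξ => f ξ - f a) (a := a)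
    (b := a + b) (C := η * (1 + 2 * (|a| + |b|) ^ (p - 1)) + L * |b|) (fun x hx => by
      have hx' : |x - a| ≤ |b| := by
        rcases le_total 0 b with h0 | h0
        · rw [uIoc_of_le (by linarith)] at hx
          rw [abs_of_pos (by linarith [hx.1]), abs_of_nonneg h0]; linarith [hx.2]
        · rw [uIoc_of_ge (by linarith)] at hx
          rw [abs_of_nonpos (by linarith [hx.2]), abs_of_nonpos h0]; linarith [hx.1]
      have h1 : |x| ≤ |a| + |b| := by
        have := abs_sub_abs_le_abs_sub x a; linarith
      have h2 : |a| ≤ |a| + |b| := by have := abs_nonneg b; linarith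
      have hp1 : 0 ≤ p - 1 := by linarith
      have h3 : |x| ^ (p - 1) ≤ (|a| + |b|) ^ (p - 1) := by gcongr
      have h4 : |a| ^ (p - 1) ≤ (|a| + |b|) ^ (p - 1) := by gcongr
      calc ‖f x - f a‖ ≤ η * (1 + |x| ^ (p - 1) + |a| ^ (p - 1)) + L * |x - a| := hf x a
        _ ≤ η * (1 + (|a| + |b|) ^ (p - 1) + (|a| + |b|) ^ (p - 1)) + L * |b| := by gcongr
        _ = _ := by ring)
  rwa [Real.norm_eq_abs, add_sub_cancel_left] at h

/-- Superhomogeneity of `F` from the Ambrosetti–Rabinowitz condition. -/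
lemma rpow_mul_primitive_le (hfc : Continuous f) (hf0 : ∀ t, t ≤ 0 → f t = 0) {θ : ℝ}
    (hAR : ∀ t, 0 < t → θ * primitive f t ≤ t * f t) {τ : ℝ} (hτ : 1 ≤ τ) (t : ℝ) :
    τ ^ θ * primitive f t ≤ primitive f (τ * t) := by
  rcases le_or_gt t 0 with h | h
  · rw [primitive_of_nonpos hf0 h, primitive_of_nonpos hf0 (by nlinarith), mul_zero]
  -- Ambrosetti–Rabinowitz says exactly that this quotient has nonnegative derivative.
  have hmono : MonotoneOn (fun x => primitive f x * x ^ (-θ)) (Ioi 0) := by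
    have hd : ∀ x ∈ Ioi (0 : ℝ), HasDerivAt (fun x => primitive f x * x ^ (-θ))
        (f x * x ^ (-θ) + primitive f x * (-θ * x ^ (-θ - 1))) x := fun x hx =>
      (hasDerivAt_primitive hfc x).mul (Real.hasDerivAt_rpow_const (Or.inl (ne_of_gt hx)))
    refine monotoneOn_of_deriv_nonneg (convex_Ioi 0)
      (fun x hx => (hd x hx).continuousAt.continuousWithinAt)
      (fun x hx => (hd x (interior_subset hx)).differentiableAt.differentiableWithinAt)
      fun x hx => ?_
    have hx0 : 0 < x := interior_subset hx
    rw [(hd x hx0).deriv]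
    have h1 : x ^ (-θ) = x ^ (-θ - 1) * x := by
      rw [← Real.rpow_add_one hx0.ne']; ring_nf
    have h2 : 0 ≤ x ^ (-θ - 1) := by positivity
    have h3 := hAR x hx0
    rw [h1]
    nlinarith
  have h1 := hmono (show t ∈ Ioi (0 : ℝ) from h) (show τ * t ∈ Ioi (0 : ℝ) by
    show 0 < τ * t
    positivity) (by nlinarith)
  simp only at h1
  have hτ0 : 0 < τ := by linarith
  rw [Real.mul_rpow hτ0.le h.le, ← mul_assoc, mul_le_mul_iff_left₀ (by positivity),
    Real.rpow_neg hτ0.le, ← div_eq_mul_inv, le_div_iff₀ (by positivity)] at h1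
  linarith

end NonlinearTerm

/-! ### Superposition operators composed with a bounded map `T` into `L²`. -/

section Superposition

open scoped RealInnerProductSpace

lemma abs_le_mul_norm_of_unit_bound {H : Type*} [NormedAddCommGroup H] [NormedSpace ℝ H]
    (l : H →ₗ[ℝ] ℝ) {M : ℝ} (hl : ∀ y, ‖y‖ ≤ 1 → |l y| ≤ M) (y : H) : |l y| ≤ M * ‖y‖ := by
  rcases eq_or_ne y 0 with rfl | hy
  · simp
  have hy' : 0 < ‖y‖ := norm_pos_iff.2 hy
  have h := hl (‖y‖⁻¹ • y) (by rw [norm_smul, norm_inv, norm_norm, inv_mul_cancel₀ hy'.ne'])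
  rw [map_smul, smul_eq_mul, abs_mul, abs_inv, abs_norm, inv_mul_le_iff₀ hy'] at h
  linarith

variable {α : Type*} [MeasurableSpace α] {μ : Measure α}

lemma integrable_sq_coeFn (g : Lp ℝ 2 μ) : Integrable (fun w => g w ^ 2) μ :=
  (Lp.memLp g).integrable_sq

lemma integral_sq_coeFn (g : Lp ℝ 2 μ) : ∫ w, g w ^ 2 ∂μ = ‖g‖ ^ 2 := by
  rw [← real_inner_self_eq_norm_sq, L2.inner_def]
  refine integral_congr_ae (Eventually.of_forall fun w => ?_)
  simp [sq]

lemma integrable_abs_coeFn [IsFiniteMeasure μ] (g : Lp ℝ 2 μ) : Integrable (fun w => |g w|) μ :=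
  ((Lp.memLp g).integrable one_le_two).abs

lemma integral_abs_coeFn_le [IsFiniteMeasure μ] (g : Lp ℝ 2 μ) :
    ∫ w, |g w| ∂μ ≤ μ.real univ + ‖g‖ ^ 2 := by
  rw [← integral_sq_coeFn]
  have h1 : ∫ w, (1 + g w ^ 2) ∂μ = μ.real univ + ∫ w, g w ^ 2 ∂μ := by
    rw [integral_add (integrable_const _) (integrable_sq_coeFn g)]; simp
  rw [← h1]
  refine integral_mono (integrable_abs_coeFn g)
    ((integrable_const _).add (integrable_sq_coeFn g)) fun w => ?_
  show |g w| ≤ 1 + g w ^ 2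
  rw [← sq_abs]; nlinarith [sq_nonneg (|g w| - 1)]

variable {H : Type*} [NormedAddCommGroup H] [InnerProductSpace ℝ H] {T : H →L[ℝ] Lp ℝ 2 μ}
  {f : ℝ → ℝ} {p A : ℝ}

lemma norm_apply_sq_le (T : H →L[ℝ] Lp ℝ 2 μ) {x : H} {R : ℝ} (hx : ‖x‖ ≤ R) :
    ‖T x‖ ^ 2 ≤ (‖T‖ * R) ^ 2 := by
  have : ‖T x‖ ≤ ‖T‖ * R := (T.le_opNorm x).trans (by gcongr)
  gcongr

lemma integrable_superposition_mul (hfc : Continuous f) {C : ℝ} (hC : 0 ≤ C) (hp : 2 < p)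
    (hf : ∀ t, |f t| ≤ 1 * |t| + C * |t| ^ (p - 1))
    {g h : Lp ℝ 2 μ} (hg : Integrable (fun w => |g w| ^ p) μ)
    (hh : Integrable (fun w => |h w| ^ p) μ) : Integrable (fun w => f (g w) * h w) μ := by
  have h1 := ((integrable_sq_coeFn g).add (integrable_sq_coeFn h)).add ((hg.add hh).const_mul C)
  refine h1.mono' ((hfc.comp_aestronglyMeasurable (Lp.aestronglyMeasurable g)).mul
    (Lp.aestronglyMeasurable h)) (Eventually.of_forall fun w => ?_)
  simp only [Pi.add_apply]
  rw [Real.norm_eq_abs, abs_mul]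
  have h2 := rpow_sub_one_mul_le (abs_nonneg (g w)) (abs_nonneg (h w)) (by linarith : 1 < p)
  calc |f (g w)| * |h w| ≤ (1 * |g w| + C * |g w| ^ (p - 1)) * |h w| := by gcongr; exact hf _
    _ = |g w| * |h w| + C * (|g w| ^ (p - 1) * |h w|) := by ring
    _ ≤ (|g w| ^ 2 + |h w| ^ 2) + C * (|g w| ^ p + |h w| ^ p) := by
        gcongr
        nlinarith [sq_nonneg (|g w| - |h w|), sq_nonneg |g w|, sq_nonneg |h w|]
    _ = _ := by rw [sq_abs, sq_abs]

lemma integrable_primitive_coeFn (hfc : Continuous f) {C : ℝ} (hC : 0 ≤ C) (hp : 2 < p)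
    (hf : ∀ t, |f t| ≤ 1 * |t| + C * |t| ^ (p - 1))
    {g : Lp ℝ 2 μ} (hg : Integrable (fun w => |g w| ^ p) μ) :
    Integrable (fun w => primitive f (g w)) μ := by
  refine ((integrable_sq_coeFn g).add (hg.const_mul C)).mono'
    ((continuous_primitive hfc).comp_aestronglyMeasurable (Lp.aestronglyMeasurable g))
    (Eventually.of_forall fun w => ?_)
  have := abs_primitive_le hp zero_le_one hC hf (g w)
  simp only [Pi.add_apply]
  rw [Real.norm_eq_abs]
  rwa [one_mul, sq_abs] at this

/-- The difference of two superposition operators, tested against a unit ball. -/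
lemma integral_abs_sub_mul_le [IsFiniteMeasure μ] (hp : 2 < p)
    (hT : ∀ x, Integrable (fun w => |T x w| ^ p) μ)
    (hTA : ∀ x, ∫ w, |T x w| ^ p ∂μ ≤ A * ‖x‖ ^ p) (hA : 0 ≤ A)
    {η L : ℝ} (hη : 0 < η)
    (hf : ∀ t t', |f t - f t'| ≤ η * (1 + |t| ^ (p - 1) + |t'| ^ (p - 1)) + L * |t - t'|)
    {R : ℝ} (hR : 1 ≤ R) {x x' y : H} (hx : ‖x‖ ≤ R) (hx' : ‖x'‖ ≤ R) (hy : ‖y‖ ≤ 1) :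
    ∫ w, |f (T x w) - f (T x' w)| * |T y w| ∂μ ≤
      η * (μ.real univ + 2 * (‖T‖ * R) ^ 2 + 4 * (A * R ^ p)) +
        L ^ 2 / (4 * η) * ‖T x - T x'‖ ^ 2 := by
  have hpb : ∀ z : H, ‖z‖ ≤ R → ∫ w, |T z w| ^ p ∂μ ≤ A * R ^ p := fun z hz =>
    (hTA z).trans (by gcongr)
  have hyR := hy.trans hR
  set G : α → ℝ := fun w => η * (|T y w| + (|T x w| ^ p + |T x' w| ^ p + 2 * |T y w| ^ p) +
    T y w ^ 2) + L ^ 2 / (4 * η) * ((T x - T x' : Lp ℝ 2 μ) w) ^ 2 with hG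
  have i1 : Integrable (fun w => |T x w| ^ p + |T x' w| ^ p) μ := (hT x).add (hT x')
  have i2 : Integrable (fun w => |T x w| ^ p + |T x' w| ^ p + 2 * |T y w| ^ p) μ :=
    i1.add ((hT y).const_mul 2)
  have i3 : Integrable (fun w => |T y w| + (|T x w| ^ p + |T x' w| ^ p + 2 * |T y w| ^ p)) μ :=
    (integrable_abs_coeFn (T y)).add i2
  have i4 : Integrable (fun w => η * (|T y w| + (|T x w| ^ p + |T x' w| ^ p + 2 * |T y w| ^ p) +
    T y w ^ 2)) μ := (i3.add (integrable_sq_coeFn (T y))).const_mul η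
  have i5 : Integrable (fun w => L ^ 2 / (4 * η) * ((T x - T x' : Lp ℝ 2 μ) w) ^ 2) μ :=
    (integrable_sq_coeFn (T x - T x')).const_mul _
  have hGint : ∫ w, G w ∂μ = η * (∫ w, |T y w| ∂μ + ((∫ w, |T x w| ^ p ∂μ + ∫ w, |T x' w| ^ p ∂μ) +
      2 * ∫ w, |T y w| ^ p ∂μ) + ‖T y‖ ^ 2) + L ^ 2 / (4 * η) * ‖T x - T x'‖ ^ 2 := by
    rw [hG, integral_add i4 i5, integral_const_mul, integral_const_mul, integral_sq_coeFn,
      integral_add i3 (integrable_sq_coeFn (T y)), integral_add (integrable_abs_coeFn (T y)) i2,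
      integral_add i1 ((hT y).const_mul 2), integral_add (hT x) (hT x'), integral_const_mul,
      integral_sq_coeFn]
  have hle : ∫ w, |f (T x w) - f (T x' w)| * |T y w| ∂μ ≤ ∫ w, G w ∂μ := by
    refine integral_mono_of_nonneg (Eventually.of_forall fun w => by positivity) (i4.add i5) ?_
    filter_upwards [Lp.coeFn_sub (T x) (T x')] with w hω
    simp only [hG, hω, Pi.sub_apply]
    set a := T x w
    set b := T x' w
    set c := T y w
    have h1 := rpow_sub_one_mul_le (abs_nonneg a) (abs_nonneg c) (by linarith : 1 < p)
    have h2 := rpow_sub_one_mul_le (abs_nonneg b) (abs_nonneg c) (by linarith : 1 < p)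
    -- Young's inequality confines the large constant to the `L²` distance of `T x` and `T x'`, the
    -- quantity that compactness of `T` controls.
    have h3 : L * |a - b| * |c| ≤ η * c ^ 2 + L ^ 2 / (4 * η) * (a - b) ^ 2 := by
      have h4 : L ^ 2 / (4 * η) * (a - b) ^ 2 = (L * |a - b| / (2 * η)) ^ 2 * η := by
        rw [← sq_abs (a - b)]; field_simp; ring
      have h5 : L * |a - b| * |c| = 2 * η * (L * |a - b| / (2 * η)) * |c| := by
        field_simp
      rw [h4, h5, ← sq_abs c]
      nlinarith [sq_nonneg (L * |a - b| / (2 * η) - |c|)]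
    calc |f a - f b| * |c|
        ≤ (η * (1 + |a| ^ (p - 1) + |b| ^ (p - 1)) + L * |a - b|) * |c| := by
          gcongr; exact hf a b
      _ = η * (|c| + (|a| ^ (p - 1) * |c| + |b| ^ (p - 1) * |c|)) + L * |a - b| * |c| := by ring
      _ ≤ η * (|c| + ((|a| ^ p + |c| ^ p) + (|b| ^ p + |c| ^ p))) +
          (η * c ^ 2 + L ^ 2 / (4 * η) * (a - b) ^ 2) := by gcongr
      _ = _ := by ring
  refine hle.trans ?_
  rw [hGint]
  have j1 := integral_abs_coeFn_le (T y)
  have j2 := norm_apply_sq_le T hyR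
  have j3 := hpb x hx
  have j4 := hpb x' hx'
  have j5 := hpb y hyR
  refine add_le_add (mul_le_mul_of_nonneg_left ?_ hη.le) le_rfl
  linarith

/-- Uniform first order expansion of `x ↦ ∫ F (T x)` on bounded sets. -/
lemma abs_integral_primitive_add_sub_le [IsFiniteMeasure μ] (hfc : Continuous f) (hp : 2 < p)
    (hT : ∀ x, Integrable (fun w => |T x w| ^ p) μ)
    (hTA : ∀ x, ∫ w, |T x w| ^ p ∂μ ≤ A * ‖x‖ ^ p) (hA : 0 ≤ A)
    {C : ℝ} (hC : 0 ≤ C) (hfC : ∀ t, |f t| ≤ 1 * |t| + C * |t| ^ (p - 1))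
    {η L : ℝ} (hη : 0 < η) (hL : 0 ≤ L)
    (hf : ∀ t t', |f t - f t'| ≤ η * (1 + |t| ^ (p - 1) + |t'| ^ (p - 1)) + L * |t - t'|)
    {R : ℝ} (hR : 1 ≤ R) {x h : H} (hx : ‖x‖ ≤ R) (hh : ‖h‖ ≤ 1) :
    |∫ w, primitive f (T (x + h) w) ∂μ - ∫ w, primitive f (T x w) ∂μ -
      ∫ w, f (T x w) * T h w ∂μ| ≤
      (η * (μ.real univ + (‖T‖ * R) ^ 2 + 2 ^ (p + 1) * (A * R ^ p)) +
        L * ‖T‖ ^ 2 * ‖h‖) * ‖h‖ := by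
  rcases eq_or_ne h 0 with rfl | hh0
  · have : ∫ w, f (T x w) * (0 : Lp ℝ 2 μ) w ∂μ = 0 := by
      refine integral_eq_zero_of_ae ?_
      filter_upwards [Lp.coeFn_zero ℝ 2 μ] with w hω
      rw [hω, Pi.zero_apply, mul_zero]
    rw [map_zero, this]
    simp
  set σ := ‖h‖ with hσ
  have hσ0 : 0 < σ := norm_pos_iff.2 hh0
  -- Working with the unit direction `k` pulls out one factor `‖h‖` from the whole remainder,
  -- including its `p`-growth part.
  set k : H := σ⁻¹ • h with hk
  have hk1 : ‖k‖ = 1 := by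
    rw [hk, norm_smul, norm_inv, Real.norm_eq_abs, abs_of_pos hσ0, inv_mul_cancel₀ hσ0.ne']
  have hkh : h = σ • k := by rw [hk, smul_smul, mul_inv_cancel₀ hσ0.ne', one_smul]
  have hpb : ∀ z : H, ‖z‖ ≤ R → ∫ w, |T z w| ^ p ∂μ ≤ A * R ^ p := fun z hz =>
    (hTA z).trans (by gcongr)
  have hkR : ‖k‖ ≤ R := by rw [hk1]; exact hR
  have hi1 := integrable_primitive_coeFn hfc hC hp hfC (hT (x + h))
  have hi2 := integrable_primitive_coeFn hfc hC hp hfC (hT x)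
  have hi3 := integrable_superposition_mul hfc hC hp hfC (hT x) (hT h)
  have hi12 : Integrable (fun w => primitive f (T (x + h) w) - primitive f (T x w)) μ :=
    hi1.sub hi2
  rw [← integral_sub hi1 hi2, ← integral_sub hi12 hi3]
  have i1 : Integrable (fun w => |T x w| ^ p + |T k w| ^ p) μ := (hT x).add (hT k)
  have i2 : Integrable (fun w => |T k w| + 2 ^ p * (|T x w| ^ p + |T k w| ^ p)) μ :=
    (integrable_abs_coeFn (T k)).add (i1.const_mul _)
  have i3 : Integrable (fun w => η * (|T k w| + 2 ^ p * (|T x w| ^ p + |T k w| ^ p))) μ :=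
    i2.const_mul η
  have i4 : Integrable (fun w => L * σ * T k w ^ 2) μ := (integrable_sq_coeFn (T k)).const_mul _
  have i5 : Integrable (fun w => (η * (|T k w| + 2 ^ p * (|T x w| ^ p + |T k w| ^ p)) +
    L * σ * T k w ^ 2) * σ) μ := (i3.add i4).mul_const σ
  have hle := norm_integral_le_of_norm_le (μ := μ)
    (f := fun w => primitive f (T (x + h) w) - primitive f (T x w) - f (T x w) * T h w) i5 (by
      have e1 := Lp.coeFn_add (T x) (T h)
      have e2 := Lp.coeFn_smul σ (T k)
      rw [← map_add] at e1
      rw [← map_smul, ← hkh] at e2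
      filter_upwards [e1, e2] with w h1 h2
      rw [h1, Pi.add_apply]
      have hb : |T h w| = σ * |T k w| := by
        rw [h2, Pi.smul_apply, smul_eq_mul, abs_mul, abs_of_pos hσ0]
      refine (abs_primitive_add_sub_le hfc hp hη.le hL hf _ _).trans ?_
      rw [hb]
      set a := |T x w| with ha
      have ha0 : 0 ≤ a := abs_nonneg _
      set c := |T k w| with hc
      have hc0 : 0 ≤ c := abs_nonneg _
      have hsq : T k w ^ 2 = c ^ 2 := (sq_abs _).symm
      have hσc : σ * c ≤ c := by nlinarith
      have hp1 : 0 ≤ p - 1 := by linarith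
      have h3 : (a + σ * c) ^ (p - 1) * c ≤ (a + c) ^ p := by
        calc (a + σ * c) ^ (p - 1) * c ≤ (a + c) ^ (p - 1) * (a + c) := by
              gcongr; linarith
          _ = (a + c) ^ p := by
            rcases (add_nonneg ha0 hc0).eq_or_lt with h0 | h0
            · rw [← h0, mul_zero, Real.zero_rpow (by linarith)]
            · rw [← Real.rpow_add_one h0.ne']; ring_nf
      have h4 : (a + c) ^ p ≤ 2 ^ (p - 1) * (a ^ p + c ^ p) := by
        exact_mod_cast NNReal.rpow_add_le_mul_rpow_add_rpow ⟨a, ha0⟩ ⟨c, hc0⟩ (by linarith : 1 ≤ p)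
      have h5 : (2 : ℝ) ^ p = 2 * 2 ^ (p - 1) := by
        rw [mul_comm, ← Real.rpow_add_one (by norm_num)]; ring_nf
      rw [hsq]
      calc (η * (1 + 2 * (a + σ * c) ^ (p - 1)) + L * (σ * c)) * (σ * c)
          = (η * (c + 2 * ((a + σ * c) ^ (p - 1) * c)) + L * σ * c ^ 2) * σ := by ring
        _ ≤ (η * (c + 2 * (2 ^ (p - 1) * (a ^ p + c ^ p))) + L * σ * c ^ 2) * σ := by
            have h34 := h3.trans h4
            exact mul_le_mul_of_nonneg_right (add_le_add
              (mul_le_mul_of_nonneg_left (by linarith) hη.le) le_rfl) hσ0.le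
        _ = _ := by rw [h5]; ring)
  refine hle.trans ?_
  rw [integral_mul_const, integral_add i3 i4, integral_const_mul, integral_const_mul,
    integral_add (integrable_abs_coeFn (T k)) (i1.const_mul _), integral_const_mul,
    integral_add (hT x) (hT k), integral_sq_coeFn]
  have j1 := integral_abs_coeFn_le (T k)
  have j2 := norm_apply_sq_le T hkR
  have j3 := hpb x hx
  have j4 := hpb k hkR
  have j5 : ‖T k‖ ^ 2 ≤ ‖T‖ ^ 2 := by simpa using norm_apply_sq_le T hk1.le
  have h5 : (2 : ℝ) ^ (p + 1) = 2 ^ p * 2 := Real.rpow_add_one (by norm_num) p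
  have j6 : (2 : ℝ) ^ p * (∫ w, |T x w| ^ p ∂μ + ∫ w, |T k w| ^ p ∂μ) ≤
      2 ^ p * (A * R ^ p + A * R ^ p) := by gcongr
  calc _ ≤ (η * ((μ.real univ + ‖T k‖ ^ 2) + 2 ^ p * (A * R ^ p + A * R ^ p)) +
        L * σ * ‖T‖ ^ 2) * σ := by gcongr
    _ ≤ (η * ((μ.real univ + (‖T‖ * R) ^ 2) + 2 ^ p * (A * R ^ p + A * R ^ p)) +
        L * σ * ‖T‖ ^ 2) * σ := by gcongr
    _ = _ := by rw [h5]; ring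

end Superposition

/-! ### Verification of the mountain pass hypotheses for `Φ x = ∫ F (T x)`. -/

section CriticalPoint

open scoped RealInnerProductSpace

variable {α : Type*} [MeasurableSpace α] {μ : Measure α} [IsFiniteMeasure μ]
  {H : Type*} [NormedAddCommGroup H] [InnerProductSpace ℝ H] [CompleteSpace H]
  {T : H →L[ℝ] Lp ℝ 2 μ} {f : ℝ → ℝ} {p A : ℝ}

/-- Riesz representation of `y ↦ ∫ g · T y`. The norm bound serves twice: for the existence of the
gradient and, with `g` a difference, for its modulus of continuity. -/
lemma exists_le_of_continuous_coeFn_mul (T : H →L[ℝ] Lp ℝ 2 μ) (g : α → ℝ)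
    (hg : ∀ y, Integrable (fun w => g w * T y w) μ) {M : ℝ} (hM : 0 ≤ M)
    (hb : ∀ y, ‖y‖ ≤ 1 → ∫ w, |g w| * |T y w| ∂μ ≤ M) :
    ∃ k : H, ‖k‖ ≤ M ∧ ∀ y, ⟪k, y⟫ = ∫ w, g w * T y w ∂μ := by
  let l : H →ₗ[ℝ] ℝ :=
    { toFun := fun y => ∫ w, g w * T y w ∂μ
      map_add' := fun y z => by
        rw [← integral_add (hg y) (hg z), map_add]
        refine integral_congr_ae ?_
        filter_upwards [Lp.coeFn_add (T y) (T z)] with w hw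
        rw [hw, Pi.add_apply, mul_add]
      map_smul' := fun c y => by
        rw [RingHom.id_apply, smul_eq_mul, ← integral_const_mul, map_smul]
        refine integral_congr_ae ?_
        filter_upwards [Lp.coeFn_smul c (T y)] with w hw
        rw [hw, Pi.smul_apply, smul_eq_mul]; ring }
  have hl : ∀ y, ‖l y‖ ≤ M * ‖y‖ := by
    refine fun y => abs_le_mul_norm_of_unit_bound l (fun y hy => ?_) y
    refine le_trans ?_ (hb y hy)
    refine (norm_integral_le_integral_norm (fun w => g w * T y w)).trans (le_of_eq ?_)
    simp only [Real.norm_eq_abs, abs_mul]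
  refine ⟨(InnerProductSpace.toDual ℝ H).symm (l.mkContinuous M hl), ?_, fun y => ?_⟩
  · rw [LinearIsometryEquiv.norm_map]
    exact LinearMap.mkContinuous_norm_le _ hM _
  · rw [InnerProductSpace.toDual_symm_apply]; rfl

/-- A mountain pass critical point of `‖x‖² / 2 - ∫ F (T x)`. -/
theorem exists_criticalPoint (hTc : IsCompactOperator T) (hp : 2 < p)
    (hT : ∀ x, Integrable (fun w => |T x w| ^ p) μ)
    (hTA : ∀ x, ∫ w, |T x w| ^ p ∂μ ≤ A * ‖x‖ ^ p) (hA : 0 ≤ A)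
    (hfc : Continuous f) (hf0 : ∀ t, t ≤ 0 → f t = 0)
    (h0 : Tendsto (fun t => f t / t) (𝓝[>] 0) (𝓝 0))
    (hinf : Tendsto (fun t => f t / t ^ (p - 1)) atTop (𝓝 0))
    {θ : ℝ} (hθ : 2 < θ) (hAR : ∀ t, 0 < t → θ * primitive f t ≤ t * f t)
    {e : H} {B : ℝ} (he : ‖e‖ ^ 2 / 2 - ∫ w, primitive f (T e w) ∂μ < 0)
    (hB : ∀ τ ∈ Icc (0 : ℝ) 1, ‖τ • e‖ ^ 2 / 2 - ∫ w, primitive f (T (τ • e) w) ∂μ ≤ B) :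
    ∃ x : H, (∀ y, ⟪x, y⟫ = ∫ w, f (T x w) * T y w ∂μ) ∧
      0 < ‖x‖ ^ 2 / 2 - ∫ w, primitive f (T x w) ∂μ ∧
      ‖x‖ ^ 2 / 2 - ∫ w, primitive f (T x w) ∂μ ≤ B := by
  obtain ⟨C, hC, hfC⟩ := exists_growth hfc hf0 h0 hinf one_pos
  have hint : ∀ x y, Integrable (fun w => f (T x w) * T y w) μ := fun x y =>
    integrable_superposition_mul hfc hC hp hfC (hT x) (hT y)
  have hintF : ∀ x, Integrable (fun w => primitive f (T x w)) μ := fun x =>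
    integrable_primitive_coeFn hfc hC hp hfC (hT x)
  -- difference estimate for the gradient
  have hdiff : ∀ R η : ℝ, 0 < η → ∃ L : ℝ, 0 ≤ L ∧ ∀ x x' y : H, ‖x‖ ≤ R → ‖x'‖ ≤ R → ‖y‖ ≤ 1 →
      ∫ w, |f (T x w) - f (T x' w)| * |T y w| ∂μ ≤ η + L * ‖T x - T x'‖ ^ 2 := by
    intro R η hη
    set R' := max R 1
    set D := μ.real univ + 2 * (‖T‖ * R') ^ 2 + 4 * (A * R' ^ p) with hD
    have hD0 : 0 ≤ D := by positivity
    have hη' : 0 < η / (D + 1) := by positivity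
    obtain ⟨L, hL, hfL⟩ := exists_modulus hfc hf0 hinf hη'
    refine ⟨L ^ 2 / (4 * (η / (D + 1))), by positivity, fun x x' y hx hx' hy => ?_⟩
    refine (integral_abs_sub_mul_le hp hT hTA hA hη' hfL (le_max_right R 1)
      (hx.trans (le_max_left _ _)) (hx'.trans (le_max_left _ _)) hy).trans ?_
    gcongr
    rw [← hD, div_mul_eq_mul_div, div_le_iff₀ (by positivity)]
    nlinarith
  have hTzero : ∀ᵐ w ∂μ, T (0 : H) w = 0 := by
    rw [map_zero]
    filter_upwards [Lp.coeFn_zero ℝ 2 μ] with w hw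
    rw [hw]; rfl
  have hgrad : ∀ x : H, ∃ k : H, ∀ y, ⟪k, y⟫ = ∫ w, f (T x w) * T y w ∂μ := by
    intro x
    obtain ⟨L, hL, h⟩ := hdiff ‖x‖ 1 one_pos
    obtain ⟨k, -, hk⟩ := exists_le_of_continuous_coeFn_mul T (fun w => f (T x w)) (hint x)
      -- Since `f 0 = 0`, the difference estimate against the point 0 bounds `f (T x)` itself.
      (M := 1 + L * ‖T x - T 0‖ ^ 2) (by positivity) fun y hy => by
        refine le_trans (le_of_eq ?_) (h x 0 y le_rfl (by simp) hy)
        refine integral_congr_ae ?_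
        filter_upwards [hTzero] with w hw
        simp only [hw, hf0 0 le_rfl, sub_zero]
    exact ⟨k, hk⟩
  choose K hK using hgrad
  -- Up to an arbitrarily small error, `K` is controlled by `T` on bounded sets, so it inherits both
  -- continuity and compactness from `T`.
  have hKdiff : ∀ R η : ℝ, 0 < η → ∃ L : ℝ, 0 ≤ L ∧ ∀ x x' : H, ‖x‖ ≤ R → ‖x'‖ ≤ R →
      ‖K x - K x'‖ ≤ η + L * ‖T x - T x'‖ ^ 2 := by
    intro R η hη
    obtain ⟨L, hL, h⟩ := hdiff R η hη
    refine ⟨L, hL, fun x x' hx hx' => ?_⟩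
    obtain ⟨k, hkM, hk⟩ := exists_le_of_continuous_coeFn_mul T
      (fun w => f (T x w) - f (T x' w))
      (fun y => by simp only [sub_mul]; exact (hint x y).sub (hint x' y))
      (M := η + L * ‖T x - T x'‖ ^ 2) (by positivity) (fun y hy => h x x' y hx hx' hy)
    have : K x - K x' = k := by
      refine ext_inner_right ℝ fun y => ?_
      rw [inner_sub_left, hK, hK, hk, ← integral_sub (hint x y) (hint x' y)]
      simp only [sub_mul]
    rwa [this]
  set Φ : H → ℝ := fun x => ∫ w, primitive f (T x w) ∂μ with hΦ
  have hexp : ∀ R η : ℝ, 0 < η → ∃ L : ℝ, 0 ≤ L ∧ ∀ x h : H, ‖x‖ ≤ R → ‖h‖ ≤ 1 →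
      |Φ (x + h) - Φ x - ⟪K x, h⟫| ≤ (η + L * ‖h‖) * ‖h‖ := by
    intro R η hη
    set R' := max R 1
    set D := μ.real univ + (‖T‖ * R') ^ 2 + 2 ^ (p + 1) * (A * R' ^ p) with hD
    have hD0 : 0 ≤ D := by positivity
    have hη' : 0 < η / (D + 1) := by positivity
    obtain ⟨L, hL, hfL⟩ := exists_modulus hfc hf0 hinf hη'
    refine ⟨L * ‖T‖ ^ 2, by positivity, fun x h hx hh => ?_⟩
    rw [hK]
    refine (abs_integral_primitive_add_sub_le hfc hp hT hTA hA hC hfC hη' hL hfL (le_max_right R 1)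
      (hx.trans (le_max_left _ _)) hh).trans ?_
    gcongr
    rw [← hD, div_mul_eq_mul_div, div_le_iff₀ (by positivity)]
    nlinarith
  have hKc : Continuous K := by
    refine continuous_iff_continuousAt.2 fun x => Metric.tendsto_nhds.2 fun ε hε => ?_
    obtain ⟨L, hL, h⟩ := hKdiff (‖x‖ + 1) (ε / 2) (by positivity)
    have h1 : Tendsto (fun y => ε / 2 + L * ‖T y - T x‖ ^ 2) (𝓝 x) (𝓝 (ε / 2)) := by
      have : Continuous fun y => ε / 2 + L * ‖T y - T x‖ ^ 2 := by fun_prop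
      simpa using this.tendsto x
    filter_upwards [h1.eventually_lt_const (by linarith : ε / 2 < ε),
      Metric.ball_mem_nhds x one_pos] with y hy hy1
    rw [dist_eq_norm]
    refine (h y x ?_ (by linarith)).trans_lt hy
    have := norm_le_norm_add_norm_sub' y x
    rw [mem_ball_iff_norm] at hy1
    linarith
  have hΦc : Continuous Φ := by
    refine continuous_iff_continuousAt.2 fun x => ?_
    obtain ⟨L, hL, h⟩ := hexp ‖x‖ 1 one_pos
    rw [ContinuousAt, tendsto_iff_norm_sub_tendsto_zero]
    have h1 : Tendsto (fun y => ‖K x‖ * ‖y - x‖ + (1 + L * ‖y - x‖) * ‖y - x‖) (𝓝 x) (𝓝 0) := by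
      have : Continuous fun y => ‖K x‖ * ‖y - x‖ + (1 + L * ‖y - x‖) * ‖y - x‖ := by fun_prop
      simpa using this.tendsto x
    refine squeeze_zero' (Eventually.of_forall fun _ => norm_nonneg _) ?_ h1
    filter_upwards [Metric.ball_mem_nhds x one_pos] with y hy
    rw [mem_ball_iff_norm] at hy
    have h2 := h x (y - x) le_rfl hy.le
    rw [add_sub_cancel] at h2
    have h3 := abs_real_inner_le_norm (K x) (y - x)
    rw [Real.norm_eq_abs]
    calc |Φ y - Φ x| = |(Φ y - Φ x - ⟪K x, y - x⟫) + ⟪K x, y - x⟫| := by ring_nf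
      _ ≤ |Φ y - Φ x - ⟪K x, y - x⟫| + |⟪K x, y - x⟫| := abs_add_le _ _
      _ ≤ _ := by linarith
  have hKS : ∀ R : ℝ, ∃ S : Set H, IsCompact S ∧ ∀ x, ‖x‖ ≤ R → K x ∈ S := by
    intro R
    refine ⟨closure (K '' Metric.closedBall 0 R), ?_, fun x hx =>
      subset_closure ⟨x, by simpa using hx, rfl⟩⟩
    have hTtb : TotallyBounded (T '' Metric.closedBall (0 : H) R) :=
      ((hTc.isCompact_closure_image_closedBall R).totallyBounded).subset subset_closure
    refine (TotallyBounded.closure ?_).isCompact_of_isClosed isClosed_closure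
    rw [Metric.totallyBounded_iff]
    intro ε hε
    obtain ⟨L, hL, h⟩ := hKdiff R (ε / 2) (by positivity)
    obtain ⟨δ, hδ, hδε⟩ : ∃ δ : ℝ, 0 < δ ∧ L * δ ^ 2 < ε / 2 := by
      have h1 : Tendsto (fun δ : ℝ => L * δ ^ 2) (𝓝[>] 0) (𝓝 0) := by
        have : Continuous fun δ : ℝ => L * δ ^ 2 := by fun_prop
        simpa using (this.tendsto 0).mono_left nhdsWithin_le_nhds
      obtain ⟨δ, h2, h3⟩ := ((h1.eventually_lt_const (by positivity : 0 < ε / 2)).and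
        self_mem_nhdsWithin).exists
      exact ⟨δ, h3, h2⟩
    -- A finite `δ`-net of the image of the ball under `T`, pulled back to the ball, is sent by `K`
    -- to an `ε`-net.
    obtain ⟨t', ht'sub, ht'fin, ht'⟩ := exists_subset_image_finite_and.1
      (Metric.finite_approx_of_totallyBounded hTtb δ hδ)
    refine ⟨K '' t', ht'fin.image _, ?_⟩
    rintro _ ⟨x, hx, rfl⟩
    have h1 := ht' ⟨x, hx, rfl⟩
    simp only [mem_iUnion, exists_prop] at h1 ⊢
    obtain ⟨_, ⟨z, hz, rfl⟩, hxz⟩ := h1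
    refine ⟨K z, ⟨z, hz, rfl⟩, ?_⟩
    rw [mem_ball_iff_norm] at hxz ⊢
    refine (h x z (by simpa using hx) (by simpa using ht'sub hz)).trans_lt ?_
    have : L * ‖T x - T z‖ ^ 2 ≤ L * δ ^ 2 := by gcongr
    linarith
  have hΦ0 : Φ 0 = 0 := by
    refine integral_eq_zero_of_ae ?_
    filter_upwards [hTzero] with w hw
    rw [hw, primitive_zero]; rfl
  have hΦθ : ∀ (x : H) (τ : ℝ), 1 ≤ τ → τ ^ θ * Φ x ≤ Φ (τ • x) := by
    intro x τ hτ
    simp only [hΦ]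
    rw [← integral_const_mul]
    refine integral_mono_ae ((hintF x).const_mul _) (hintF _) ?_
    rw [map_smul]
    filter_upwards [Lp.coeFn_smul τ (T x)] with w hw
    rw [hw, Pi.smul_apply, smul_eq_mul]
    exact rpow_mul_primitive_le hfc hf0 hAR hτ _
  -- mountain pass geometry at the origin
  obtain ⟨C₁, hC₁, hfC₁⟩ := exists_growth hfc hf0 h0 hinf
    (show 0 < 1 / (4 * (‖T‖ ^ 2 + 1)) by positivity)
  have hΦsmall : ∀ x, Φ x ≤ ‖x‖ ^ 2 / 4 + C₁ * A * ‖x‖ ^ p := by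
    intro x
    have h1 : Φ x ≤ ∫ w, (1 / (4 * (‖T‖ ^ 2 + 1)) * T x w ^ 2 + C₁ * |T x w| ^ p) ∂μ := by
      refine integral_mono (hintF x)
        (((integrable_sq_coeFn (T x)).const_mul _).add ((hT x).const_mul _)) fun w => ?_
      have := abs_primitive_le hp (by positivity) hC₁ hfC₁ (T x w)
      rw [sq_abs] at this
      exact (le_abs_self _).trans this
    rw [integral_add ((integrable_sq_coeFn (T x)).const_mul _) ((hT x).const_mul _),
      integral_const_mul, integral_const_mul, integral_sq_coeFn] at h1
    have h2 := norm_apply_sq_le T (le_refl ‖x‖)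
    have h3 : 1 / (4 * (‖T‖ ^ 2 + 1)) * ‖T x‖ ^ 2 ≤ ‖x‖ ^ 2 / 4 := by
      rw [one_div_mul_eq_div, div_le_iff₀ (by positivity)]
      nlinarith [sq_nonneg ‖x‖]
    have h4 : C₁ * ∫ w, |T x w| ^ p ∂μ ≤ C₁ * (A * ‖x‖ ^ p) := by gcongr; exact hTA x
    linarith
  -- Of the coefficient 1/2 of `‖x‖²`, the quadratic part of `Φ` takes 1/4 and the `p`-growth part
  -- 1/8 on this ball; 1/8 is left.
  obtain ⟨r, hr0, hr⟩ : ∃ r : ℝ, 0 < r ∧ C₁ * A * r ^ (p - 2) ≤ 1 / 8 := by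
    have h1 : Tendsto (fun r : ℝ => C₁ * A * r ^ (p - 2)) (𝓝[>] 0) (𝓝 0) := by
      have h2 : ContinuousAt (fun r : ℝ => C₁ * A * r ^ (p - 2)) 0 :=
        continuousAt_const.mul (Real.continuousAt_rpow_const _ _ (Or.inr (by linarith)))
      have h3 := h2.tendsto.mono_left (nhdsWithin_le_nhds (s := Ioi 0))
      simpa [Real.zero_rpow (by linarith : p - 2 ≠ 0)] using h3
    obtain ⟨r, h2, h3⟩ := ((h1.eventually_le_const (by norm_num : (0 : ℝ) < 1 / 8)).and
      self_mem_nhdsWithin).exists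
    exact ⟨r, h3, h2⟩
  have hIlow : ∀ x, ‖x‖ ≤ r → ‖x‖ ^ 2 / 8 ≤ semilinearEnergy Φ x := by
    intro x hx
    rcases eq_or_ne x 0 with rfl | hx0
    · simp [semilinearEnergy, hΦ0]
    have hx' : 0 < ‖x‖ := norm_pos_iff.2 hx0
    have h1 := hΦsmall x
    have h2 : ‖x‖ ^ p = ‖x‖ ^ (p - 2) * ‖x‖ ^ 2 := by
      rw [← Real.rpow_natCast, ← Real.rpow_add hx']; norm_num
    have h3 : C₁ * A * ‖x‖ ^ (p - 2) ≤ 1 / 8 := by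
      refine le_trans ?_ hr
      have : 0 ≤ p - 2 := by linarith
      gcongr
    have h4 : C₁ * A * ‖x‖ ^ p ≤ 1 / 8 * ‖x‖ ^ 2 := by
      rw [h2, ← mul_assoc]; gcongr
    simp only [semilinearEnergy]
    linarith
  obtain ⟨x, hx, hx1, hx2⟩ := exists_mountainPass (K := K) (α := r ^ 2 / 8) hΦc hKc hΦ0 hKS
    (fun R η hη => by
      obtain ⟨L, hL, h⟩ := hexp R η hη
      refine ⟨L, hL, fun x y hx hy => ?_⟩
      have := (abs_le.1 (h x y hx hy)).1
      linarith) hθ hΦθ hr0 (by positivity)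
    (fun x hx => by rw [← hx]; exact hIlow x hx.le)
    (fun x hx => le_trans (by positivity) (hIlow x hx)) he hB
  exact ⟨x, fun y => by rw [← hK, hx], hx1, hx2⟩

end CriticalPoint

/-! ### Measure density of smooth bounded domains. -/

section Domain

variable {N : ℕ} {Ω : Set (EuclideanSpace ℝ (Fin N))}

/-- From `x ∈ Ω`, moving in a direction `v` with `dφ(v) < 0` only decreases `φ`, also for directions
close to `v`. Strict differentiability at `x₀` makes this uniform over base points near `x₀`. -/
lemma IsSmoothBoundedDomain.exists_ball_subset_near_frontier (hΩ : IsSmoothBoundedDomain Ω)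
    {x₀ : EuclideanSpace ℝ (Fin N)} (hx₀ : x₀ ∈ frontier Ω) :
    ∃ V ∈ 𝓝 x₀, ∃ δ : ℝ, 0 < δ ∧ ∀ x ∈ V ∩ Ω, ∀ r : ℝ, 0 < r → r ≤ 1 →
      ∃ z, Metric.ball z (δ * r) ⊆ Metric.ball x r ∩ Ω := by
  obtain ⟨U, φ, hU, hxU, hφ, -, hφ', hΩU⟩ := hΩ.smooth_boundary x₀ hx₀
  have hstrict : HasStrictFDerivAt φ (fderiv ℝ φ x₀) x₀ :=
    (hφ.contDiffAt (hU.mem_nhds hxU)).hasStrictFDerivAt (by simp)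
  set L := fderiv ℝ φ x₀ with hL
  obtain ⟨v, hv, hLv⟩ : ∃ v, ‖v‖ ≤ 1 / 2 ∧ L v < 0 := by
    obtain ⟨w, hw⟩ := DFunLike.ne_iff.1 hφ'
    have hw' : L w ≠ 0 := hw
    have hw0 : w ≠ 0 := fun h => hw' (by rw [h, map_zero])
    have hn : 0 < ‖w‖ := norm_pos_iff.2 hw0
    have hs : 0 < |L w| := abs_pos.2 hw'
    refine ⟨(-(L w) / |L w| * (2 * ‖w‖)⁻¹) • w, ?_, ?_⟩
    · rw [norm_smul, norm_mul, norm_div, norm_neg, Real.norm_eq_abs, Real.norm_eq_abs, abs_abs,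
        div_self hs.ne', norm_inv, norm_mul, norm_norm]
      simp only [Real.norm_ofNat]
      field_simp
      norm_num
    · rw [map_smul, smul_eq_mul]
      have : -(L w) / |L w| * (2 * ‖w‖)⁻¹ * L w = -((L w) ^ 2 / (|L w| * (2 * ‖w‖))) := by
        field_simp
      rw [this]
      have : 0 < (L w) ^ 2 := by positivity
      have : 0 < (L w) ^ 2 / (|L w| * (2 * ‖w‖)) := by positivity
      linarith
  set a := -L v with ha
  have ha0 : 0 < a := by linarith
  -- Deviating from `t • v` by `δ t` costs at most `a t / 4`, and so does the differentiability
  -- error; both fit inside the gain `a t`.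
  set δ := min (1 / 2) (a / (4 * (‖L‖ + 1))) with hδ
  have hδ0 : 0 < δ := by positivity
  have hδL : ‖L‖ * δ ≤ a / 4 := by
    have h1 : δ ≤ a / (4 * (‖L‖ + 1)) := min_le_right _ _
    rw [le_div_iff₀ (by positivity)] at h1
    nlinarith [norm_nonneg L]
  have hnear : ∀ᶠ q : EuclideanSpace ℝ (Fin N) × EuclideanSpace ℝ (Fin N) in 𝓝 (x₀, x₀),
      ‖φ q.1 - φ q.2 - L (q.1 - q.2)‖ ≤ a / 4 * ‖q.1 - q.2‖ :=
    hstrict.isLittleO.bound (by positivity)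
  have hnearU : ∀ᶠ q : EuclideanSpace ℝ (Fin N) × EuclideanSpace ℝ (Fin N) in 𝓝 (x₀, x₀),
      q.1 ∈ U ∧ q.2 ∈ U := by
    rw [nhds_prod_eq]
    exact prod_mem_prod (hU.mem_nhds hxU) (hU.mem_nhds hxU)
  obtain ⟨ρ, hρ, hρball⟩ := Metric.eventually_nhds_iff.1 (hnear.and hnearU)
  set η := min (ρ / 2) 1 with hη
  have hη0 : 0 < η := by positivity
  have hη1 : η ≤ 1 := min_le_right _ _
  have hηρ : 2 * η ≤ ρ := by have := min_le_left (ρ / 2) 1; linarith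
  refine ⟨Metric.ball x₀ η, Metric.ball_mem_nhds _ hη0, δ * η, by positivity, ?_⟩
  rintro x ⟨hx, hxΩ⟩ r hr hr1
  refine ⟨x + (η * r) • v, fun y hy => ?_⟩
  set t := η * r with ht
  have ht0 : 0 < t := by positivity
  have htη : t ≤ η := by nlinarith
  have htr : t ≤ r := by nlinarith
  have hyv : ‖(y - x) - t • v‖ < δ * t := by
    rw [mem_ball_iff_norm] at hy
    rw [show δ * t = δ * η * r by rw [ht]; ring, sub_sub]
    exact hy
  have hδ2 : δ ≤ 1 / 2 := min_le_left _ _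
  have hyx : ‖y - x‖ < t := by
    have h1 := norm_le_norm_add_norm_sub' (y - x) (t • v)
    have h2 : ‖t • v‖ ≤ t * (1 / 2) := by
      rw [norm_smul, Real.norm_eq_abs, abs_of_pos ht0]; gcongr
    nlinarith
  rw [Metric.mem_ball] at hx
  have hyx0 : dist y x₀ < ρ := by
    have := dist_triangle y x x₀
    rw [dist_eq_norm y x] at this
    linarith
  obtain ⟨h1, hyU, hxU'⟩ := hρball (y := (y, x)) (by
    rw [Prod.dist_eq]; exact max_lt hyx0 (by linarith))
  refine ⟨by rw [mem_ball_iff_norm]; linarith, ?_⟩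
  have hφx : φ x < 0 := by
    have : x ∈ Ω ∩ U := ⟨hxΩ, hxU'⟩
    rw [hΩU] at this
    exact this.1
  have hφy : φ y < 0 := by
    have h2 := (abs_le.1 h1).2
    have h3 : L (y - x) = L ((y - x) - t • v) + t * L v := by
      rw [map_sub L (y - x), map_smul, smul_eq_mul]; ring
    have h4 : L ((y - x) - t • v) ≤ ‖L‖ * (δ * t) :=
      (le_abs_self _).trans ((L.le_opNorm _).trans (by gcongr))
    simp only at h2
    nlinarith
  have : y ∈ {x | φ x < 0} ∩ U := ⟨hφy, hyU⟩
  rw [← hΩU] at this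
  exact this.1

/-- The local constants become one by compactness of the closure: interior points have a ball around
them, frontier points are covered by the previous lemma. -/
lemma IsSmoothBoundedDomain.exists_ball_subset (hΩ : IsSmoothBoundedDomain Ω) :
    ∃ δ : ℝ, 0 < δ ∧ ∀ x ∈ Ω, ∀ r : ℝ, 0 < r → r ≤ 1 →
      ∃ z, Metric.ball z (δ * r) ⊆ Metric.ball x r ∩ Ω := by
  have hK : IsCompact (closure Ω) := hΩ.isBounded.isCompact_closure
  have key := hK.induction_on (p := fun s => ∃ δ : ℝ, 0 < δ ∧ ∀ x ∈ s ∩ Ω, ∀ r : ℝ, 0 < r → r ≤ 1 →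
      ∃ z, Metric.ball z (δ * r) ⊆ Metric.ball x r ∩ Ω) ⟨1, one_pos, by simp⟩
    (fun s t hst ⟨δ, hδ, h⟩ => ⟨δ, hδ, fun x hx => h x ⟨hst hx.1, hx.2⟩⟩)
    (fun s t ⟨δ, hδ, h⟩ ⟨δ', hδ', h'⟩ => by
      refine ⟨min δ δ', lt_min hδ hδ', fun x hx r hr hr1 => ?_⟩
      rcases hx with ⟨hx | hx, hxΩ⟩
      · obtain ⟨z, hz⟩ := h x ⟨hx, hxΩ⟩ r hr hr1
        refine ⟨z, (Metric.ball_subset_ball ?_).trans hz⟩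
        gcongr; exact min_le_left _ _
      · obtain ⟨z, hz⟩ := h' x ⟨hx, hxΩ⟩ r hr hr1
        refine ⟨z, (Metric.ball_subset_ball ?_).trans hz⟩
        gcongr; exact min_le_right _ _)
    (fun x₀ hx₀ => by
      by_cases hx : x₀ ∈ Ω
      · obtain ⟨ρ, hρ, hball⟩ := Metric.isOpen_iff.1 hΩ.isOpen x₀ hx
        refine ⟨Metric.ball x₀ (ρ / 2), mem_nhdsWithin_of_mem_nhds
          (Metric.ball_mem_nhds _ (by positivity)), min (ρ / 2) 1, by positivity, ?_⟩
        rintro x ⟨hxρ, -⟩ r hr hr1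
        have h1 : min (ρ / 2) 1 * r ≤ r := by
          have := min_le_right (ρ / 2) 1; nlinarith
        have h2 : min (ρ / 2) 1 * r ≤ ρ / 2 := by
          have := min_le_left (ρ / 2) 1
          have : 0 < min (ρ / 2) 1 := by positivity
          nlinarith
        refine ⟨x, subset_inter (Metric.ball_subset_ball h1) (subset_trans ?_ hball)⟩
        refine Metric.ball_subset_ball' ?_
        rw [Metric.mem_ball] at hxρ
        linarith
      · have : x₀ ∈ frontier Ω := by
          rw [frontier, hΩ.isOpen.interior_eq]; exact ⟨hx₀, hx⟩
        obtain ⟨V, hV, δ, hδ, h⟩ := hΩ.exists_ball_subset_near_frontier this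
        exact ⟨V, mem_nhdsWithin_of_mem_nhds hV, δ, hδ, h⟩)
  obtain ⟨δ, hδ, h⟩ := key
  exact ⟨δ, hδ, fun x hx => h x ⟨subset_closure hx, hx⟩⟩

/-- Smooth bounded domains satisfy the measure density condition. -/
theorem IsSmoothBoundedDomain.exists_measure_ball_inter_ge (hΩ : IsSmoothBoundedDomain Ω) :
    ∃ c : ℝ, 0 < c ∧ ∀ x ∈ Ω, ∀ r : ℝ, 0 < r → r ≤ 1 →
      ENNReal.ofReal (c * r ^ N) ≤ volume (Metric.ball x r ∩ Ω) := by
  obtain ⟨δ, hδ, h⟩ := hΩ.exists_ball_subset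
  set b := volume (Metric.ball (0 : EuclideanSpace ℝ (Fin N)) 1) with hb
  have hb0 : 0 < b := Metric.measure_ball_pos _ _ one_pos
  have hbtop : b ≠ ⊤ := measure_ball_lt_top.ne
  refine ⟨δ ^ N * b.toReal, mul_pos (by positivity) (ENNReal.toReal_pos hb0.ne' hbtop),
    fun x hx r hr hr1 => ?_⟩
  obtain ⟨z, hz⟩ := h x hx r hr hr1
  refine le_trans (le_of_eq ?_) (measure_mono hz)
  rw [Measure.addHaar_ball_of_pos _ _ (by positivity), finrank_euclideanSpace_fin, ← hb,
    show δ ^ N * b.toReal * r ^ N = (δ * r) ^ N * b.toReal by ring,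
    ENNReal.ofReal_mul (by positivity), ENNReal.ofReal_toReal hbtop]

end Domain

/-! ### Subcritical fractional Sobolev embedding from measure density. -/

section Sobolev

variable {N : ℕ}

/-- The measure density condition `|B(x, r) ∩ Ω| ≥ c r^N` for `x ∈ Ω`, `r ≤ 1`. -/
def HasMeasureDensity (Ω : Set (EuclideanSpace ℝ (Fin N))) (c : ℝ) : Prop :=
  ∀ x ∈ Ω, ∀ r : ℝ, 0 < r → r ≤ 1 →
    ENNReal.ofReal (c * r ^ N) ≤ volume (Metric.ball x r ∩ Ω)

/-- `∫_Ω (u(x) - u(y))² / |x - y|^{N+2s} dy`, with values in `[0, ∞]`. -/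
def localEnergy (Ω : Set (EuclideanSpace ℝ (Fin N))) (s : ℝ)
    (u : EuclideanSpace ℝ (Fin N) → ℝ) (x : EuclideanSpace ℝ (Fin N)) : ENNReal :=
  ∫⁻ y in Ω, ENNReal.ofReal ((u x - u y) ^ 2 / ‖x - y‖ ^ ((N : ℝ) + 2 * s))

variable {Ω : Set (EuclideanSpace ℝ (Fin N))} {c s : ℝ} {u : EuclideanSpace ℝ (Fin N) → ℝ}

/-- An averaging argument: the sum of the two normalized integrands has integral at most 2 over
`B(x, r) ∩ Ω`, so some point lies below its mean, and both nonnegative summands are then small there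
at once. -/
lemma exists_near_good_point (hc : 0 < c) (hd : HasMeasureDensity Ω c)
    (hu : AEMeasurable u (volume.restrict Ω)) {x : EuclideanSpace ℝ (Fin N)} (hx : x ∈ Ω)
    {G M q r : ℝ} (hG : 0 < G) (hM : 0 < M) (hr : 0 < r) (hr1 : r ≤ 1)
    (hgag : localEnergy Ω s u x ≤ ENNReal.ofReal (G ^ 2))
    (hq : ∫⁻ y in Ω, ENNReal.ofReal (|u y| ^ q) ≤ ENNReal.ofReal (M ^ q)) :
    ∃ y, ‖x - y‖ < r ∧ (u x - u y) ^ 2 / ‖x - y‖ ^ ((N : ℝ) + 2 * s) ≤ 2 / (c * r ^ N) * G ^ 2 ∧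
      |u y| ^ q ≤ 2 / (c * r ^ N) * M ^ q := by
  set D := Metric.ball x r ∩ Ω with hD
  have hcr : 0 < c * r ^ N := by positivity
  have hDge : ENNReal.ofReal (c * r ^ N) ≤ volume D := hd x hx r hr hr1
  have hD0 : volume D ≠ 0 := ((ENNReal.ofReal_pos.2 hcr).trans_le hDge).ne'
  have hDtop : volume D ≠ ⊤ :=
    ((measure_mono inter_subset_left).trans_lt measure_ball_lt_top).ne
  set a : EuclideanSpace ℝ (Fin N) → ℝ := fun y =>
    (u x - u y) ^ 2 / ‖x - y‖ ^ ((N : ℝ) + 2 * s)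
  set b : EuclideanSpace ℝ (Fin N) → ℝ := fun y => |u y| ^ q
  have ha0 : ∀ y, 0 ≤ a y := fun y => by positivity
  have hb0 : ∀ y, 0 ≤ b y := fun y => by positivity
  have ham : AEMeasurable a (volume.restrict Ω) := by
    refine AEMeasurable.div ((aemeasurable_const.sub hu).pow_const 2) ?_
    exact Measurable.aemeasurable (by fun_prop)
  have hbm : AEMeasurable b (volume.restrict Ω) := by
    have : AEMeasurable (fun y => |u y|) (volume.restrict Ω) := hu.abs
    exact this.pow_const q
  have hM0 : 0 < M ^ q := by positivity
  set g : EuclideanSpace ℝ (Fin N) → ENNReal := fun y =>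
    ENNReal.ofReal ((G ^ 2)⁻¹) * ENNReal.ofReal (a y) +
      ENNReal.ofReal ((M ^ q)⁻¹) * ENNReal.ofReal (b y) with hg
  have hgm : AEMeasurable g (volume.restrict Ω) :=
    (ham.ennreal_ofReal.const_mul _).add (hbm.ennreal_ofReal.const_mul _)
  have hgint : ∫⁻ y in D, g y ≤ 2 := by
    calc ∫⁻ y in D, g y ≤ ∫⁻ y in Ω, g y := lintegral_mono_set inter_subset_right
      _ = (ENNReal.ofReal ((G ^ 2)⁻¹) * ∫⁻ y in Ω, ENNReal.ofReal (a y)) +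
          ENNReal.ofReal ((M ^ q)⁻¹) * ∫⁻ y in Ω, ENNReal.ofReal (b y) := by
        rw [hg, lintegral_add_left' (ham.ennreal_ofReal.const_mul _),
          lintegral_const_mul'' _ ham.ennreal_ofReal, lintegral_const_mul'' _ hbm.ennreal_ofReal]
      _ ≤ ENNReal.ofReal ((G ^ 2)⁻¹) * ENNReal.ofReal (G ^ 2) +
          ENNReal.ofReal ((M ^ q)⁻¹) * ENNReal.ofReal (M ^ q) := by
        gcongr; exact hgag
      _ = 2 := by
        rw [← ENNReal.ofReal_mul (by positivity), ← ENNReal.ofReal_mul (by positivity),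
          inv_mul_cancel₀ (by positivity), inv_mul_cancel₀ hM0.ne', ENNReal.ofReal_one]
        norm_num
  obtain ⟨y, hyD, hy⟩ := exists_le_setLAverage hD0 hDtop (hgm.mono_measure
    (Measure.restrict_mono inter_subset_right le_rfl))
  rw [setLAverage_eq] at hy
  have hy2 : g y ≤ ENNReal.ofReal (2 / (c * r ^ N)) := by
    refine hy.trans ?_
    rw [ENNReal.ofReal_div_of_pos hcr]
    refine ENNReal.div_le_div (hgint.trans (by simp)) hDge
  have hgy : g y = ENNReal.ofReal ((G ^ 2)⁻¹ * a y + (M ^ q)⁻¹ * b y) := by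
    have := ha0 y
    have := hb0 y
    rw [ENNReal.ofReal_add (by positivity) (by positivity), ENNReal.ofReal_mul (by positivity),
      ENNReal.ofReal_mul (by positivity)]
  rw [hgy, ENNReal.ofReal_le_ofReal_iff (by positivity)] at hy2
  have h1 : 0 ≤ (G ^ 2)⁻¹ * a y := by have := ha0 y; positivity
  have h2 : 0 ≤ (M ^ q)⁻¹ * b y := by have := hb0 y; positivity
  refine ⟨y, ?_, ?_, ?_⟩
  · have := hyD.1
    rwa [mem_ball_iff_norm, ← norm_neg, neg_sub] at this
  · have h3 : (G ^ 2)⁻¹ * a y ≤ 2 / (c * r ^ N) := by linarith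
    rwa [inv_mul_le_iff₀ (by positivity), mul_comm] at h3
  · have h3 : (M ^ q)⁻¹ * b y ≤ 2 / (c * r ^ N) := by linarith
    rwa [inv_mul_le_iff₀ (by positivity), mul_comm] at h3

/-- The pointwise estimate behind the Sobolev inequality. -/
lemma abs_le_of_localEnergy_le (hs : 0 < s) (hc : 0 < c) (hd : HasMeasureDensity Ω c)
    (hu : AEMeasurable u (volume.restrict Ω)) {x : EuclideanSpace ℝ (Fin N)} (hx : x ∈ Ω)
    {G M q r : ℝ} (hG : 0 < G) (hM : 0 < M) (hr : 0 < r) (hr1 : r ≤ 1) (hq2 : 1 ≤ q)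
    (hgag : localEnergy Ω s u x ≤ ENNReal.ofReal (G ^ 2))
    (hq : ∫⁻ y in Ω, ENNReal.ofReal (|u y| ^ q) ≤ ENNReal.ofReal (M ^ q)) :
    |u x| ≤ max (2 / c) 1 * (r ^ s * G + r ^ (-((N : ℝ) / q)) * M) := by
  obtain ⟨y, hyr, h1, h2⟩ := exists_near_good_point hc hd hu hx hG hM hr hr1 hgag hq
  set κ := max (2 / c) 1 with hκ
  have hκ1 : 1 ≤ κ := le_max_right _ _
  have hκ0 : 0 < κ := by linarith
  have hrN : 2 / (c * r ^ N) ≤ κ * r ^ (-(N : ℝ)) := by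
    rw [Real.rpow_neg hr.le, Real.rpow_natCast, ← div_div, div_eq_mul_inv (2 / c)]
    gcongr
    exact le_max_left _ _
  have hq0 : 0 < q := by linarith
  have hA : |u x - u y| ≤ κ * (r ^ s * G) := by
    have hd0 : 0 ≤ ‖x - y‖ := norm_nonneg _
    have hexp : 0 < (N : ℝ) + 2 * s := by positivity
    have h3 : (u x - u y) ^ 2 ≤ κ * r ^ (-(N : ℝ)) * G ^ 2 * r ^ ((N : ℝ) + 2 * s) := by
      rcases hd0.eq_or_lt with h0 | h0
      · have : x = y := by rw [← sub_eq_zero, ← norm_eq_zero]; exact h0.symm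
        rw [this, sub_self, zero_pow two_ne_zero]; positivity
      · rw [div_le_iff₀ (by positivity)] at h1
        refine h1.trans ?_
        gcongr
    have h4 : κ * r ^ (-(N : ℝ)) * G ^ 2 * r ^ ((N : ℝ) + 2 * s) = κ * (r ^ s * G) ^ 2 := by
      have : r ^ (-(N : ℝ)) * r ^ ((N : ℝ) + 2 * s) = (r ^ s) ^ 2 := by
        rw [← Real.rpow_add hr, ← Real.rpow_natCast, ← Real.rpow_mul hr.le]
        congr 1; push_cast; ring
      calc _ = κ * (r ^ (-(N : ℝ)) * r ^ ((N : ℝ) + 2 * s)) * G ^ 2 := by ring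
        _ = _ := by rw [this]; ring
    refine abs_le_of_sq_le_sq ?_ (by positivity)
    rw [h4] at h3
    refine h3.trans ?_
    rw [mul_pow κ]
    gcongr
    nlinarith
  have hB : |u y| ≤ κ * (r ^ (-((N : ℝ) / q)) * M) := by
    have h3 : |u y| ^ q ≤ (κ * (r ^ (-((N : ℝ) / q)) * M)) ^ q := by
      rw [Real.mul_rpow hκ0.le (by positivity), Real.mul_rpow (by positivity) hM.le,
        ← Real.rpow_mul hr.le, neg_mul, div_mul_cancel₀ _ hq0.ne', ← mul_assoc]
      refine h2.trans ?_
      gcongr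
      refine hrN.trans ?_
      gcongr
      exact Real.self_le_rpow_of_one_le hκ1 hq2
    exact (Real.rpow_le_rpow_iff (abs_nonneg _) (by positivity) hq0).1 h3
  have h5 : |u x| ≤ |u x - u y| + |u y| := by
    have := abs_add_le (u x - u y) (u y)
    rwa [sub_add_cancel] at this
  linarith

/-- The embedding of `H^s(Ω)` into `L^q(Ω)`. -/
def SobolevEmbedding (Ω : Set (EuclideanSpace ℝ (Fin N))) (s q : ℝ) : Prop :=
  ∃ A : ℝ, 0 < A ∧ ∀ (u : EuclideanSpace ℝ (Fin N) → ℝ) (h : ℝ), 0 < h →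
    AEMeasurable u (volume.restrict Ω) →
    ∫⁻ x in Ω, localEnergy Ω s u x ≤ ENNReal.ofReal (h ^ 2) →
    ∫⁻ x in Ω, ENNReal.ofReal (|u x| ^ (2 : ℝ)) ≤ ENNReal.ofReal (h ^ 2) →
    ∫⁻ x in Ω, ENNReal.ofReal (|u x| ^ q) ≤ ENNReal.ofReal ((A * h) ^ q)

lemma sobolevEmbedding_two : SobolevEmbedding Ω s 2 :=
  ⟨1, one_pos, fun u h _ _ _ h2 => by simpa using h2⟩

lemma aemeasurable_localEnergy (hu : AEMeasurable u (volume.restrict Ω)) :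
    AEMeasurable (localEnergy Ω s u) (volume.restrict Ω) := by
  have h1 : AEMeasurable (fun z : EuclideanSpace ℝ (Fin N) × EuclideanSpace ℝ (Fin N) =>
      ENNReal.ofReal ((u z.1 - u z.2) ^ 2 / ‖z.1 - z.2‖ ^ ((N : ℝ) + 2 * s)))
      ((volume.restrict Ω).prod (volume.restrict Ω)) := by
    refine (AEMeasurable.div ((hu.comp_fst.sub hu.comp_snd).pow_const 2) ?_).ennreal_ofReal
    exact Measurable.aemeasurable (by fun_prop)
  exact h1.lintegral_prod_right'

/-- Bootstrap: the pointwise estimate holds for every radius, and optimizing it at each `x` bounds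
`|u|^q'` by the local energy plus a constant, whose integral is controlled. -/
lemma SobolevEmbedding.improve (hs : 0 < s) (hc : 0 < c) (hd : HasMeasureDensity Ω c)
    (hN : 0 < N) (hΩ : MeasurableSet Ω) (hfin : volume Ω ≠ ⊤) {q : ℝ} (hq : 2 ≤ q)
    (hS : SobolevEmbedding Ω s q) : SobolevEmbedding Ω s (2 + 2 * s * q / N) := by
  obtain ⟨A, hA, hAq⟩ := hS
  set q' := 2 + 2 * s * q / N with hq'
  have hN' : (0 : ℝ) < N := by exact_mod_cast hN
  have hq0 : 0 < q := by linarith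
  have hq'0 : 0 < q' := by positivity
  set κ := max (2 / c) 1 with hκ
  have hκ0 : 0 < κ := by positivity
  set A₁ := κ * (1 + A) with hA₁
  have hA₁0 : 0 < A₁ := by positivity
  set V := (volume Ω).toReal with hV
  have hV0 : 0 ≤ V := ENNReal.toReal_nonneg
  set W := 2 + 2 * V with hW
  have hW0 : 0 < W := by positivity
  refine ⟨A₁ * W ^ (1 / q'), by positivity, fun u h hh hu hgag h2 => ?_⟩
  have hMq := hAq u h hh hu hgag h2
  have hfinae : ∀ᵐ x ∂(volume.restrict Ω), localEnergy Ω s u x < ⊤ :=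
    ae_lt_top' (aemeasurable_localEnergy hu) (hgag.trans_lt ENNReal.ofReal_lt_top).ne
  have hpt : ∀ᵐ x ∂(volume.restrict Ω), ENNReal.ofReal (|u x| ^ q') ≤
      ENNReal.ofReal (A₁ ^ q' * h ^ (q' - 2)) *
        (2 * localEnergy Ω s u x + ENNReal.ofReal (2 * h ^ 2)) := by
    filter_upwards [hfinae, ae_restrict_mem hΩ] with x hx hxΩ
    set g := Real.sqrt (localEnergy Ω s u x).toReal with hg
    have hg0 : 0 ≤ g := Real.sqrt_nonneg _
    have hgsq : ENNReal.ofReal (g ^ 2) = localEnergy Ω s u x := by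
      rw [hg, Real.sq_sqrt ENNReal.toReal_nonneg, ENNReal.ofReal_toReal hx.ne]
    set G := g + h with hG
    have hG0 : 0 < G := by positivity
    set β := 1 / (s + N / q) with hβ
    have hβ0 : 0 < β := by positivity
    -- The radius that balances `r^s G` with `r^(-N/q) h`. The exponent `q'` is the one for which
    -- the result is quadratic in `G`.
    set r := (h / G) ^ β with hr
    have hhG : h / G ≤ 1 := by rw [div_le_one hG0]; linarith
    have hr0 : 0 < r := by positivity
    have hr1 : r ≤ 1 := Real.rpow_le_one (by positivity) hhG hβ0.le
    have h3 := abs_le_of_localEnergy_le hs hc hd hu hxΩ hG0 (by positivity : 0 < A * h) hr0 hr1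
      (by linarith) (by
        rw [← hgsq]; exact ENNReal.ofReal_le_ofReal (by gcongr; linarith)) hMq
    have h4 : r ^ s * G = r ^ (-((N : ℝ) / q)) * h := by
      have h5 : r ^ s = r ^ (-((N : ℝ) / q)) * (h / G) := by
        have h6 : r ^ (1 / β) = h / G := by
          rw [hr, ← Real.rpow_mul (by positivity), mul_one_div_cancel hβ0.ne', Real.rpow_one]
        rw [← h6, ← Real.rpow_add hr0]
        congr 1
        rw [hβ]; field_simp; ring
      rw [h5]; field_simp
    have h7 : |u x| ≤ A₁ * (r ^ s * G) := by
      refine h3.trans (le_of_eq ?_)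
      rw [hA₁, show r ^ (-((N : ℝ) / q)) * (A * h) = A * (r ^ (-((N : ℝ) / q)) * h) by ring, ← h4]
      ring
    have h8 : (r ^ s * G) ^ q' = h ^ (q' - 2) * G ^ 2 := by
      rw [Real.mul_rpow (by positivity) hG0.le, hr, ← Real.rpow_mul (by positivity),
        ← Real.rpow_mul (by positivity), Real.div_rpow hh.le hG0.le]
      have h9 : β * (s * q') = q' - 2 := by
        rw [hβ, hq']; field_simp; ring
      rw [h9, Real.rpow_sub hG0 q' 2]
      have : G ^ (2 : ℝ) = G ^ 2 := by norm_cast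
      rw [this]
      have : 0 < G ^ q' := by positivity
      field_simp
    have h10 : |u x| ^ q' ≤ A₁ ^ q' * h ^ (q' - 2) * (2 * g ^ 2 + 2 * h ^ 2) := by
      calc |u x| ^ q' ≤ (A₁ * (r ^ s * G)) ^ q' := by gcongr
        _ = A₁ ^ q' * h ^ (q' - 2) * G ^ 2 := by
          rw [Real.mul_rpow hA₁0.le (by positivity), h8]; ring
        _ ≤ _ := by
          gcongr
          rw [hG]; nlinarith [sq_nonneg (g - h)]
    refine (ENNReal.ofReal_le_ofReal h10).trans (le_of_eq ?_)
    rw [ENNReal.ofReal_mul (by positivity), ENNReal.ofReal_add (by positivity) (by positivity),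
      ENNReal.ofReal_mul (by norm_num : (0 : ℝ) ≤ 2), hgsq]
    simp
  calc ∫⁻ x in Ω, ENNReal.ofReal (|u x| ^ q')
      ≤ ∫⁻ x in Ω, ENNReal.ofReal (A₁ ^ q' * h ^ (q' - 2)) *
        (2 * localEnergy Ω s u x + ENNReal.ofReal (2 * h ^ 2)) := lintegral_mono_ae hpt
    _ = ENNReal.ofReal (A₁ ^ q' * h ^ (q' - 2)) *
        ((2 * ∫⁻ x in Ω, localEnergy Ω s u x) + ENNReal.ofReal (2 * h ^ 2) * volume Ω) := by
      have hm := aemeasurable_localEnergy (s := s) hu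
      have hm2 : AEMeasurable (fun x => 2 * localEnergy Ω s u x + ENNReal.ofReal (2 * h ^ 2))
        (volume.restrict Ω) := (hm.const_mul _).add aemeasurable_const
      rw [lintegral_const_mul'' _ hm2,
        lintegral_add_left' (hm.const_mul _), lintegral_const_mul'' _ hm, setLIntegral_const]
    _ ≤ ENNReal.ofReal (A₁ ^ q' * h ^ (q' - 2)) *
        (2 * ENNReal.ofReal (h ^ 2) + ENNReal.ofReal (2 * h ^ 2) * ENNReal.ofReal V) := by
      rw [hV, ENNReal.ofReal_toReal hfin]
      gcongr
    _ = ENNReal.ofReal ((A₁ * W ^ (1 / q') * h) ^ q') := by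
      rw [show (2 : ENNReal) = ENNReal.ofReal 2 by simp, ← ENNReal.ofReal_mul (by norm_num),
        ← ENNReal.ofReal_mul (by positivity), ← ENNReal.ofReal_add (by positivity) (by positivity),
        ← ENNReal.ofReal_mul (by positivity)]
      congr 1
      rw [Real.mul_rpow (by positivity) hh.le, Real.mul_rpow hA₁0.le (by positivity),
        ← Real.rpow_mul hW0.le, one_div_mul_cancel hq'0.ne', Real.rpow_one,
        Real.rpow_sub hh q' 2]
      have : h ^ (2 : ℝ) = h ^ 2 := by norm_cast
      rw [this, hW]
      field_simp

/-- Interpolation at the scale `h`: values below `h` are handled by the `L²` bound, values above by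
the `L^q` bound. -/
lemma SobolevEmbedding.mono {p q : ℝ} (hp : 2 ≤ p) (hpq : p ≤ q) (hS : SobolevEmbedding Ω s q) :
    SobolevEmbedding Ω s p := by
  obtain ⟨A, hA, hAq⟩ := hS
  have hp0 : 0 < p := by linarith
  refine ⟨(1 + A ^ q) ^ (1 / p), by positivity, fun u h hh hu hgag h2 => ?_⟩
  have hpt : ∀ t : ℝ, 0 ≤ t → t ^ p ≤ h ^ (p - 2) * t ^ (2 : ℝ) + h ^ (p - q) * t ^ q := by
    intro t ht
    rcases ht.eq_or_lt with rfl | ht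
    · rw [Real.zero_rpow hp0.ne']; positivity
    rcases le_total t h with hth | hth
    · have h3 : t ^ p = t ^ (p - 2) * t ^ (2 : ℝ) := by
        rw [← Real.rpow_add ht]; congr 1; ring
      have h4 : t ^ (p - 2) ≤ h ^ (p - 2) := by
        have : 0 ≤ p - 2 := by linarith
        gcongr
      have h5 : t ^ (p - 2) * t ^ (2 : ℝ) ≤ h ^ (p - 2) * t ^ (2 : ℝ) := by gcongr
      have : 0 ≤ h ^ (p - q) * t ^ q := by positivity
      linarith
    · have h3 : t ^ p = t ^ (p - q) * t ^ q := by
        rw [← Real.rpow_add ht]; congr 1; ring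
      have h4 : t ^ (p - q) ≤ h ^ (p - q) :=
        Real.rpow_le_rpow_of_nonpos hh hth (by linarith)
      have h5 : t ^ (p - q) * t ^ q ≤ h ^ (p - q) * t ^ q := by gcongr
      have : 0 ≤ h ^ (p - 2) * t ^ (2 : ℝ) := by positivity
      linarith
  have hum : AEMeasurable (fun x => |u x|) (volume.restrict Ω) := hu.abs
  calc ∫⁻ x in Ω, ENNReal.ofReal (|u x| ^ p)
      ≤ ∫⁻ x in Ω, (ENNReal.ofReal (h ^ (p - 2)) * ENNReal.ofReal (|u x| ^ (2 : ℝ)) +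
          ENNReal.ofReal (h ^ (p - q)) * ENNReal.ofReal (|u x| ^ q)) := by
        refine lintegral_mono fun x => ?_
        rw [← ENNReal.ofReal_mul (by positivity), ← ENNReal.ofReal_mul (by positivity),
          ← ENNReal.ofReal_add (by positivity) (by positivity)]
        exact ENNReal.ofReal_le_ofReal (hpt _ (abs_nonneg _))
    _ = (ENNReal.ofReal (h ^ (p - 2)) * ∫⁻ x in Ω, ENNReal.ofReal (|u x| ^ (2 : ℝ))) +
          ENNReal.ofReal (h ^ (p - q)) * ∫⁻ x in Ω, ENNReal.ofReal (|u x| ^ q) := by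
        have m1 := (hum.pow_const (2 : ℝ)).ennreal_ofReal
        have m2 := (hum.pow_const q).ennreal_ofReal
        rw [lintegral_add_left' (m1.const_mul _), lintegral_const_mul'' _ m1,
          lintegral_const_mul'' _ m2]
    _ ≤ ENNReal.ofReal (h ^ (p - 2)) * ENNReal.ofReal (h ^ 2) +
          ENNReal.ofReal (h ^ (p - q)) * ENNReal.ofReal ((A * h) ^ q) := by
        gcongr
        exact hAq u h hh hu hgag h2
    _ = ENNReal.ofReal (((1 + A ^ q) ^ (1 / p) * h) ^ p) := by
        rw [← ENNReal.ofReal_mul (by positivity), ← ENNReal.ofReal_mul (by positivity),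
          ← ENNReal.ofReal_add (by positivity) (by positivity)]
        congr 1
        rw [Real.mul_rpow (x := (1 + A ^ q) ^ (1 / p)) (by positivity) hh.le,
          ← Real.rpow_mul (by positivity), one_div_mul_cancel hp0.ne', Real.rpow_one, Real.mul_rpow hA.le hh.le,
          Real.rpow_sub hh p 2, Real.rpow_sub hh p q]
        have : h ^ (2 : ℝ) = h ^ 2 := by norm_cast
        rw [this]
        have : 0 < h ^ q := by positivity
        field_simp

/-- The fractional Sobolev embedding for subcritical exponents. -/
theorem sobolevEmbedding_of_lt (hs : 0 < s) (hNs : 2 * s < N) (hc : 0 < c)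
    (hd : HasMeasureDensity Ω c) (hΩ : MeasurableSet Ω) (hfin : volume Ω ≠ ⊤) {p : ℝ}
    (hp : 2 ≤ p) (hpc : p < 2 * N / (N - 2 * s)) : SobolevEmbedding Ω s p := by
  have hN' : (0 : ℝ) < N := by linarith
  have hN : 0 < N := by exact_mod_cast hN'
  have hNs' : (0 : ℝ) < N - 2 * s := by linarith
  set qs := 2 * (N : ℝ) / (N - 2 * s) with hqs
  set l := 2 * s / N with hl
  have hl0 : 0 < l := by positivity
  have hl1 : l < 1 := by rw [hl, div_lt_one hN']; exact hNs
  have hfix : 2 + l * qs = qs := by rw [hqs, hl]; field_simp; ring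
  have hqs2 : 2 < qs := by linarith
  -- The improvement is the affine contraction `q ↦ 2 + l q`, whose fixed point is the critical
  -- exponent `qs`; starting from 2, the iterates increase to `qs` and so pass every subcritical
  -- `p`.
  have hiter : ∀ k : ℕ, SobolevEmbedding Ω s (qs - (qs - 2) * l ^ k) := by
    intro k
    induction k with
    | zero => simpa using sobolevEmbedding_two
    | succ k ih =>
      have hlk : l ^ k ≤ 1 := pow_le_one₀ hl0.le hl1.le
      have h1 := ih.improve hs hc hd hN hΩ hfin (by nlinarith)
      have h2 : 2 + 2 * s * (qs - (qs - 2) * l ^ k) / N = qs - (qs - 2) * l ^ (k + 1) := by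
        rw [show 2 * s * (qs - (qs - 2) * l ^ k) / N = l * (qs - (qs - 2) * l ^ k) by
          rw [hl]; ring]
        rw [pow_succ]
        linear_combination hfix
      rwa [h2] at h1
  have hlim : Tendsto (fun k : ℕ => qs - (qs - 2) * l ^ k) atTop (𝓝 qs) := by
    have := (tendsto_pow_atTop_nhds_zero_of_lt_one hl0.le hl1).const_mul (qs - 2)
    simpa using this.const_sub qs
  obtain ⟨k, hk⟩ := (hlim.eventually_const_lt hpc).exists
  exact (hiter k).mono hp hk.le

end Sobolev

/-! ### Compactness in `L²(Ω)` by local averaging. -/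

section Compactness

variable {N : ℕ} {Ω : Set (EuclideanSpace ℝ (Fin N))} {c s : ℝ}

/-- Nonnegativity of the variance of `g`, expanded around `a`. -/
lemma measureReal_mul_sq_sub_average_le {α : Type*} [MeasurableSpace α] {μ : Measure α}
    [IsFiniteMeasure μ] {g : α → ℝ} (hg : MemLp g 2 μ) (a : ℝ) (hμ : μ.real univ ≠ 0) :
    μ.real univ * (a - (μ.real univ)⁻¹ * ∫ y, g y ∂μ) ^ 2 ≤ ∫ y, (a - g y) ^ 2 ∂μ := by
  set V := μ.real univ with hV
  set m := V⁻¹ * ∫ y, g y ∂μ with hm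
  have hgi : Integrable g μ := hg.integrable one_le_two
  have hvi : Integrable (fun y => a - g y) μ := (integrable_const a).sub hgi
  have hvi2 : Integrable (fun y => (a - g y) ^ 2) μ := ((memLp_const a).sub hg).integrable_sq
  have h0 : 0 ≤ ∫ y, ((a - g y) - (a - m)) ^ 2 ∂μ := integral_nonneg fun y => sq_nonneg _
  have hI : ∫ y, (a - g y) ∂μ = V * (a - m) := by
    rw [integral_sub (integrable_const a) hgi, integral_const, smul_eq_mul, ← hV, hm]
    field_simp
  have h1 : ∫ y, ((a - g y) - (a - m)) ^ 2 ∂μ =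
      ∫ y, (a - g y) ^ 2 ∂μ - V * (a - m) ^ 2 := by
    have e : ∀ y, ((a - g y) - (a - m)) ^ 2 =
        (a - g y) ^ 2 - (2 * (a - m) * (a - g y) - (a - m) ^ 2) := fun y => by ring
    have i3 : Integrable (fun y => 2 * (a - m) * (a - g y) - (a - m) ^ 2) μ :=
      (hvi.const_mul _).sub (integrable_const _)
    simp_rw [e]
    rw [integral_sub hvi2 i3, integral_sub (hvi.const_mul _) (integrable_const _),
      integral_const_mul, hI, integral_const, smul_eq_mul, ← hV]
    ring
  linarith

/-- On the ball `|x - y| < 2r`, so inserting the kernel costs `(2r)^(N+2s)`; dividing by the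
measure, at least `c r^N`, leaves `r^(2s)`. -/
lemma sq_sub_average_le_localEnergy (hc : 0 < c) (hs : 0 < s) (hd : HasMeasureDensity Ω c)
    {g : EuclideanSpace ℝ (Fin N) → ℝ} (hg : MemLp g 2 (volume.restrict Ω))
    {x z : EuclideanSpace ℝ (Fin N)} {r : ℝ} (hr : 0 < r) (hr1 : r ≤ 1) (hz : z ∈ Ω)
    (hxz : x ∈ Metric.ball z r) :
    ENNReal.ofReal ((g x - (volume.real (Metric.ball z r ∩ Ω))⁻¹ *
      ∫ y in Metric.ball z r ∩ Ω, g y) ^ 2) ≤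
      ENNReal.ofReal (2 ^ ((N : ℝ) + 2 * s) / c * r ^ (2 * s)) * localEnergy Ω s g x := by
  set D := Metric.ball z r ∩ Ω with hD
  have hcr : 0 < c * r ^ N := by positivity
  have hDge : ENNReal.ofReal (c * r ^ N) ≤ volume D := hd z hz r hr hr1
  have hDtop : volume D ≠ ⊤ :=
    ((measure_mono inter_subset_left).trans_lt measure_ball_lt_top).ne
  have : IsFiniteMeasure (volume.restrict D) := ⟨by simpa using hDtop.lt_top⟩
  have hgD : MemLp g 2 (volume.restrict D) :=
    hg.mono_measure (Measure.restrict_mono inter_subset_right le_rfl)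
  have hVge : c * r ^ N ≤ volume.real D := by
    rwa [Measure.real, ← ENNReal.ofReal_le_iff_le_toReal hDtop]
  have hV : (volume.restrict D).real univ = volume.real D := by simp
  have h1 := measureReal_mul_sq_sub_average_le hgD (g x) (by rw [hV]; linarith)
  rw [hV] at h1
  set m := (volume.real D)⁻¹ * ∫ y in D, g y
  have h2 : (g x - m) ^ 2 ≤ (c * r ^ N)⁻¹ * ∫ y in D, (g x - g y) ^ 2 := by
    rw [← div_eq_inv_mul, le_div_iff₀ hcr]
    nlinarith [sq_nonneg (g x - m)]
  have hvi2 : Integrable (fun y => (g x - g y) ^ 2) (volume.restrict D) :=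
    ((memLp_const (g x)).sub hgD).integrable_sq
  have hexp : 0 < (N : ℝ) + 2 * s := by positivity
  have h3 : ENNReal.ofReal (∫ y in D, (g x - g y) ^ 2) ≤
      ENNReal.ofReal ((2 * r) ^ ((N : ℝ) + 2 * s)) * localEnergy Ω s g x := by
    rw [ofReal_integral_eq_lintegral_ofReal hvi2 (Eventually.of_forall fun y => sq_nonneg _),
      localEnergy, ← lintegral_const_mul' _ _ ENNReal.ofReal_ne_top]
    refine le_trans ?_ (lintegral_mono_set (inter_subset_right : D ⊆ Ω))
    refine lintegral_mono_ae ?_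
    have hDball : ∀ᵐ y ∂(volume.restrict D), y ∈ Metric.ball z r :=
      ae_mono (Measure.restrict_mono (inter_subset_left : D ⊆ Metric.ball z r) le_rfl)
        (ae_restrict_mem measurableSet_ball)
    filter_upwards [hDball] with y hy
    rw [← ENNReal.ofReal_mul (by positivity)]
    refine ENNReal.ofReal_le_ofReal ?_
    rcases (norm_nonneg (x - y)).eq_or_lt with h0 | h0
    · have : x = y := by rw [← sub_eq_zero, ← norm_eq_zero]; exact h0.symm
      rw [this, sub_self, zero_pow two_ne_zero, zero_div, mul_zero]
    · rw [← mul_div_assoc, le_div_iff₀ (by positivity), mul_comm]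
      gcongr
      rw [← dist_eq_norm]
      have := dist_triangle_right x y z
      rw [Metric.mem_ball] at hy hxz
      linarith
  calc ENNReal.ofReal ((g x - m) ^ 2)
      ≤ ENNReal.ofReal ((c * r ^ N)⁻¹ * ∫ y in D, (g x - g y) ^ 2) := ENNReal.ofReal_le_ofReal h2
    _ = ENNReal.ofReal ((c * r ^ N)⁻¹) * ENNReal.ofReal (∫ y in D, (g x - g y) ^ 2) :=
        ENNReal.ofReal_mul (by positivity)
    _ ≤ ENNReal.ofReal ((c * r ^ N)⁻¹) *
        (ENNReal.ofReal ((2 * r) ^ ((N : ℝ) + 2 * s)) * localEnergy Ω s g x) := by gcongr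
    _ = _ := by
      rw [← mul_assoc, ← ENNReal.ofReal_mul (by positivity)]
      congr 2
      rw [Real.mul_rpow (by norm_num) hr.le, Real.rpow_add hr, Real.rpow_natCast]
      field_simp

/-- The index of the first ball containing a point turns a finite cover into a measurable partition.
The default index `n` is reserved for points outside all balls. -/
lemma exists_measurable_net {S : Set (EuclideanSpace ℝ (Fin N))} (hS : TotallyBounded S) {r : ℝ}
    (hr : 0 < r) : ∃ (n : ℕ) (e : Fin n → EuclideanSpace ℝ (Fin N))
      (i : EuclideanSpace ℝ (Fin N) → ℕ), (∀ k, e k ∈ S) ∧ Measurable i ∧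
      ∀ x ∈ S, ∃ k : Fin n, i x = k ∧ x ∈ Metric.ball (e k) r := by
  obtain ⟨t, htS, htfin, ht⟩ := Metric.finite_approx_of_totallyBounded hS r hr
  obtain ⟨n, e, he⟩ := htfin.fin_param
  obtain ⟨-, rfl⟩ := he
  classical
  set p : EuclideanSpace ℝ (Fin N) → ℕ → Prop := fun x k =>
    (∃ h : k < n, x ∈ Metric.ball (e ⟨k, h⟩) r) ∨ n ≤ k with hp
  have hp1 : ∀ x, ∃ k, p x k := fun x => ⟨n, Or.inr le_rfl⟩
  refine ⟨n, e, fun x => Nat.find (hp1 x), fun k => htS ⟨k, rfl⟩, ?_, ?_⟩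
  · refine measurable_find hp1 fun k => ?_
    by_cases hk : k < n
    · have : {x | p x k} = Metric.ball (e ⟨k, hk⟩) r := by
        ext x; simp [hp, hk, not_le.2 hk]
      rw [this]; exact measurableSet_ball
    · have : {x | p x k} = univ := by
        ext x; simp [hp, not_lt.1 hk]
      rw [this]; exact MeasurableSet.univ
  · intro x hx
    have h1 := ht hx
    simp only [mem_iUnion, exists_prop, mem_range, exists_exists_eq_and] at h1
    obtain ⟨k, hk⟩ := h1
    have hlt : Nat.find (hp1 x) < n := by
      refine lt_of_le_of_lt (Nat.find_min' (hp1 x) (m := k) (Or.inl ⟨k.2, hk⟩)) k.2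
    refine ⟨⟨Nat.find (hp1 x), hlt⟩, rfl, ?_⟩
    rcases Nat.find_spec (hp1 x) with ⟨h, hx'⟩ | h
    · exact hx'
    · exact absurd h (not_le.2 hlt)

/-- A finite rank approximation of an operator into `L²(Ω)` with fractional regularity. -/
lemma exists_compact_approx {H : Type*} [NormedAddCommGroup H] [NormedSpace ℝ H] (hc : 0 < c)
    (hs : 0 < s) (hd : HasMeasureDensity Ω c) (hΩ : MeasurableSet Ω) (hb : Bornology.IsBounded Ω)
    (T : H →L[ℝ] Lp ℝ 2 (volume.restrict Ω)) {B : ℝ} (hB : 0 ≤ B)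
    (hT : ∀ x, ∫⁻ w in Ω, localEnergy Ω s (T x) w ≤ ENNReal.ofReal (B * ‖x‖ ^ 2))
    {r : ℝ} (hr : 0 < r) (hr1 : r ≤ 1) :
    ∃ S : H →L[ℝ] Lp ℝ 2 (volume.restrict Ω), IsCompactOperator S ∧
      ‖T - S‖ ≤ Real.sqrt (2 ^ ((N : ℝ) + 2 * s) / c * r ^ (2 * s) * B) := by
  have hΩtop : volume Ω ≠ ⊤ := hb.measure_lt_top.ne
  have : IsFiniteMeasure (volume.restrict Ω) := ⟨by simpa using hΩtop.lt_top⟩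
  obtain ⟨n, e, i, heΩ, hi, hnet⟩ := exists_measurable_net (hb.isCompact_closure.totallyBounded.subset subset_closure) hr
  set D : Fin n → Set (EuclideanSpace ℝ (Fin N)) := fun k => Metric.ball (e k) r with hD
  have hDm : ∀ k, MeasurableSet (D k) := fun k => measurableSet_ball
  have hEm : ∀ k : Fin n, MeasurableSet (i ⁻¹' {(k : ℕ)}) := fun k => hi (measurableSet_singleton _)
  have hfinm : ∀ A, (volume.restrict Ω) A ≠ ⊤ := fun A => measure_ne_top _ _
  let l : Fin n → (Lp ℝ 2 (volume.restrict Ω) →L[ℝ] ℝ) := fun k =>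
    (volume.real (D k ∩ Ω))⁻¹ • innerSL ℝ (indicatorConstLp 2 (hDm k) (hfinm _) (1 : ℝ))
  have hl : ∀ k g, l k g = (volume.real (D k ∩ Ω))⁻¹ * ∫ y in D k ∩ Ω, g y := by
    intro k g
    simp only [l, smul_apply, smul_eq_mul, innerSL_apply_apply]
    rw [L2.inner_indicatorConstLp_one, Measure.restrict_restrict (hDm k)]
  -- On each disjoint cell `i = k` the function is replaced by its mean over the whole ball `D k ∩
  -- Ω`: the ball, unlike the cell, has the lower measure bound.
  let S : H →L[ℝ] Lp ℝ 2 (volume.restrict Ω) :=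
    ∑ k : Fin n, ((l k).comp T).smulRight (indicatorConstLp 2 (hEm k) (hfinm _) (1 : ℝ))
  refine ⟨S, ?_, ?_⟩
  · refine Submodule.sum_mem (compactOperator (RingHom.id ℝ) H (Lp ℝ 2 (volume.restrict Ω)))
      fun k _ => ?_
    exact (isCompactOperator_of_locallyCompactSpace_dom ((l k).comp T)).clm_comp
      (ContinuousLinearMap.toSpanSingleton ℝ (indicatorConstLp 2 (hEm k) (hfinm _) (1 : ℝ)))
  · refine ContinuousLinearMap.opNorm_le_bound _ (Real.sqrt_nonneg _) fun x => ?_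
    set K := 2 ^ ((N : ℝ) + 2 * s) / c * r ^ (2 * s) with hK
    have hK0 : 0 ≤ K := by positivity
    have hae : ∀ᵐ w ∂(volume.restrict Ω), ENNReal.ofReal (((T - S) x : Lp ℝ 2 (volume.restrict Ω)) w ^ 2) ≤
        ENNReal.ofReal K * localEnergy Ω s (T x) w := by
      have e1 : (T - S) x = T x - ∑ k : Fin n, (l k (T x)) •
          indicatorConstLp 2 (hEm k) (hfinm _) (1 : ℝ) := by
        simp [S]
      have e2 : ∀ᵐ w ∂(volume.restrict Ω), ∀ k : Fin n,
          (((l k (T x)) • indicatorConstLp 2 (hEm k) (hfinm _) (1 : ℝ) :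
            Lp ℝ 2 (volume.restrict Ω)) w) =
            l k (T x) * (i ⁻¹' {(k : ℕ)}).indicator (fun _ => (1 : ℝ)) w := by
        rw [ae_all_iff]
        intro k
        filter_upwards [Lp.coeFn_smul (l k (T x)) (indicatorConstLp 2 (hEm k) (hfinm _) (1 : ℝ)),
          indicatorConstLp_coeFn (p := 2) (hs := hEm k) (hμs := hfinm _) (c := (1 : ℝ))] with w h1 h2
        rw [h1, Pi.smul_apply, smul_eq_mul, h2]
      rw [e1]
      filter_upwards [e2, ae_restrict_mem hΩ, Lp.coeFn_sub (T x) (∑ k : Fin n, (l k (T x)) •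
          indicatorConstLp 2 (hEm k) (hfinm _) (1 : ℝ)),
        Lp.coeFn_finsetSum Finset.univ (fun k : Fin n => (l k (T x)) •
          indicatorConstLp 2 (hEm k) (hfinm _) (1 : ℝ))] with w h1 hw h2 h3
      obtain ⟨k, hk, hwk⟩ := hnet w hw
      rw [h2, Pi.sub_apply, h3, Finset.sum_apply, Finset.sum_eq_single k, h1 k, hl,
        indicator_of_mem (by simp [hk]), mul_one]
      · exact sq_sub_average_le_localEnergy hc hs hd (Lp.memLp (T x)) hr hr1 (heΩ k) hwk
      · intro j _ hj
        rw [h1 j, indicator_of_notMem, mul_zero]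
        simp only [mem_preimage, mem_singleton_iff, hk]
        exact fun h => hj (Fin.ext h.symm)
      · simp
    have h1 : ENNReal.ofReal (‖(T - S) x‖ ^ 2) ≤ ENNReal.ofReal (K * (B * ‖x‖ ^ 2)) := by
      rw [← integral_sq_coeFn, ofReal_integral_eq_lintegral_ofReal (integrable_sq_coeFn _)
        (Eventually.of_forall fun y => sq_nonneg _)]
      refine (lintegral_mono_ae hae).trans ?_
      rw [lintegral_const_mul' _ _ ENNReal.ofReal_ne_top, ENNReal.ofReal_mul hK0]
      gcongr
      exact hT x
    rw [ENNReal.ofReal_le_ofReal_iff (by positivity)] at h1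
    refine le_of_sq_le_sq ?_ (by positivity)
    rw [mul_pow (Real.sqrt _), Real.sq_sqrt (by positivity)]
    linarith

/-- Fractional regularity implies compactness in `L²(Ω)`. -/
theorem isCompactOperator_of_localEnergy_le {H : Type*} [NormedAddCommGroup H] [NormedSpace ℝ H]
    (hc : 0 < c) (hs : 0 < s) (hd : HasMeasureDensity Ω c) (hΩ : MeasurableSet Ω)
    (hb : Bornology.IsBounded Ω) (T : H →L[ℝ] Lp ℝ 2 (volume.restrict Ω)) {B : ℝ} (hB : 0 ≤ B)
    (hT : ∀ x, ∫⁻ w in Ω, localEnergy Ω s (T x) w ≤ ENNReal.ofReal (B * ‖x‖ ^ 2)) :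
    IsCompactOperator T := by
  have hpos : ∀ n : ℕ, (0 : ℝ) < 1 / ((n : ℝ) + 1) := fun n => by positivity
  have hle : ∀ n : ℕ, (1 : ℝ) / ((n : ℝ) + 1) ≤ 1 := fun n => by
    rw [div_le_one (by positivity)]; linarith [(Nat.cast_nonneg n : (0 : ℝ) ≤ n)]
  choose S hS hTS using fun n : ℕ =>
    exists_compact_approx hc hs hd hΩ hb T hB hT (hpos n) (hle n)
  refine isCompactOperator_of_tendsto (F := S) (l := atTop) ?_ (Eventually.of_forall hS)
  rw [tendsto_iff_norm_sub_tendsto_zero]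
  have hlim : Tendsto (fun n : ℕ => Real.sqrt (2 ^ ((N : ℝ) + 2 * s) / c *
      (1 / ((n : ℝ) + 1)) ^ (2 * s) * B)) atTop (𝓝 0) := by
    have h1 : ContinuousAt (fun r : ℝ => Real.sqrt (2 ^ ((N : ℝ) + 2 * s) / c *
        r ^ (2 * s) * B)) 0 := by
      have : ContinuousAt (fun r : ℝ => r ^ (2 * s)) 0 :=
        Real.continuousAt_rpow_const _ _ (Or.inr (by positivity))
      fun_prop
    have h2 := h1.tendsto.comp (tendsto_one_div_add_atTop_nhds_zero_nat (𝕜 := ℝ))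
    simpa [Function.comp_def, Real.zero_rpow (by positivity : 2 * s ≠ 0)] using h2
  refine squeeze_zero (fun _ => norm_nonneg _) (fun n => ?_) hlim
  rw [norm_sub_rev]
  exact hTS n

end Compactness

/-! ### `H^s(Ω)` as a closed subspace of a product of `L²` spaces. -/

section HilbertSpace

open scoped RealInnerProductSpace

variable {N : ℕ}

/-- `√k (u(x) - u(y)) / |x - y|^{(N+2s)/2}`. -/
def diffQuotient (s k : ℝ) (u : EuclideanSpace ℝ (Fin N) → ℝ)
    (z : EuclideanSpace ℝ (Fin N) × EuclideanSpace ℝ (Fin N)) : ℝ :=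
  Real.sqrt k * (u z.1 - u z.2) / Real.sqrt (‖z.1 - z.2‖ ^ ((N : ℝ) + 2 * s))

/-- The ambient Hilbert space of pairs (difference quotient, restriction to `Ω`). -/
abbrev PairSpace (Ω : Set (EuclideanSpace ℝ (Fin N))) : Type :=
  WithLp 2 (Lp ℝ 2 ((volume : Measure (EuclideanSpace ℝ (Fin N) × EuclideanSpace ℝ (Fin N))).restrict
    (crossRegion Ω)) × Lp ℝ 2 ((volume : Measure (EuclideanSpace ℝ (Fin N))).restrict Ω))

/-- The element `x` of the pair space is represented by the function `u`. -/
def IsRep {Ω : Set (EuclideanSpace ℝ (Fin N))} (s k : ℝ) (x : PairSpace Ω)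
    (u : EuclideanSpace ℝ (Fin N) → ℝ) : Prop :=
  AEMeasurable u volume ∧ x.fst =ᵐ[volume.restrict (crossRegion Ω)] diffQuotient s k u ∧
    x.snd =ᵐ[volume.restrict Ω] u

variable {Ω : Set (EuclideanSpace ℝ (Fin N))} {s k : ℝ} {u v : EuclideanSpace ℝ (Fin N) → ℝ}

lemma diffQuotient_mul (hk : 0 ≤ k) (z : EuclideanSpace ℝ (Fin N) × EuclideanSpace ℝ (Fin N)) :
    diffQuotient s k u z * diffQuotient s k v z = k * gagliardoIntegrand s u v z := by
  unfold diffQuotient gagliardoIntegrand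
  have h1 : Real.sqrt k * Real.sqrt k = k := Real.mul_self_sqrt hk
  have h2 : Real.sqrt (‖z.1 - z.2‖ ^ ((N : ℝ) + 2 * s)) *
      Real.sqrt (‖z.1 - z.2‖ ^ ((N : ℝ) + 2 * s)) = ‖z.1 - z.2‖ ^ ((N : ℝ) + 2 * s) :=
    Real.mul_self_sqrt (by positivity)
  rw [div_mul_div_comm, h2, ← mul_div_assoc]
  congr 1
  calc _ = (Real.sqrt k * Real.sqrt k) * ((u z.1 - u z.2) * (v z.1 - v z.2)) := by ring
    _ = _ := by rw [h1]

lemma aemeasurable_diffQuotient (hu : AEMeasurable u volume) :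
    AEMeasurable (diffQuotient s k u) volume := by
  rw [Measure.volume_eq_prod]
  refine AEMeasurable.div ((hu.comp_fst.sub hu.comp_snd).const_mul _) ?_
  exact Measurable.aemeasurable (by fun_prop)

lemma diffQuotient_add (z : EuclideanSpace ℝ (Fin N) × EuclideanSpace ℝ (Fin N)) :
    diffQuotient s k (u + v) z = diffQuotient s k u z + diffQuotient s k v z := by
  simp only [diffQuotient, Pi.add_apply]; ring

lemma diffQuotient_smul (a : ℝ) (z : EuclideanSpace ℝ (Fin N) × EuclideanSpace ℝ (Fin N)) :
    diffQuotient s k (a • u) z = a * diffQuotient s k u z := by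
  simp only [diffQuotient, Pi.smul_apply, smul_eq_mul]; ring

variable (Ω s k) in
/-- `H^s(Ω)`, as a subspace of the pair space. -/
def hsSubmodule : Submodule ℝ (PairSpace Ω) where
  carrier := {x | ∃ u, IsRep s k x u}
  add_mem' := by
    rintro x y ⟨u, hu, hu1, hu2⟩ ⟨v, hv, hv1, hv2⟩
    refine ⟨u + v, hu.add hv, ?_, ?_⟩
    · rw [WithLp.add_fst]
      filter_upwards [hu1, hv1, Lp.coeFn_add x.fst y.fst] with z h1 h2 h3
      rw [h3, Pi.add_apply, h1, h2, diffQuotient_add]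
    · rw [WithLp.add_snd]
      filter_upwards [hu2, hv2, Lp.coeFn_add x.snd y.snd] with z h1 h2 h3
      rw [h3, Pi.add_apply, h1, h2, Pi.add_apply]
  zero_mem' := by
    refine ⟨0, aemeasurable_const, ?_, ?_⟩
    · rw [WithLp.zero_fst]
      filter_upwards [Lp.coeFn_zero ℝ 2 ((volume : Measure (EuclideanSpace ℝ (Fin N) ×
        EuclideanSpace ℝ (Fin N))).restrict (crossRegion Ω))] with z h1
      rw [h1]; simp [diffQuotient]
    · rw [WithLp.zero_snd]
      filter_upwards [Lp.coeFn_zero ℝ 2 ((volume : Measure (EuclideanSpace ℝ (Fin N))).restrict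
        Ω)] with z h1
      rw [h1]
  smul_mem' := by
    rintro a x ⟨u, hu, hu1, hu2⟩
    refine ⟨a • u, hu.const_smul a, ?_, ?_⟩
    · rw [WithLp.smul_fst]
      filter_upwards [hu1, Lp.coeFn_smul a x.fst] with z h1 h3
      rw [h3, Pi.smul_apply, h1, diffQuotient_smul, smul_eq_mul]
    · rw [WithLp.smul_snd]
      filter_upwards [hu2, Lp.coeFn_smul a x.snd] with z h1 h3
      rw [h3, Pi.smul_apply, h1, Pi.smul_apply]

lemma IsRep.inner_eq (hk : 0 ≤ k) {x y : PairSpace Ω} (hx : IsRep s k x u) (hy : IsRep s k y v) :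
    ⟪x, y⟫ = k * (∫ z in crossRegion Ω, gagliardoIntegrand s u v z) + ∫ w in Ω, u w * v w := by
  rw [WithLp.prod_inner_apply, L2.inner_def, L2.inner_def, ← integral_const_mul]
  congr 1
  · refine integral_congr_ae ?_
    filter_upwards [hx.2.1, hy.2.1] with z h1 h2
    rw [← diffQuotient_mul hk, ← h1, ← h2]
    rw [RCLike.inner_apply, conj_trivial, mul_comm]; rfl
  · refine integral_congr_ae ?_
    filter_upwards [hx.2.2, hy.2.2] with z h1 h2
    rw [← h1, ← h2]
    rw [RCLike.inner_apply, conj_trivial, mul_comm]; rfl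

lemma IsRep.memHs (hk : 0 < k) {x : PairSpace Ω} (hx : IsRep s k x u) : MemHs Ω s u := by
  refine ⟨hx.1, ?_, ?_⟩
  · have h1 := (integrable_sq_coeFn x.fst).const_mul k⁻¹
    refine h1.congr ?_
    filter_upwards [hx.2.1] with z h
    rw [h, sq, diffQuotient_mul hk.le, inv_mul_cancel_left₀ hk.ne']
  · refine (integrable_sq_coeFn x.snd).congr ?_
    filter_upwards [hx.2.2] with z h
    rw [h, sq]

lemma MemHs.exists_isRep (hk : 0 ≤ k) (hu : MemHs Ω s u) :
    ∃ x : hsSubmodule Ω s k, IsRep s k (x : PairSpace Ω) u := by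
  have h1 : MemLp (diffQuotient s k u) 2 (volume.restrict (crossRegion Ω)) := by
    rw [memLp_two_iff_integrable_sq (aemeasurable_diffQuotient hu.1).restrict.aestronglyMeasurable]
    refine (hu.2.1.const_mul k).congr (Eventually.of_forall fun z => ?_)
    simp only
    rw [sq, diffQuotient_mul hk]
  have h2 : MemLp u 2 (volume.restrict Ω) := by
    rw [memLp_two_iff_integrable_sq hu.1.restrict.aestronglyMeasurable]
    refine hu.2.2.congr (Eventually.of_forall fun z => ?_)
    simp only
    rw [sq]
  have h3 : IsRep s k (WithLp.toLp 2 (h1.toLp, h2.toLp) : PairSpace Ω) u :=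
    ⟨hu.1, h1.coeFn_toLp, h2.coeFn_toLp⟩
  exact ⟨⟨_, u, h3⟩, h3⟩

lemma prod_restrict_compl_le (A : Set (EuclideanSpace ℝ (Fin N))) :
    ((volume : Measure (EuclideanSpace ℝ (Fin N))).restrict A).prod (volume.restrict Ω) ≤
      volume.restrict (crossRegion Ω) := by
  rw [Measure.prod_restrict, ← Measure.volume_eq_prod]
  refine Measure.restrict_mono ?_ le_rfl
  rintro z ⟨-, hz⟩ ⟨-, h⟩
  exact h hz

/-- Along a subsequence the functions converge a.e. on `Ω` and their difference quotients a.e. on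
the cross region. The limit function must also be produced outside `Ω`, where no norm of `u` is
available. -/
lemma isClosed_hsSubmodule (hk : 0 < k) (hΩm : MeasurableSet Ω) (hΩ0 : volume Ω ≠ 0) :
    IsClosed (hsSubmodule Ω s k : Set (PairSpace Ω)) := by
  refine IsSeqClosed.isClosed fun x a hx hxa => ?_
  choose u hu using hx
  have hfst : Tendsto (fun n => (x n).fst) atTop (𝓝 a.fst) :=
    ((WithLp.fstL 2 ℝ _ _).continuous.tendsto a).comp hxa
  have hsnd : Tendsto (fun n => (x n).snd) atTop (𝓝 a.snd) :=
    ((WithLp.sndL 2 ℝ _ _).continuous.tendsto a).comp hxa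
  obtain ⟨φ, hφ, h1⟩ := (tendstoInMeasure_of_tendsto_Lp hfst).exists_seq_tendsto_ae
  obtain ⟨ψ, hψ, h2⟩ :=
    (tendstoInMeasure_of_tendsto_Lp (hsnd.comp hφ.tendsto_atTop)).exists_seq_tendsto_ae
  set U : ℕ → EuclideanSpace ℝ (Fin N) → ℝ := fun n => u (φ (ψ n)) with hU
  have hUm : ∀ n, AEMeasurable (U n) volume := fun n => (hu _).1
  have hw : ∀ᵐ z ∂(volume.restrict (crossRegion Ω)),
      Tendsto (fun n => diffQuotient s k (U n) z) atTop (𝓝 (a.fst z)) := by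
    have h3 : ∀ᵐ z ∂(volume.restrict (crossRegion Ω)), ∀ n,
        (x (φ (ψ n))).fst z = diffQuotient s k (U n) z := by
      rw [ae_all_iff]; exact fun n => (hu _).2.1
    filter_upwards [h1, h3] with z h4 h5
    have := h4.comp hψ.tendsto_atTop
    simpa only [Function.comp_def, h5] using this
  have hg : ∀ᵐ y ∂(volume.restrict Ω), Tendsto (fun n => U n y) atTop (𝓝 (a.snd y)) := by
    have h3 : ∀ᵐ y ∂(volume.restrict Ω), ∀ n, (x (φ (ψ n))).snd y = U n y := by
      rw [ae_all_iff]; exact fun n => (hu _).2.2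
    filter_upwards [h2, h3] with y h4 h5
    simpa only [Function.comp_def, h5] using h4
  have hsk : 0 < Real.sqrt k := Real.sqrt_pos.2 hk
  have hlim : ∀ᵐ y, ∃ l, Tendsto (fun n => U n y) atTop (𝓝 l) := by
    refine ae_of_ae_restrict_of_ae_restrict_compl Ω (hg.mono fun y hy => ⟨_, hy⟩) ?_
    have h3 := Measure.ae_ae_of_ae_prod (ae_mono (prod_restrict_compl_le Ωᶜ) hw)
    have : (ae ((volume : Measure (EuclideanSpace ℝ (Fin N))).restrict Ω)).NeBot := by
      rw [ae_neBot]; simpa [Measure.restrict_eq_zero] using hΩ0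
    filter_upwards [h3, ae_restrict_mem hΩm.compl] with p hp hpΩ
    -- For almost every outer point `p` a single `y ∈ Ω` suffices: `U n p` is `U n y` plus a fixed
    -- multiple of the difference quotient at `(p, y)`, and both converge.
    obtain ⟨y, ⟨hy1, hy2⟩, hyΩ⟩ := ((hp.and hg).and (ae_restrict_mem hΩm)).exists
    have hpy : p - y ≠ 0 := sub_ne_zero.2 fun h => hpΩ (h ▸ hyΩ)
    set d := Real.sqrt (‖p - y‖ ^ ((N : ℝ) + 2 * s)) with hd
    have hd0 : 0 < d := Real.sqrt_pos.2 (Real.rpow_pos_of_pos (norm_pos_iff.2 hpy) _)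
    refine ⟨_, ((hy1.mul_const (d / Real.sqrt k)).add hy2).congr fun n => ?_⟩
    simp only [diffQuotient, ← hd]
    field_simp
    ring
  obtain ⟨u₀, hu₀m, hu₀⟩ := measurable_limit_of_tendsto_metrizable_ae hUm hlim
  refine ⟨u₀, hu₀m.aemeasurable, ?_, ?_⟩
  · have h3 : ∀ᵐ z ∂(volume : Measure (EuclideanSpace ℝ (Fin N) × EuclideanSpace ℝ (Fin N))),
        Tendsto (fun n => U n z.1) atTop (𝓝 (u₀ z.1)) ∧
        Tendsto (fun n => U n z.2) atTop (𝓝 (u₀ z.2)) := by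
      rw [Measure.volume_eq_prod]
      exact (Measure.quasiMeasurePreserving_fst.ae hu₀).and
        (Measure.quasiMeasurePreserving_snd.ae hu₀)
    filter_upwards [hw, ae_restrict_of_ae h3] with z h4 h5
    refine tendsto_nhds_unique h4 ?_
    exact ((h5.1.sub h5.2).const_mul _).div_const _
  · filter_upwards [hg, ae_restrict_of_ae hu₀] with y h4 h5
    exact tendsto_nhds_unique h4 h5

lemma lintegral_localEnergy_congr (h : u =ᵐ[volume.restrict Ω] v) :
    ∫⁻ w in Ω, localEnergy Ω s u w = ∫⁻ w in Ω, localEnergy Ω s v w := by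
  refine lintegral_congr_ae ?_
  filter_upwards [h] with w hw
  refine lintegral_congr_ae ?_
  filter_upwards [h] with y hy
  rw [hw, hy]

lemma MemHs.lintegral_localEnergy_le (hu : MemHs Ω s u) :
    ∫⁻ w in Ω, localEnergy Ω s u w ≤
      ENNReal.ofReal (∫ z in crossRegion Ω, gagliardoIntegrand s u u z) := by
  have h0 : ∀ z, 0 ≤ gagliardoIntegrand s u u z := fun z => by
    unfold gagliardoIntegrand
    exact div_nonneg (mul_self_nonneg _) (by positivity)
  rw [ofReal_integral_eq_lintegral_ofReal hu.2.1 (Eventually.of_forall h0)]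
  refine le_trans (le_of_eq ?_) (lintegral_mono' (prod_restrict_compl_le Ω) le_rfl)
  have hm : AEMeasurable (fun z => ENNReal.ofReal (gagliardoIntegrand s u u z))
      ((volume.restrict Ω).prod (volume.restrict Ω)) :=
    (hu.2.1.aemeasurable.mono_measure (prod_restrict_compl_le Ω)).ennreal_ofReal
  rw [lintegral_prod _ hm]
  refine lintegral_congr fun w => ?_
  unfold localEnergy gagliardoIntegrand
  refine lintegral_congr fun y => ?_
  rw [sq]

end HilbertSpace

/-! ### Scaling of tent functions. -/

section Bump

variable {N : ℕ}

/-- The kernel `min(1, |z|²) / |z|^{N+2s}`. -/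
def truncKernel (N : ℕ) (s : ℝ) (z : EuclideanSpace ℝ (Fin N)) : ℝ :=
  min 1 (‖z‖ ^ 2) / ‖z‖ ^ ((N : ℝ) + 2 * s)

lemma truncKernel_nonneg {s : ℝ} (z : EuclideanSpace ℝ (Fin N)) : 0 ≤ truncKernel N s z := by
  unfold truncKernel; positivity

/-- In polar coordinates the radial density is `r^(1-2s)` near 0, integrable since `s < 1`, and
`r^(-1-2s)` at infinity, integrable since `s > 0`. -/
lemma integrable_truncKernel {s : ℝ} (hs0 : 0 < s) (hs1 : s < 1) (hN : 0 < N) :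
    Integrable (truncKernel N s) := by
  have : Nonempty (Fin N) := ⟨⟨0, hN⟩⟩
  have key := integrable_fun_norm_addHaar
    (volume : Measure (EuclideanSpace ℝ (Fin N)))
    (f := fun r : ℝ => min 1 (r ^ 2) / r ^ ((N : ℝ) + 2 * s))
  refine key.2 ?_
  rw [finrank_euclideanSpace_fin]
  have hpow : ∀ y : ℝ, 0 < y → y ^ (N - 1) = y ^ ((N : ℝ) - 1) := fun y hy => by
    rw [← Real.rpow_natCast, Nat.cast_sub hN, Nat.cast_one]
  rw [← Ioc_union_Ioi_eq_Ioi (zero_le_one' ℝ)]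
  refine IntegrableOn.union ?_ ?_
  · have h1 : IntegrableOn (fun y : ℝ => y ^ (1 - 2 * s)) (Ioc 0 1) :=
      (intervalIntegrable_iff_integrableOn_Ioc_of_le zero_le_one).1
        (intervalIntegral.intervalIntegrable_rpow' (by linarith))
    refine h1.congr_fun (fun y hy => ?_) measurableSet_Ioc
    have hy0 : 0 < y := hy.1
    have hy2 : y ^ 2 ≤ 1 := pow_le_one₀ hy0.le hy.2
    simp only [smul_eq_mul]
    rw [min_eq_right hy2, hpow y hy0, ← Real.rpow_natCast y 2, ← Real.rpow_sub hy0,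
      ← Real.rpow_add hy0]
    congr 1; push_cast; ring
  · have h1 : IntegrableOn (fun y : ℝ => y ^ (-1 - 2 * s)) (Ioi 1) :=
      integrableOn_Ioi_rpow_of_lt (by linarith) one_pos
    refine h1.congr_fun (fun y hy => ?_) measurableSet_Ioi
    have hy1 : 1 < y := hy
    have hy0 : 0 < y := by linarith
    have hy2 : 1 ≤ y ^ 2 := one_le_pow₀ hy1.le
    simp only [smul_eq_mul]
    rw [min_eq_left hy2, hpow y hy0, one_div, ← Real.rpow_neg hy0.le, ← Real.rpow_add hy0]
    congr 1; ring

/-- The tent function `max(0, 1 - |x - x₀| / ε)`. -/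
def tent (x₀ : EuclideanSpace ℝ (Fin N)) (ε : ℝ) (x : EuclideanSpace ℝ (Fin N)) : ℝ :=
  max 0 (1 - ‖x - x₀‖ / ε)

variable {x₀ : EuclideanSpace ℝ (Fin N)} {ε s : ℝ}

lemma tent_nonneg (x : EuclideanSpace ℝ (Fin N)) : 0 ≤ tent x₀ ε x := le_max_left _ _

lemma continuous_tent : Continuous (tent x₀ ε) := by unfold tent; fun_prop

lemma tent_le_one (hε : 0 < ε) (x : EuclideanSpace ℝ (Fin N)) : tent x₀ ε x ≤ 1 := by
  have : 0 ≤ ‖x - x₀‖ / ε := by positivity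
  exact max_le zero_le_one (by linarith)

lemma tent_eq_zero (hε : 0 < ε) {x : EuclideanSpace ℝ (Fin N)} (hx : x ∉ Metric.ball x₀ ε) :
    tent x₀ ε x = 0 := by
  rw [mem_ball_iff_norm, not_lt] at hx
  have : 1 ≤ ‖x - x₀‖ / ε := by rwa [le_div_iff₀ hε, one_mul]
  exact max_eq_left (by linarith)

lemma half_le_tent (hε : 0 < ε) {x : EuclideanSpace ℝ (Fin N)}
    (hx : x ∈ Metric.ball x₀ (ε / 2)) : 1 / 2 ≤ tent x₀ ε x := by
  rw [mem_ball_iff_norm] at hx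
  have : ‖x - x₀‖ / ε ≤ 1 / 2 := by rw [div_le_iff₀ hε]; linarith
  exact le_trans (by linarith) (le_max_right _ _)

lemma abs_tent_sub_le (hε : 0 < ε) (x y : EuclideanSpace ℝ (Fin N)) :
    |tent x₀ ε x - tent x₀ ε y| ≤ ‖x - y‖ / ε := by
  have h1 : |tent x₀ ε x - tent x₀ ε y| ≤
      |(1 - ‖x - x₀‖ / ε) - (1 - ‖y - x₀‖ / ε)| := by
    have := abs_max_sub_max_le_abs (1 - ‖x - x₀‖ / ε) (1 - ‖y - x₀‖ / ε) 0
    unfold tent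
    rwa [max_comm 0, max_comm 0]
  refine h1.trans ?_
  have h2 : (1 - ‖x - x₀‖ / ε) - (1 - ‖y - x₀‖ / ε) = (‖y - x₀‖ - ‖x - x₀‖) / ε := by ring
  rw [h2, abs_div, abs_of_pos hε]
  gcongr
  have := abs_norm_sub_norm_le (y - x₀) (x - x₀)
  rwa [sub_sub_sub_cancel_right, norm_sub_rev y x] at this

/-- Only pairs with a point in the support contribute, and there the difference is at most `min(1,
|x - y| / ε)`. The bound is a product structure after a shear, which makes the double integral
explicit. -/
lemma gagliardoIntegrand_tent_le (hε : 0 < ε)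
    (z : EuclideanSpace ℝ (Fin N) × EuclideanSpace ℝ (Fin N)) :
    gagliardoIntegrand s (tent x₀ ε) (tent x₀ ε) z ≤
      (Metric.ball x₀ ε).indicator 1 z.1 *
        (ε ^ (-((N : ℝ) + 2 * s)) * truncKernel N s (ε⁻¹ • (z.1 - z.2))) +
      (Metric.ball x₀ ε).indicator 1 z.2 *
        (ε ^ (-((N : ℝ) + 2 * s)) * truncKernel N s (ε⁻¹ • (z.1 - z.2))) := by
  have hK : ε ^ (-((N : ℝ) + 2 * s)) * truncKernel N s (ε⁻¹ • (z.1 - z.2)) =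
      min 1 ((‖z.1 - z.2‖ / ε) ^ 2) / ‖z.1 - z.2‖ ^ ((N : ℝ) + 2 * s) := by
    unfold truncKernel
    rw [norm_smul, norm_inv, Real.norm_eq_abs, abs_of_pos hε, inv_mul_eq_div,
      Real.div_rpow (norm_nonneg _) hε.le, Real.rpow_neg hε.le]
    have : 0 < ε ^ ((N : ℝ) + 2 * s) := by positivity
    field_simp
  rw [hK]
  set m := min 1 ((‖z.1 - z.2‖ / ε) ^ 2) with hm
  have hm0 : 0 ≤ m := by positivity
  set d := ‖z.1 - z.2‖ ^ ((N : ℝ) + 2 * s) with hd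
  have hd0 : 0 ≤ d := by positivity
  have hsq : (tent x₀ ε z.1 - tent x₀ ε z.2) * (tent x₀ ε z.1 - tent x₀ ε z.2) ≤ m := by
    rw [← sq, ← sq_abs]
    refine le_min ?_ ?_
    · have h1 := tent_nonneg (x₀ := x₀) (ε := ε) z.1
      have h2 := tent_nonneg (x₀ := x₀) (ε := ε) z.2
      have h3 := tent_le_one (x₀ := x₀) hε z.1
      have h4 := tent_le_one (x₀ := x₀) hε z.2
      exact pow_le_one₀ (abs_nonneg _) (abs_le.2 ⟨by linarith, by linarith⟩)
    · have := abs_tent_sub_le (x₀ := x₀) hε z.1 z.2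
      gcongr
  have hmd : 0 ≤ m / d := by positivity
  have hle : gagliardoIntegrand s (tent x₀ ε) (tent x₀ ε) z ≤ m / d := by
    unfold gagliardoIntegrand; gcongr
  by_cases h1 : z.1 ∈ Metric.ball x₀ ε
  · have h2 : 0 ≤ (Metric.ball x₀ ε).indicator (1 : EuclideanSpace ℝ (Fin N) → ℝ) z.2 :=
      indicator_nonneg (fun _ _ => zero_le_one) _
    rw [indicator_of_mem h1, Pi.one_apply, one_mul]
    have : 0 ≤ (Metric.ball x₀ ε).indicator (1 : EuclideanSpace ℝ (Fin N) → ℝ) z.2 * (m / d) := by positivity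
    linarith
  · by_cases h2 : z.2 ∈ Metric.ball x₀ ε
    · rw [indicator_of_notMem h1, indicator_of_mem h2, Pi.one_apply, one_mul, zero_mul, zero_add]
      exact hle
    · rw [indicator_of_notMem h1, indicator_of_notMem h2]
      unfold gagliardoIntegrand
      rw [tent_eq_zero hε h1, tent_eq_zero hε h2]
      simp

/-- The scaling of the norm of the tent function. -/
theorem exists_tent_bound (hs0 : 0 < s) (hs1 : s < 1) (hN : 0 < N) :
    ∃ A : ℝ, 0 < A ∧ ∀ (Ω : Set (EuclideanSpace ℝ (Fin N))) (x₀ : EuclideanSpace ℝ (Fin N)) (ε : ℝ),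
      0 < ε → MemHs Ω s (tent x₀ ε) ∧
        ε ^ (2 * s) * (∫ z in crossRegion Ω, gagliardoIntegrand s (tent x₀ ε) (tent x₀ ε) z) ≤
          A * ε ^ N ∧
        ∫ x in Ω, tent x₀ ε x * tent x₀ ε x ≤ A * ε ^ N := by
  set b := volume.real (Metric.ball (0 : EuclideanSpace ℝ (Fin N)) 1) with hb
  have hb0 : 0 ≤ b := measureReal_nonneg
  set κ := ∫ z, truncKernel N s z with hκ
  have hκ0 : 0 ≤ κ := integral_nonneg truncKernel_nonneg
  have hKi := integrable_truncKernel hs0 hs1 hN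
  refine ⟨2 * b * κ + b + 1, by positivity, fun Ω x₀ ε hε => ?_⟩
  set B := Metric.ball x₀ ε with hB
  have hBvol : volume.real B = ε ^ N * b := by
    rw [hB, Measure.real, Measure.addHaar_ball_of_pos _ _ hε, finrank_euclideanSpace_fin,
      ENNReal.toReal_mul, ENNReal.toReal_ofReal (by positivity)]; rfl
  have hBi : Integrable (B.indicator (1 : EuclideanSpace ℝ (Fin N) → ℝ)) :=
    (integrable_indicator_iff measurableSet_ball).2
      (integrableOn_const measure_ball_lt_top.ne)
  have hBint : ∫ x, B.indicator (1 : EuclideanSpace ℝ (Fin N) → ℝ) x = ε ^ N * b := by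
    rw [integral_indicator_one measurableSet_ball, hBvol]
  set k : EuclideanSpace ℝ (Fin N) → ℝ := fun z =>
    ε ^ (-((N : ℝ) + 2 * s)) * truncKernel N s (ε⁻¹ • z) with hk
  have hki : Integrable k := (hKi.comp_smul (inv_ne_zero hε.ne')).const_mul _
  have hkint : ∫ z, k z = ε ^ (-(2 * s)) * κ := by
    rw [hk, integral_const_mul, Measure.integral_comp_inv_smul_of_nonneg _ _ hε.le,
      finrank_euclideanSpace_fin, smul_eq_mul, ← mul_assoc, ← hκ]
    congr 1
    rw [← Real.rpow_natCast, ← Real.rpow_add hε]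
    congr 1; ring
  have hkeven : ∀ z, k (-z) = k z := fun z => by simp [hk, truncKernel]
  set F : EuclideanSpace ℝ (Fin N) × EuclideanSpace ℝ (Fin N) → ℝ := fun z =>
    B.indicator 1 z.1 * k z.2 with hF
  have hFi : Integrable F (volume.prod volume) := hBi.mul_prod hki
  have hFint : ∫ z, F z ∂(volume.prod volume) = ε ^ N * b * (ε ^ (-(2 * s)) * κ) := by
    rw [hF, integral_prod_mul, hBint, hkint]
  -- The shears `(x, y) ↦ (x, y - x)` and `(x, y) ↦ (y, x - y)` preserve Lebesgue measure and turn
  -- both majorants into the product `F`.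
  have mp1 := measurePreserving_prod_sub (volume : Measure (EuclideanSpace ℝ (Fin N)))
    (volume : Measure (EuclideanSpace ℝ (Fin N)))
  have mp2 := measurePreserving_prod_sub_swap (volume : Measure (EuclideanSpace ℝ (Fin N)))
    (volume : Measure (EuclideanSpace ℝ (Fin N)))
  have hcomp : ∀ z : EuclideanSpace ℝ (Fin N) × EuclideanSpace ℝ (Fin N),
      gagliardoIntegrand s (tent x₀ ε) (tent x₀ ε) z ≤
        F (z.1, z.2 - z.1) + F (z.2, z.1 - z.2) := by
    intro z
    have h := gagliardoIntegrand_tent_le (s := s) (x₀ := x₀) hε z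
    have h2 : k (z.2 - z.1) = k (z.1 - z.2) := by rw [← hkeven, neg_sub]
    simp only [hF, h2]
    exact h
  have i1 := mp1.integrable_comp_of_integrable hFi
  have i2 := mp2.integrable_comp_of_integrable hFi
  have hmp : ∀ g : EuclideanSpace ℝ (Fin N) × EuclideanSpace ℝ (Fin N) →
      EuclideanSpace ℝ (Fin N) × EuclideanSpace ℝ (Fin N),
      MeasurePreserving g (volume.prod volume) (volume.prod volume) →
      ∫ z, (F ∘ g) z ∂(volume.prod volume) = ε ^ N * b * (ε ^ (-(2 * s)) * κ) := by
    intro g hg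
    have h := integral_map hg.aemeasurable (f := F) (by rw [hg.map_eq]; exact hFi.1)
    rw [hg.map_eq, hFint] at h
    exact h.symm
  have hg0 : ∀ z, 0 ≤ gagliardoIntegrand s (tent x₀ ε) (tent x₀ ε) z := fun z => by
    unfold gagliardoIntegrand
    exact div_nonneg (mul_self_nonneg _) (by positivity)
  have htm : Measurable (tent x₀ ε) := continuous_tent.measurable
  have hgm : Measurable (gagliardoIntegrand s (tent x₀ ε) (tent x₀ ε)) := by
    unfold gagliardoIntegrand; fun_prop
  have hgi : Integrable (gagliardoIntegrand s (tent x₀ ε) (tent x₀ ε)) := by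
    rw [Measure.volume_eq_prod]
    refine (i1.add i2).mono' hgm.aestronglyMeasurable (Eventually.of_forall fun z => ?_)
    rw [Real.norm_eq_abs, abs_of_nonneg (hg0 z)]
    exact hcomp z
  have hgint : ∫ z, gagliardoIntegrand s (tent x₀ ε) (tent x₀ ε) z ≤
      2 * (ε ^ N * b * (ε ^ (-(2 * s)) * κ)) := by
    rw [Measure.volume_eq_prod] at hgi ⊢
    refine (integral_mono hgi (i1.add i2) hcomp).trans (le_of_eq ?_)
    rw [integral_add' i1 i2, hmp _ mp1, hmp _ mp2]; ring
  have ht2 : ∀ x, tent x₀ ε x * tent x₀ ε x ≤ B.indicator 1 x := by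
    intro x
    by_cases hx : x ∈ B
    · rw [indicator_of_mem hx, Pi.one_apply]
      have h1 := tent_nonneg (x₀ := x₀) (ε := ε) x
      have h2 := tent_le_one (x₀ := x₀) hε x
      nlinarith
    · rw [indicator_of_notMem hx, tent_eq_zero hε hx, mul_zero]
  have ht2i : Integrable (fun x => tent x₀ ε x * tent x₀ ε x) := by
    refine hBi.mono' (htm.mul htm).aestronglyMeasurable (Eventually.of_forall fun x => ?_)
    rw [Real.norm_eq_abs, abs_of_nonneg (mul_self_nonneg _)]
    exact ht2 x
  have hεN : 0 < ε ^ N := by positivity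
  have hεs : ε ^ (2 * s) * ε ^ (-(2 * s)) = 1 := by
    rw [← Real.rpow_add hε]; simp
  have hεs0 : 0 ≤ ε ^ (2 * s) := by positivity
  refine ⟨⟨htm.aemeasurable, hgi.integrableOn, ht2i.integrableOn⟩, ?_, ?_⟩
  · have h1 : ∫ z in crossRegion Ω, gagliardoIntegrand s (tent x₀ ε) (tent x₀ ε) z ≤
        2 * (ε ^ N * b * (ε ^ (-(2 * s)) * κ)) :=
      (setIntegral_le_integral hgi (Eventually.of_forall hg0)).trans hgint
    calc _ ≤ ε ^ (2 * s) * (2 * (ε ^ N * b * (ε ^ (-(2 * s)) * κ))) := by gcongr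
      _ = (ε ^ (2 * s) * ε ^ (-(2 * s))) * (2 * b * κ * ε ^ N) := by ring
      _ = 2 * b * κ * ε ^ N := by rw [hεs, one_mul]
      _ ≤ _ := by gcongr; linarith
  · calc _ ≤ ∫ x, tent x₀ ε x * tent x₀ ε x :=
          setIntegral_le_integral ht2i (Eventually.of_forall fun x => mul_self_nonneg _)
      _ ≤ ∫ x, B.indicator (1 : EuclideanSpace ℝ (Fin N) → ℝ) x := integral_mono ht2i hBi ht2
      _ = b * ε ^ N := by rw [hBint, mul_comm]
      _ ≤ _ := by
        gcongr
        have : 0 ≤ 2 * b * κ := by positivity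
        linarith

end Bump

/-! ### Properties of weak solutions: integrability, sign, constants. -/

section WeakSolutions

open scoped RealInnerProductSpace

variable {N : ℕ} {Ω : Set (EuclideanSpace ℝ (Fin N))} {s ε p : ℝ} {f : ℝ → ℝ}
  {u v : EuclideanSpace ℝ (Fin N) → ℝ}

/-- The poles of the Gamma function are the nonpositive integers, and `-s` lies strictly between
`-1` and `0`. -/
lemma fracConst_pos (hs0 : 0 < s) (hs1 : s < 1) : 0 < fracConst N s := by
  have h1 : 0 < Real.Gamma ((N : ℝ) / 2 + s) := Real.Gamma_pos_of_pos (by positivity)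
  have h2 : Real.Gamma (-s) ≠ 0 := by
    refine Real.Gamma_ne_zero fun m h => ?_
    have h3 : s = m := by linarith
    rw [h3] at hs0 hs1
    have h4 : 0 < m := by exact_mod_cast hs0
    have h5 : m < 1 := by exact_mod_cast hs1
    omega
  unfold fracConst
  have := abs_pos.2 h2
  positivity

lemma gagliardoIntegrand_self_nonneg
    (z : EuclideanSpace ℝ (Fin N) × EuclideanSpace ℝ (Fin N)) :
    0 ≤ gagliardoIntegrand s u u z :=
  div_nonneg (mul_self_nonneg _) (by positivity)

lemma setIntegral_gagliardoIntegrand_nonneg :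
    0 ≤ ∫ z in crossRegion Ω, gagliardoIntegrand s u u z :=
  integral_nonneg gagliardoIntegrand_self_nonneg

lemma innerHs_self_nonneg (hk : 0 ≤ fracConst N s) (hε : 0 < ε) : 0 ≤ innerHs Ω s ε u u := by
  unfold innerHs
  have h1 := setIntegral_gagliardoIntegrand_nonneg (Ω := Ω) (s := s) (u := u)
  have h2 : 0 ≤ ∫ x in Ω, u x * u x := integral_nonneg fun x => mul_self_nonneg _
  positivity

lemma energy_eq : energy Ω s ε f u = innerHs Ω s ε u u / 2 - ∫ x in Ω, primitive f (u x) := by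
  have h1 : ∀ z : EuclideanSpace ℝ (Fin N) × EuclideanSpace ℝ (Fin N),
      |u z.1 - u z.2| ^ 2 / ‖z.1 - z.2‖ ^ ((N : ℝ) + 2 * s) = gagliardoIntegrand s u u z :=
    fun z => by unfold gagliardoIntegrand; rw [sq_abs, sq]
  have h2 : ∀ x, |u x| ^ 2 = u x * u x := fun x => by rw [sq_abs, sq]
  simp only [energy, innerHs, h1, h2]
  ring

lemma aemeasurable_gagliardoIntegrand (hu : AEMeasurable u volume) (hv : AEMeasurable v volume) :
    AEMeasurable (gagliardoIntegrand s u v) volume := by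
  rw [Measure.volume_eq_prod]
  refine AEMeasurable.div ((hu.comp_fst.sub hu.comp_snd).mul (hv.comp_fst.sub hv.comp_snd)) ?_
  exact Measurable.aemeasurable (by fun_prop)

lemma SobolevEmbedding.integrable_and_integral_le {A : ℝ} (hA : 0 < A)
    (hS : ∀ (u : EuclideanSpace ℝ (Fin N) → ℝ) (h : ℝ), 0 < h →
      AEMeasurable u (volume.restrict Ω) →
      ∫⁻ x in Ω, localEnergy Ω s u x ≤ ENNReal.ofReal (h ^ 2) →
      ∫⁻ x in Ω, ENNReal.ofReal (|u x| ^ (2 : ℝ)) ≤ ENNReal.ofReal (h ^ 2) →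
      ∫⁻ x in Ω, ENNReal.ofReal (|u x| ^ p) ≤ ENNReal.ofReal ((A * h) ^ p))
    {h : ℝ} (hh : 0 < h) (hu : AEMeasurable u (volume.restrict Ω))
    (hgag : ∫⁻ x in Ω, localEnergy Ω s u x ≤ ENNReal.ofReal (h ^ 2))
    (hui : IntegrableOn (fun x => u x ^ 2) Ω) (hu2 : ∫ x in Ω, u x ^ 2 ≤ h ^ 2) :
    IntegrableOn (fun x => |u x| ^ p) Ω ∧ ∫ x in Ω, |u x| ^ p ≤ (A * h) ^ p := by
  have h1 : ∫⁻ x in Ω, ENNReal.ofReal (|u x| ^ (2 : ℝ)) ≤ ENNReal.ofReal (h ^ 2) := by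
    have e : ∀ x, |u x| ^ (2 : ℝ) = u x ^ 2 := fun x => by
      rw [← sq_abs]; norm_cast
    simp only [e]
    rw [← ofReal_integral_eq_lintegral_ofReal hui (Eventually.of_forall fun x => sq_nonneg _)]
    exact ENNReal.ofReal_le_ofReal hu2
  have h2 := hS u h hh hu hgag h1
  have habs : AEMeasurable (fun x => |u x|) (volume.restrict Ω) := hu.abs
  have hm : AEMeasurable (fun x => |u x| ^ p) (volume.restrict Ω) := habs.pow_const p
  have h0 : 0 ≤ᵐ[volume.restrict Ω] fun x => |u x| ^ p :=
    Eventually.of_forall fun x => by simp only [Pi.zero_apply]; positivity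
  have hi : IntegrableOn (fun x => |u x| ^ p) Ω :=
    ⟨hm.aestronglyMeasurable,
      (hasFiniteIntegral_iff_ofReal h0).2 (h2.trans_lt ENNReal.ofReal_lt_top)⟩
  refine ⟨hi, ?_⟩
  rw [← ofReal_integral_eq_lintegral_ofReal hi h0,
    ENNReal.ofReal_le_ofReal_iff (by positivity)] at h2
  exact h2

lemma MemHs.memLp (hu : MemHs Ω s u) : MemLp u 2 (volume.restrict Ω) := by
  rw [memLp_two_iff_integrable_sq hu.1.restrict.aestronglyMeasurable]
  refine hu.2.2.congr (Eventually.of_forall fun z => ?_)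
  simp only
  rw [sq]

lemma MemHs.integrableOn_rpow (hS : SobolevEmbedding Ω s p) (hu : MemHs Ω s u) :
    IntegrableOn (fun x => |u x| ^ p) Ω := by
  obtain ⟨A, hA, hS⟩ := hS
  have h1 := setIntegral_gagliardoIntegrand_nonneg (Ω := Ω) (s := s) (u := u)
  have hu2 : IntegrableOn (fun x => u x ^ 2) Ω := hu.memLp.integrable_sq
  have h2 : 0 ≤ ∫ x in Ω, u x ^ 2 := integral_nonneg fun x => sq_nonneg _
  set h := Real.sqrt ((∫ z in crossRegion Ω, gagliardoIntegrand s u u z) +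
    (∫ x in Ω, u x ^ 2) + 1) with hh
  have hsq : h ^ 2 = (∫ z in crossRegion Ω, gagliardoIntegrand s u u z) +
    (∫ x in Ω, u x ^ 2) + 1 := Real.sq_sqrt (by positivity)
  refine (SobolevEmbedding.integrable_and_integral_le hA hS (h := h) (by positivity)
    hu.1.restrict ?_ hu2 (by rw [hsq]; linarith)).1
  exact hu.lintegral_localEnergy_le.trans (ENNReal.ofReal_le_ofReal (by rw [hsq]; linarith))

lemma MemHs.integrableOn_superposition (hS : SobolevEmbedding Ω s p) (hp : 2 < p)
    (hfc : Continuous f) {C : ℝ} (hC : 0 ≤ C) (hf : ∀ t, |f t| ≤ 1 * |t| + C * |t| ^ (p - 1))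
    (hu : MemHs Ω s u) :
    IntegrableOn (fun x => primitive f (u x)) Ω ∧ IntegrableOn (fun x => f (u x) * u x) Ω := by
  have h1 := hu.integrableOn_rpow hS
  set g := hu.memLp.toLp with hg
  have hgu : g =ᵐ[volume.restrict Ω] u := hu.memLp.coeFn_toLp
  have h2 : Integrable (fun x => |g x| ^ p) (volume.restrict Ω) := by
    refine h1.congr ?_
    filter_upwards [hgu] with x hx
    rw [hx]
  constructor
  · refine (integrable_primitive_coeFn hfc hC hp hf h2).congr ?_
    filter_upwards [hgu] with x hx
    rw [hx]
  · refine (integrable_superposition_mul hfc hC hp hf h2 h2).congr ?_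
    filter_upwards [hgu] with x hx
    rw [hx]

lemma IsWeakSolution.innerHs_self (hu : IsWeakSolution Ω s ε f u) :
    innerHs Ω s ε u u = ∫ x in Ω, f (u x) * u x := by
  linarith [hu.2 u hu.1]

lemma IsWeakSolution.normHs_sq (hk : 0 ≤ fracConst N s) (hε : 0 < ε)
    (hu : IsWeakSolution Ω s ε f u) : normHs Ω s ε u ^ 2 = ∫ x in Ω, f (u x) * u x := by
  rw [normHs, Real.sq_sqrt (innerHs_self_nonneg hk hε), hu.innerHs_self]

/-- A function of `H^s` vanishing on `Ω` with zero seminorm vanishes everywhere. -/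
lemma ae_eq_zero_of_gagliardoIntegrand (hΩm : MeasurableSet Ω) (hΩ0 : volume Ω ≠ 0)
    (hv : ∀ᵐ x ∂(volume.restrict Ω), v x = 0)
    (hg : ∀ᵐ z ∂(volume.restrict (crossRegion Ω)), gagliardoIntegrand s v v z = 0) :
    ∀ᵐ x, v x = 0 := by
  refine ae_of_ae_restrict_of_ae_restrict_compl Ω hv ?_
  have h3 := Measure.ae_ae_of_ae_prod (ae_mono (prod_restrict_compl_le Ωᶜ) hg)
  have : (ae ((volume : Measure (EuclideanSpace ℝ (Fin N))).restrict Ω)).NeBot := by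
    rw [ae_neBot]; simpa [Measure.restrict_eq_zero] using hΩ0
  filter_upwards [h3, ae_restrict_mem hΩm.compl] with q hq hqΩ
  obtain ⟨y, ⟨hy1, hy2⟩, hyΩ⟩ := ((hq.and hv).and (ae_restrict_mem hΩm)).exists
  have hqy : q - y ≠ 0 := sub_ne_zero.2 fun h => hqΩ (h ▸ hyΩ)
  have hd : 0 < ‖q - y‖ ^ ((N : ℝ) + 2 * s) := Real.rpow_pos_of_pos (norm_pos_iff.2 hqy) _
  unfold gagliardoIntegrand at hy1
  simp only [hy2, sub_zero] at hy1
  rw [div_eq_zero_iff] at hy1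
  rcases hy1 with h | h
  · exact mul_self_eq_zero.1 h
  · exact absurd h hd.ne'

lemma MemHs.of_abs_sub_le (hu : MemHs Ω s u) (hv : AEMeasurable v volume)
    (h1 : ∀ x y, |v x - v y| ≤ |u x - u y|) (h2 : ∀ x, |v x| ≤ |u x|) :
    MemHs Ω s v ∧ IntegrableOn (gagliardoIntegrand s u v) (crossRegion Ω) := by
  have hg1 : ∀ z, |gagliardoIntegrand s u v z| ≤ gagliardoIntegrand s u u z := fun z => by
    unfold gagliardoIntegrand
    rw [abs_div, abs_of_nonneg (by positivity : 0 ≤ ‖z.1 - z.2‖ ^ ((N : ℝ) + 2 * s)), abs_mul]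
    refine div_le_div_of_nonneg_right ?_ (by positivity)
    rw [← abs_mul_abs_self (u z.1 - u z.2)]
    exact mul_le_mul_of_nonneg_left (h1 _ _) (abs_nonneg _)
  have hg2 : ∀ z, |gagliardoIntegrand s v v z| ≤ gagliardoIntegrand s u u z := fun z => by
    unfold gagliardoIntegrand
    rw [abs_div, abs_of_nonneg (by positivity : 0 ≤ ‖z.1 - z.2‖ ^ ((N : ℝ) + 2 * s)), abs_mul]
    refine div_le_div_of_nonneg_right ?_ (by positivity)
    rw [← abs_mul_abs_self (u z.1 - u z.2)]
    exact mul_le_mul (h1 _ _) (h1 _ _) (abs_nonneg _) (abs_nonneg _)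
  refine ⟨⟨hv, ?_, ?_⟩, ?_⟩
  · exact hu.2.1.mono' (aemeasurable_gagliardoIntegrand hv hv).restrict.aestronglyMeasurable
      (Eventually.of_forall hg2)
  · refine hu.2.2.mono' (hv.mul hv).restrict.aestronglyMeasurable (Eventually.of_forall fun x => ?_)
    rw [Real.norm_eq_abs, abs_mul, ← abs_mul_abs_self (u x)]
    exact mul_le_mul (h2 x) (h2 x) (abs_nonneg _) (abs_nonneg _)
  · exact hu.2.1.mono' (aemeasurable_gagliardoIntegrand hu.1 hv).restrict.aestronglyMeasurable
      (Eventually.of_forall hg1)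

/-- Weak solutions are nonnegative when `f` vanishes on `(-∞, 0]`. -/
theorem IsWeakSolution.ae_nonneg (hk : 0 < fracConst N s) (hε : 0 < ε) (hΩm : MeasurableSet Ω)
    (hΩ0 : volume Ω ≠ 0) (hf0 : ∀ t, t ≤ 0 → f t = 0) (hu : IsWeakSolution Ω s ε f u) :
    ∀ᵐ x, 0 ≤ u x := by
  set v : EuclideanSpace ℝ (Fin N) → ℝ := fun x => min (u x) 0 with hv
  have hvm : AEMeasurable v volume := hu.1.1.min aemeasurable_const
  have habs : ∀ a b : ℝ, |min a 0 - min b 0| ≤ |a - b| := fun a b =>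
    (abs_min_sub_min_le_max a 0 b 0).trans (by simp)
  have hle : ∀ a : ℝ, |min a 0| ≤ |a| := fun a => by simpa using habs a 0
  obtain ⟨hvH, huv⟩ := hu.1.of_abs_sub_le hvm (fun x y => habs _ _) (fun x => hle _)
  have hweak := hu.2 v hvH
  have hzero : ∫ x in Ω, f (u x) * v x = 0 := by
    have : ∀ x, f (u x) * v x = 0 := fun x => by
      rcases le_total (u x) 0 with h | h
      · rw [hf0 _ h, zero_mul]
      · simp only [hv, min_eq_right h, mul_zero]
    simp [this]
  -- With `f(u) v = 0`, this inequality turns the weak equation tested with `v` into `‖v‖² ≤ 0`.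
  have hgle : ∀ z, gagliardoIntegrand s v v z ≤ gagliardoIntegrand s u v z := fun z => by
    unfold gagliardoIntegrand
    refine div_le_div_of_nonneg_right ?_ (by positivity)
    simp only [hv]
    rcases le_total (u z.1) 0 with h1 | h1 <;> rcases le_total (u z.2) 0 with h2 | h2 <;>
      simp only [h1, h2, min_eq_left, min_eq_right] <;> nlinarith
  have hint : ∫ z in crossRegion Ω, gagliardoIntegrand s v v z ≤
      ∫ z in crossRegion Ω, gagliardoIntegrand s u v z := integral_mono hvH.2.1 huv hgle
  have huvx : ∀ x, u x * v x = v x * v x := fun x => by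
    simp only [hv]
    rcases le_total (u x) 0 with h | h
    · rw [min_eq_left h]
    · rw [min_eq_right h]; simp
  have hk' : 0 < fracConst N s * ε ^ (2 * s) / 2 := by positivity
  have h1 := setIntegral_gagliardoIntegrand_nonneg (Ω := Ω) (s := s) (u := v)
  have h2 : 0 ≤ ∫ x in Ω, v x * v x := integral_nonneg fun x => mul_self_nonneg _
  rw [hzero, sub_zero, innerHs] at hweak
  simp only [huvx] at hweak
  have h3 := mul_le_mul_of_nonneg_left hint hk'.le
  have h4 := mul_nonneg hk'.le h1
  have h5 : ∫ x in Ω, v x * v x = 0 := by linarith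
  have h6 : ∫ z in crossRegion Ω, gagliardoIntegrand s v v z = 0 := by
    have : fracConst N s * ε ^ (2 * s) / 2 *
      ∫ z in crossRegion Ω, gagliardoIntegrand s v v z = 0 := by linarith
    exact (mul_eq_zero.1 this).resolve_left hk'.ne'
  have h7 := (integral_eq_zero_iff_of_nonneg (fun x => mul_self_nonneg _) hvH.2.2).1 h5
  have h8 := (integral_eq_zero_iff_of_nonneg gagliardoIntegrand_self_nonneg hvH.2.1).1 h6
  have h9 := ae_eq_zero_of_gagliardoIntegrand hΩm hΩ0
    (h7.mono fun x hx => mul_self_eq_zero.1 hx) h8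
  filter_upwards [h9] with x hx
  simp only [hv] at hx
  exact min_eq_right_iff.1 hx

/-- The energy of a weak solution that is constant on `Ω`. -/
theorem IsWeakSolution.energy_of_ae_const (hk : 0 < fracConst N s) (hε : 0 < ε)
    (hΩ0 : volume Ω ≠ 0) (hΩtop : volume Ω ≠ ⊤) (hf0 : ∀ t, t ≤ 0 → f t = 0)
    (hu : IsWeakSolution Ω s ε f u) {c : ℝ} (hc : ∀ᵐ x ∂(volume.restrict Ω), u x = c) :
    energy Ω s ε f u = 0 ∨
      (0 < c ∧ f c = c ∧ volume.real Ω * (c ^ 2 / 2 - primitive f c) ≤ energy Ω s ε f u) := by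
  have : IsFiniteMeasure (volume.restrict Ω) := ⟨by simpa using hΩtop.lt_top⟩
  have hV : 0 < volume.real Ω := ENNReal.toReal_pos hΩ0 hΩtop
  have hgone : ∀ w : EuclideanSpace ℝ (Fin N) → ℝ, ∀ z,
      gagliardoIntegrand s w (fun _ => 1) z = 0 := fun w z => by simp [gagliardoIntegrand]
  -- Testing with the constant 1 kills the nonlocal term and forces `f c = c`.
  have hone : MemHs Ω s (fun _ => 1) := by
    refine ⟨aemeasurable_const, ?_, ?_⟩
    · have : gagliardoIntegrand (N := N) s (fun _ => 1) (fun _ => 1) = fun _ => 0 :=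
        funext (hgone _)
      rw [this]; exact integrableOn_zero
    · exact integrable_const _
  have hconst : ∀ g : ℝ → ℝ, ∫ x in Ω, g (u x) = volume.real Ω * g c := fun g => by
    rw [integral_congr_ae (hc.mono fun x hx => by simp only [hx] : (fun x => g (u x)) =ᵐ[_] fun _ => g c)]
    simp
  have h1 := hu.2 _ hone
  simp only [innerHs, hgone, integral_zero, mul_zero, zero_add, mul_one] at h1
  rw [hconst (fun t => t), hconst f] at h1
  have hfc : f c = c := by
    have : volume.real Ω * (c - f c) = 0 := by linarith
    linarith [(mul_eq_zero.1 this).resolve_left hV.ne']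
  have hF := hconst (primitive f)
  rcases le_or_gt c 0 with h0 | h0
  · left
    have hc0 : c = 0 := by rw [← hfc, hf0 c h0]
    rw [energy_eq, hu.innerHs_self, hF, hconst (fun t => f t * t), hc0]
    simp
  · right
    -- Only an inequality for the energy: `u` may vary outside `Ω`, which contributes a nonnegative
    -- seminorm.
    refine ⟨h0, hfc, ?_⟩
    rw [energy_eq, hF, innerHs, hconst (fun t => t * t)]
    have h2 := setIntegral_gagliardoIntegrand_nonneg (Ω := Ω) (s := s) (u := u)
    have h3 : 0 ≤ fracConst N s * ε ^ (2 * s) / 2 *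
      ∫ z in crossRegion Ω, gagliardoIntegrand s u u z := by positivity
    nlinarith

end WeakSolutions

/-! ### Existence by mountain pass, and the tent function as direction. -/

section Existence

open scoped RealInnerProductSpace

variable {N : ℕ} {Ω : Set (EuclideanSpace ℝ (Fin N))} {s ε p θ c : ℝ} {f : ℝ → ℝ}
  {u v : EuclideanSpace ℝ (Fin N) → ℝ}

lemma IsRep.smul {k : ℝ} {x : PairSpace Ω} (hx : IsRep s k x u) (a : ℝ) :
    IsRep s k (a • x) (a • u) := by
  refine ⟨hx.1.const_smul a, ?_, ?_⟩
  · rw [WithLp.smul_fst]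
    filter_upwards [hx.2.1, Lp.coeFn_smul a x.fst] with z h1 h2
    rw [h2, diffQuotient_smul, Pi.smul_apply, h1, smul_eq_mul]
  · rw [WithLp.smul_snd]
    filter_upwards [hx.2.2, Lp.coeFn_smul a x.snd] with z h1 h2
    rw [h2, Pi.smul_apply, Pi.smul_apply, h1]

lemma IsRep.inner_eq_innerHs (hk : 0 ≤ fracConst N s * ε ^ (2 * s) / 2) {x y : PairSpace Ω}
    (hx : IsRep s (fracConst N s * ε ^ (2 * s) / 2) x u)
    (hy : IsRep s (fracConst N s * ε ^ (2 * s) / 2) y v) : ⟪x, y⟫ = innerHs Ω s ε u v :=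
  hx.inner_eq hk hy

lemma IsRep.energy_eq (hk : 0 ≤ fracConst N s * ε ^ (2 * s) / 2) {x : PairSpace Ω}
    (hx : IsRep s (fracConst N s * ε ^ (2 * s) / 2) x u) :
    ‖x‖ ^ 2 / 2 - ∫ w in Ω, primitive f (x.snd w) = energy Ω s ε f u := by
  rw [FracNeumann.energy_eq, ← hx.inner_eq_innerHs hk hx, real_inner_self_eq_norm_sq]
  congr 1
  exact integral_congr_ae (hx.2.2.mono fun w hw => by simp only [hw])

/-- A weak solution of mountain pass type, given a direction along which the energy becomes
negative. -/
theorem exists_weakSolution (hs : 0 < s) (hk : 0 < fracConst N s) (hε : 0 < ε) (hc : 0 < c)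
    (hd : HasMeasureDensity Ω c) (hΩm : MeasurableSet Ω) (hb : Bornology.IsBounded Ω)
    (hΩ0 : volume Ω ≠ 0) (hS : SobolevEmbedding Ω s p) (hp : 2 < p)
    (hfc : Continuous f) (hf0 : ∀ t, t ≤ 0 → f t = 0)
    (h0 : Tendsto (fun t => f t / t) (𝓝[>] 0) (𝓝 0))
    (hinf : Tendsto (fun t => f t / t ^ (p - 1)) atTop (𝓝 0))
    (hθ : 2 < θ) (hAR : ∀ t, 0 < t → θ * primitive f t ≤ t * f t) {B : ℝ} (hv : MemHs Ω s v)
    (he : energy Ω s ε f v < 0)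
    (hB : ∀ τ ∈ Icc (0 : ℝ) 1, energy Ω s ε f (τ • v) ≤ B) :
    ∃ u, IsWeakSolution Ω s ε f u ∧ 0 < energy Ω s ε f u ∧ energy Ω s ε f u ≤ B := by
  have hfin : IsFiniteMeasure (volume.restrict Ω) := ⟨by simpa using hb.measure_lt_top⟩
  set k := fracConst N s * ε ^ (2 * s) / 2 with hk_def
  have hk' : 0 < k := by positivity
  have hclosed := isClosed_hsSubmodule (s := s) hk' hΩm hΩ0
  have : CompleteSpace (hsSubmodule Ω s k) := hclosed.completeSpace_coe
  let T : hsSubmodule Ω s k →L[ℝ] Lp ℝ 2 (volume.restrict Ω) :=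
    (WithLp.sndL 2 ℝ _ _).comp (hsSubmodule Ω s k).subtypeL
  have hTx : ∀ x : hsSubmodule Ω s k, T x = (x : PairSpace Ω).snd := fun _ => rfl
  have hsq : ∀ (x : hsSubmodule Ω s k) (u : EuclideanSpace ℝ (Fin N) → ℝ),
      IsRep s k (x : PairSpace Ω) u →
      ‖x‖ ^ 2 = k * (∫ z in crossRegion Ω, gagliardoIntegrand s u u z) + ∫ w in Ω, u w * u w := by
    intro x u hu
    rw [← hu.inner_eq hk'.le hu, real_inner_self_eq_norm_sq, Submodule.coe_norm]
  have hgag : ∀ x, ∫⁻ w in Ω, localEnergy Ω s (T x) w ≤ ENNReal.ofReal (k⁻¹ * ‖x‖ ^ 2) := by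
    intro x
    obtain ⟨u, hu⟩ := x.2
    rw [hTx, lintegral_localEnergy_congr hu.2.2]
    refine (hu.memHs hk').lintegral_localEnergy_le.trans (ENNReal.ofReal_le_ofReal ?_)
    rw [hsq x u hu, mul_add, inv_mul_cancel_left₀ hk'.ne']
    have : 0 ≤ ∫ w in Ω, u w * u w := integral_nonneg fun x => mul_self_nonneg _
    have : 0 ≤ k⁻¹ * ∫ w in Ω, u w * u w := by positivity
    linarith
  have hL2 : ∀ x, ∫ w in Ω, T x w ^ 2 ≤ ‖x‖ ^ 2 := by
    intro x
    obtain ⟨u, hu⟩ := x.2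
    have h1 := setIntegral_gagliardoIntegrand_nonneg (Ω := Ω) (s := s) (u := u)
    have h2 : ∫ w in Ω, T x w ^ 2 = ∫ w in Ω, u w * u w :=
      integral_congr_ae (hu.2.2.mono fun w hw => by simp only [hTx, hw, sq])
    rw [h2, hsq x u hu]
    have := mul_nonneg hk'.le h1
    linarith
  obtain ⟨A, hA, hS⟩ := hS
  -- With this factor `h = K * ‖x‖` dominates both the `L²` norm and the local energy, the latter
  -- being at most `k⁻¹ * ‖x‖ ^ 2`.
  set K := max 1 (Real.sqrt k⁻¹) with hK
  have hK1 : 1 ≤ K := le_max_left _ _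
  have hKk : k⁻¹ ≤ K ^ 2 := by
    rw [← Real.sq_sqrt (inv_pos.2 hk').le]
    exact pow_le_pow_left₀ (Real.sqrt_nonneg _) (le_max_right _ _) 2
  have hLp : ∀ x, Integrable (fun w => |T x w| ^ p) (volume.restrict Ω) ∧
      ∫ w in Ω, |T x w| ^ p ≤ (A * K) ^ p * ‖x‖ ^ p := by
    intro x
    rcases eq_or_ne x 0 with rfl | hx
    · have h1 : (fun w => |T 0 w| ^ p) =ᵐ[volume.restrict Ω] fun _ => 0 := by
        rw [map_zero]
        filter_upwards [Lp.coeFn_zero ℝ 2 (volume.restrict Ω)] with w hw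
        rw [hw]
        simp [Real.zero_rpow (by linarith : p ≠ 0)]
      refine ⟨(integrable_zero _ _ _).congr h1.symm, ?_⟩
      rw [integral_congr_ae h1]
      simp only [integral_zero]
      positivity
    · have hx0 : 0 < ‖x‖ := norm_pos_iff.2 hx
      have hle : ∀ a, a ≤ K ^ 2 → a * ‖x‖ ^ 2 ≤ (K * ‖x‖) ^ 2 := fun a ha => by
        rw [mul_pow]; gcongr
      have h1 := SobolevEmbedding.integrable_and_integral_le hA hS (h := K * ‖x‖) (by positivity)
        (Lp.aestronglyMeasurable (T x)).aemeasurable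
        ((hgag x).trans (ENNReal.ofReal_le_ofReal (hle _ hKk)))
        (integrable_sq_coeFn (T x))
        ((hL2 x).trans (by simpa using hle 1 (by nlinarith)))
      refine ⟨h1.1, h1.2.trans_eq ?_⟩
      rw [← mul_assoc, Real.mul_rpow (by positivity) (norm_nonneg _)]
  have hTc : IsCompactOperator T :=
    isCompactOperator_of_localEnergy_le hc hs hd hΩm hb T (inv_pos.2 hk').le hgag
  obtain ⟨e, hev⟩ := hv.exists_isRep hk'.le
  have hen : ∀ (x : hsSubmodule Ω s k) (u : EuclideanSpace ℝ (Fin N) → ℝ),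
      IsRep s k (x : PairSpace Ω) u →
      ‖x‖ ^ 2 / 2 - ∫ w in Ω, primitive f (T x w) = energy Ω s ε f u :=
    fun x u hu => hu.energy_eq hk'.le
  obtain ⟨x, hx1, hx2, hx3⟩ := exists_criticalPoint hTc hp (fun x => (hLp x).1)
    (fun x => (hLp x).2) (by positivity) hfc hf0 h0 hinf hθ hAR (e := e) (B := B)
    (by rw [hen e v hev]; exact he)
    (fun τ hτ => by rw [hen (τ • e) (τ • v) (hev.smul τ)]; exact hB τ hτ)
  obtain ⟨u, hu⟩ := x.2
  rw [hen x u hu] at hx2 hx3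
  refine ⟨u, ⟨hu.memHs hk', fun w hw => ?_⟩, hx2, hx3⟩
  obtain ⟨y, hy⟩ := hw.exists_isRep hk'.le
  have h1 : ⟪x, y⟫ = innerHs Ω s ε u w := hu.inner_eq_innerHs hk'.le hy
  have h2 : ∫ z in Ω, f (T x z) * T y z = ∫ z in Ω, f (u z) * w z := by
    refine integral_congr_ae ?_
    filter_upwards [hu.2.2, hy.2.2] with z h1 h2
    rw [hTx, hTx, h1, h2]
  rw [← h1, hx1 y, h2, sub_self]

/-- The energy of multiples of the tent functions. -/
lemma exists_energy_tent_le (hs0 : 0 < s) (hs1 : s < 1) (hN : 0 < N)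
    (hfc : Continuous f) (hf0 : ∀ t, t ≤ 0 → f t = 0) (hf : ∀ t, 0 ≤ f t) :
    ∃ A c : ℝ, 0 < A ∧ 0 < c ∧ ∀ (Ω : Set (EuclideanSpace ℝ (Fin N)))
      (x₀ : EuclideanSpace ℝ (Fin N)) (ε : ℝ), 0 < ε → volume Ω ≠ ⊤ → Metric.ball x₀ ε ⊆ Ω →
      MemHs Ω s (tent x₀ ε) ∧ ∀ τ : ℝ, 0 ≤ τ →
        energy Ω s ε f (τ • tent x₀ ε) ≤ ε ^ N * (A * τ ^ 2 - c * primitive f (τ / 2)) := by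
  obtain ⟨A, hA, hT⟩ := exists_tent_bound (s := s) hs0 hs1 hN
  have hk := fracConst_pos (N := N) hs0 hs1
  set b := volume.real (Metric.ball (0 : EuclideanSpace ℝ (Fin N)) 1) with hb
  have hb0 : 0 < b :=
    ENNReal.toReal_pos (Metric.measure_ball_pos _ _ one_pos).ne' measure_ball_lt_top.ne
  refine ⟨(fracConst N s / 2 + 1) * A, b / 2 ^ N, by positivity, by positivity, ?_⟩
  intro Ω x₀ ε hε hfin hball
  obtain ⟨h1, h2, h3⟩ := hT Ω x₀ ε hε
  refine ⟨h1, fun τ hτ => ?_⟩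
  have : IsFiniteMeasure (volume.restrict Ω) := ⟨by simpa using hfin.lt_top⟩
  have hF := monotone_primitive hfc hf
  have hF0 := primitive_nonneg hfc hf0 hf
  have e1 : ∀ z, gagliardoIntegrand s (τ • tent x₀ ε) (τ • tent x₀ ε) z =
      τ ^ 2 * gagliardoIntegrand s (tent x₀ ε) (tent x₀ ε) z := fun z => by
    simp only [gagliardoIntegrand, Pi.smul_apply, smul_eq_mul]; ring
  have e2 : ∀ x, (τ • tent x₀ ε) x * (τ • tent x₀ ε) x =
      τ ^ 2 * (tent x₀ ε x * tent x₀ ε x) := fun x => by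
    simp only [Pi.smul_apply, smul_eq_mul]; ring
  have hint : IntegrableOn (fun x => primitive f (τ * tent x₀ ε x)) Ω := by
    refine Integrable.mono' (integrable_const (primitive f τ))
      ((continuous_primitive hfc).comp
        (continuous_const.mul continuous_tent)).aestronglyMeasurable
      (Eventually.of_forall fun x => ?_)
    rw [Real.norm_eq_abs, abs_of_nonneg (hF0 _)]
    exact hF (mul_le_of_le_one_right hτ (tent_le_one hε _))
  have hlow : (ε / 2) ^ N * b * primitive f (τ / 2) ≤
      ∫ x in Ω, primitive f (τ * tent x₀ ε x) := by
    have hsub : Metric.ball x₀ (ε / 2) ⊆ Ω :=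
      (Metric.ball_subset_ball (by linarith)).trans hball
    calc (ε / 2) ^ N * b * primitive f (τ / 2)
        = ∫ x in Metric.ball x₀ (ε / 2), primitive f (τ / 2) := by
          rw [setIntegral_const, smul_eq_mul, hb, measureReal_def, measureReal_def,
            Measure.addHaar_ball_of_pos _ _ (by positivity : 0 < ε / 2), ENNReal.toReal_mul,
            finrank_euclideanSpace_fin, ENNReal.toReal_ofReal (by positivity)]
      _ ≤ ∫ x in Metric.ball x₀ (ε / 2), primitive f (τ * tent x₀ ε x) := by
          refine setIntegral_mono_on (by simp [integrableOn_const_iff, measure_ball_lt_top])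
            (hint.mono_set hsub) measurableSet_ball fun x hx => hF ?_
          have := half_le_tent hε hx
          nlinarith
      _ ≤ _ := setIntegral_mono_set hint (Eventually.of_forall fun x => hF0 _)
          hsub.eventuallyLE
  rw [energy_eq, innerHs]
  simp only [e1, e2, integral_const_mul]
  simp only [Pi.smul_apply, smul_eq_mul]
  have e3 : (ε / 2) ^ N * b = ε ^ N * (b / 2 ^ N) := by rw [div_pow]; ring
  rw [e3] at hlow
  have h4 := mul_le_mul_of_nonneg_left h2 (by positivity : 0 ≤ fracConst N s * τ ^ 2)
  have h5 := mul_le_mul_of_nonneg_left h3 (by positivity : 0 ≤ τ ^ 2)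
  have h6 : 0 ≤ A * ε ^ N := by positivity
  have h7 := mul_nonneg hk.le (sq_nonneg τ)
  have h8 := mul_nonneg h7 h6
  have h9 := mul_nonneg (sq_nonneg τ) h6
  nlinarith

/-- Superhomogeneity gives `F(t) ≥ t^θ F(1)` for `t ≥ 1`, which beats any quadratic. The scale
depends on neither `ε` nor the centre. -/
lemma exists_scale_neg (hfc : Continuous f) (hf0 : ∀ t, t ≤ 0 → f t = 0) (hθ : 2 < θ)
    (hAR : ∀ t, 0 < t → θ * primitive f t ≤ t * f t) (hF1 : 0 < primitive f 1)
    {A : ℝ} (hc : 0 < c) : ∃ t : ℝ, 0 < t ∧ A * t ^ 2 - c * primitive f (t / 2) < 0 := by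
  have h1 : Tendsto (fun t : ℝ => t ^ (θ - 2)) atTop atTop := tendsto_rpow_atTop (by linarith)
  obtain ⟨t, ht, ht1⟩ :=
    ((h1.eventually_gt_atTop (4 * A / (c * primitive f 1))).and (eventually_ge_atTop 1)).exists
  have ht0 : 0 < t := by linarith
  refine ⟨2 * t, by linarith, ?_⟩
  have h2 := rpow_mul_primitive_le hfc hf0 hAR ht1 1
  rw [mul_one] at h2
  have h3 : t ^ θ = t ^ (θ - 2) * t ^ 2 := by
    rw [← Real.rpow_natCast, ← Real.rpow_add ht0]; norm_num
  rw [div_lt_iff₀ (by positivity)] at ht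
  have h4 : 2 * t / 2 = t := by ring
  rw [h4]
  have h5 := mul_le_mul_of_nonneg_left h2 hc.le
  have h6 := mul_lt_mul_of_pos_right ht (by positivity : 0 < t ^ 2)
  rw [h3] at h5
  nlinarith

end Existence

/-! ### Consequences of the assumptions on `f`, and the theorem. -/

section Main

variable {N : ℕ} {Ω : Set (EuclideanSpace ℝ (Fin N))} {s θ : ℝ} {f : ℝ → ℝ}
  {u : EuclideanSpace ℝ (Fin N) → ℝ}

lemma Nonlinearity.eq_zero_of_nonpos (hf : Nonlinearity N s 0 f) : ∀ t, t ≤ 0 → f t = 0 :=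
  fun _ ht => FracNeumann.eq_zero_of_nonpos hf.continuous hf.f1.1 ht

lemma Nonlinearity.nonneg (hf : Nonlinearity N s 0 f) (t : ℝ) : 0 ≤ f t := by
  rcases le_or_gt t 0 with h | h
  · exact (hf.eq_zero_of_nonpos t h).ge
  · exact (hf.f1.2 t h).le

/-- The nonzero constant solutions have energy density bounded below. -/
lemma Nonlinearity.exists_le_of_fixed (hf : Nonlinearity N s 0 f) :
    ∃ m : ℝ, 0 < m ∧ ∀ c, 0 < c → f c = c → m ≤ c ^ 2 / 2 - primitive f c := by
  refine ⟨_, hf.f5, fun c hc hfc => csInf_le ?_ ⟨c, ⟨hc, hfc⟩, rfl⟩⟩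
  -- A set of reals not bounded below has `sInf` equal to 0 by convention, so positivity in `f5`
  -- forces boundedness below.
  by_contra h
  exact hf.f5.ne' (Real.sInf_of_not_bddBelow h)

/-- For a weak solution the energy is `½ ∫ f(u) u - ∫ F(u)`, which is at least `(½ - 1/θ) ∫ f(u) u`.
-/
theorem IsWeakSolution.integral_le_of_energy_le {ε K : ℝ}
    (hθ : 2 < θ) (hAR : ∀ t, θ * primitive f t ≤ f t * t)
    (hu : IsWeakSolution Ω s ε f u) (hF : IntegrableOn (fun x => primitive f (u x)) Ω)
    (hfu : IntegrableOn (fun x => f (u x) * u x) Ω) (hK : energy Ω s ε f u ≤ K) :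
    ∫ x in Ω, f (u x) * u x ≤ 2 * θ / (θ - 2) * K := by
  have h1 : θ * ∫ x in Ω, primitive f (u x) ≤ ∫ x in Ω, f (u x) * u x := by
    rw [← integral_const_mul]
    exact integral_mono (hF.const_mul θ) hfu fun x => hAR _
  rw [energy_eq, hu.innerHs_self] at hK
  have hθ' : 0 < θ - 2 := by linarith
  rw [div_mul_eq_mul_div, le_div_iff₀ hθ']
  have h2 := mul_le_mul_of_nonneg_left hK (by linarith : 0 ≤ 2 * θ)
  nlinarith

end Main

end FracNeumann

end

theorem mainTheorem3 (N : ℕ) (s : ℝ) (hs0 : 0 < s) (hs1 : s < 1) (hN : 2 * s < (N : ℝ))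
    (Ω : Set (EuclideanSpace ℝ (Fin N))) (hΩ : FracNeumann.IsSmoothBoundedDomain Ω)
    (f : ℝ → ℝ) (hf : FracNeumann.Nonlinearity N s 0 f) :
    (∃ C : ℝ, 0 < C ∧ ∃ ε₀ : ℝ, 0 < ε₀ ∧ ∀ ε : ℝ, 0 < ε → ε < ε₀ →
      ∃ u : EuclideanSpace ℝ (Fin N) → ℝ,
        FracNeumann.IsWeakSolution Ω s ε f u ∧
        (∀ᵐ x, 0 ≤ u x) ∧
        (¬ ∃ c : ℝ, ∀ᵐ x ∂(volume.restrict Ω), u x = c) ∧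
        FracNeumann.energy Ω s ε f u ≤ C * ε ^ N) ∧
    (∀ ε : ℝ, 0 < ε → ∀ u : EuclideanSpace ℝ (Fin N) → ℝ,
      FracNeumann.IsWeakSolution Ω s ε f u →
        IntegrableOn (fun x => FracNeumann.primitive f (u x)) Ω ∧
        IntegrableOn (fun x => f (u x) * u x) Ω ∧
        FracNeumann.normHs Ω s ε u ^ 2 = ∫ x in Ω, f (u x) * u x) ∧
    (∀ C : ℝ, 0 < C → ∃ K₀ : ℝ, 0 < K₀ ∧ ∀ ε : ℝ, 0 < ε →
      ∀ u : EuclideanSpace ℝ (Fin N) → ℝ,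
        FracNeumann.IsWeakSolution Ω s ε f u →
        FracNeumann.energy Ω s ε f u ≤ C * ε ^ N →
          ∫ x in Ω, f (u x) * u x ≤ K₀ * ε ^ N) := by
  have hN0 : 0 < N := by
    have : (0 : ℝ) < N := by linarith
    exact_mod_cast this
  have hfc := hf.continuous
  have hf0 := hf.eq_zero_of_nonpos
  have hfnn := hf.nonneg
  have h0 := hf.f2.1
  obtain ⟨p, hp, hpc, hinf⟩ := hf.f2.2
  obtain ⟨θ, hθ, hAR'⟩ := hf.f4
  have hAR : ∀ t, 0 < t → θ * FracNeumann.primitive f t ≤ t * f t :=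
    fun t ht => (hAR' t ht ht.le).2
  have hFpos : ∀ t, 0 < t → 0 < FracNeumann.primitive f t :=
    fun t ht => pos_of_mul_pos_right (hAR' t ht ht.le).1 (by linarith)
  have hAR'' : ∀ t, θ * FracNeumann.primitive f t ≤ f t * t := fun t => by
    rcases le_or_gt t 0 with h | h
    · rw [FracNeumann.primitive_of_nonpos hf0 h, hf0 t h]; simp
    · rw [mul_comm (f t)]; exact hAR t h
  obtain ⟨m, hm, hmc⟩ := hf.exists_le_of_fixed
  have hk := FracNeumann.fracConst_pos (N := N) hs0 hs1
  have hΩm := hΩ.isOpen.measurableSet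
  have hΩ0 : volume Ω ≠ 0 := (hΩ.isOpen.measure_pos volume hΩ.isConnected.nonempty).ne'
  have hΩtop : volume Ω ≠ ⊤ := hΩ.isBounded.measure_lt_top.ne
  have hV : 0 < volume.real Ω := ENNReal.toReal_pos hΩ0 hΩtop
  obtain ⟨c, hc, hd⟩ := hΩ.exists_measure_ball_inter_ge
  have hS : FracNeumann.SobolevEmbedding Ω s p :=
    FracNeumann.sobolevEmbedding_of_lt hs0 hN hc hd hΩm hΩtop hp.le hpc
  obtain ⟨C₀, hC₀, hfC₀⟩ := FracNeumann.exists_growth hfc hf0 h0 hinf one_pos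
  have hint : ∀ u, FracNeumann.MemHs Ω s u →
      IntegrableOn (fun x => FracNeumann.primitive f (u x)) Ω ∧
        IntegrableOn (fun x => f (u x) * u x) Ω :=
    fun u hu => hu.integrableOn_superposition hS hp hfc hC₀ hfC₀
  refine ⟨?_, ?_, ?_⟩
  · obtain ⟨A, b, hA, hb, htent⟩ :=
      FracNeumann.exists_energy_tent_le (N := N) hs0 hs1 hN0 hfc hf0 hfnn
    obtain ⟨t, ht, htneg⟩ := FracNeumann.exists_scale_neg (A := A) hfc hf0 hθ hAR
      (hFpos 1 one_pos) hb
    obtain ⟨x₀, hx₀⟩ := hΩ.isConnected.nonempty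
    obtain ⟨r, hr, hball⟩ := Metric.isOpen_iff.1 hΩ.isOpen x₀ hx₀
    have hC : 0 < A * t ^ 2 := by positivity
    -- The first bound fits the support of the tent into `Ω`, the second gives `ε^N ≤ ε`, and the
    -- third puts the mountain pass level below `|Ω| m`, the least energy of a positive constant
    -- solution.
    refine ⟨A * t ^ 2, hC, min r (min 1 (volume.real Ω * m / (A * t ^ 2))), by positivity, ?_⟩
    intro ε hε hε'
    obtain ⟨hεr, hε'⟩ := lt_min_iff.1 hε'
    obtain ⟨hε1, hεm⟩ := lt_min_iff.1 hε'
    obtain ⟨hmem, hen⟩ := htent Ω x₀ ε hε hΩtop ((Metric.ball_subset_ball hεr.le).trans hball)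
    have hεN : 0 < ε ^ N := by positivity
    have htmem : FracNeumann.MemHs Ω s (t • FracNeumann.tent x₀ ε) := by
      obtain ⟨x, hx⟩ := hmem.exists_isRep (k := 1) zero_le_one
      exact (hx.smul t).memHs one_pos
    obtain ⟨u, hu, hu1, hu2⟩ := FracNeumann.exists_weakSolution hs0 hk hε hc hd hΩm hΩ.isBounded
      hΩ0 hS hp hfc hf0 h0 hinf hθ hAR (B := A * t ^ 2 * ε ^ N) htmem
      ((hen t ht.le).trans_lt (mul_neg_of_pos_of_neg hεN htneg)) (fun τ hτ => by
        rw [smul_smul]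
        refine (hen (τ * t) (mul_nonneg hτ.1 ht.le)).trans ?_
        rw [mul_comm _ (ε ^ N)]
        refine mul_le_mul_of_nonneg_left ?_ hεN.le
        have h1 := FracNeumann.primitive_nonneg hfc hf0 hfnn (τ * t / 2)
        have h2 : (τ * t) ^ 2 ≤ t ^ 2 :=
          pow_le_pow_left₀ (mul_nonneg hτ.1 ht.le) (mul_le_of_le_one_left ht.le hτ.2) 2
        have h3 := mul_le_mul_of_nonneg_left h2 hA.le
        have h4 := mul_nonneg hb.le h1
        linarith)
    refine ⟨u, hu, hu.ae_nonneg hk hε hΩm hΩ0 hf0, ?_, hu2⟩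
    rintro ⟨a, ha⟩
    rcases hu.energy_of_ae_const hk hε hΩ0 hΩtop hf0 ha with h | ⟨ha0, hfa, h⟩
    · exact hu1.ne' h
    · have h1 := mul_le_mul_of_nonneg_left (hmc a ha0 hfa) hV.le
      have h2 : ε ^ N ≤ ε := pow_le_of_le_one hε.le hε1.le hN0.ne'
      rw [lt_div_iff₀ hC] at hεm
      have h3 := mul_le_mul_of_nonneg_left h2 hC.le
      linarith
  · intro ε hε u hu
    exact ⟨(hint u hu.1).1, (hint u hu.1).2, hu.normHs_sq hk.le hε⟩
  · intro C hC
    have hθ' : 0 < θ - 2 := by linarith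
    refine ⟨2 * θ / (θ - 2) * C, by positivity, fun ε hε u hu hE => ?_⟩
    rw [mul_assoc]
    exact hu.integral_le_of_energy_le hθ hAR'' (hint u hu.1).1 (hint u hu.1).2 hE
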